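/- **Model.** Fix constants $0<\varepsilon<1$, $R,P>0$, $1\le\lambda<\zeta$, $C_0>0$, $\rho_c\ge 0$, $I_c,I_{ack},I_{cd}>0$, $\phi_0\ge 1$, $h_1,h_2>1$, $\rho>1$. A (static) network is a finite metric space $(V,d)$ with $n=|V|\ge 1$ nodes and $(\varepsilon R/8,\lambda)$-bounded independence: with $r=\varepsilon R/8$, for every $q\ge 1$ and every ball $D$ of radius $qr$, every set of nodes whose $r$-balls are pairwise disjoint and contained in $D$ has at most $C_0q^\lambda$ elements (balls are open, and are sets of nodes). The communication graph $G$ joins distinct nodes at distance at most $(1-\varepsilon)R$; it is assumed to be connected, with diameter $D_G$. Time proceeds in synchronous rounds and all nodes start simultaneously (spontaneous mode). In round $t$, each node $v$ transmits, independently of the other nodes given the past, with a probability $p_t(v)$ determined by its current local state. If $S$ is the set of transmitters, the interference at $u$ is $\sum_{w\in S\setminus\{u\}}P/d(w,u)^\zeta$. An adaptive, possibly randomized adversary, which knows the past and $S$, decides who receives which transmissions and what the nodes sense, subject only to the following rules. * *Clear channel.* If $u\in S$, no other $w\in S$ has $d(w,u)<\rho_cR$, and the interference at $u$ is at most $I_c$,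 then every node $v\neq u$ with $d(u,v)\le(1-\varepsilon/2)R$ receives $u$'s transmission. * *ACK.* If $u\in S$ and all nodes $v\ne u$ with $d(u,v)\le (1-\varepsilon/2)R$ receive $u$'s transmission and the interference at $u$ is at most $I_{ack}$, then $u$'s ACK outcome is $1$; if some such $v$ does not receive it, the outcome is $0$. * *NTD.* The NTD outcome of $v$ is $1$ exactly if $v$ receives the transmission of some $u$ with $d(u,v)<\varepsilon R/4$. * *CD.* Each node senses Busy or Idle. Conditionally on the past: (i) for every node $v$ and $\phi>\phi_0$, if $\sum_{w:\,d(w,v)<R/2}p_t(w)>\phi$, then with probability at least $1-h_1^{-\phi}$ all nodes $w$ with $d(w,v)<R/2$ sense Busy; (ii) for every node $v$ and $\eta>0$, if $\sum_{w:\,d(w,v)<\rho R}p_t(w)\le\eta$, then, given that the interference at $v$ from the transmitters at distance at least $\rho R$ is less than $I_{cd}$, $v$ senses Idle with probability at least $h_2^{-\eta}$. An algorithm is *uniform* if all nodes run the same program, which depends only on the constants of the model; initially a node knows only whether it is the source, and after each round it updates its state from whether it transmitted, the packets it received, and its CD, ACK and NTD outcomes. Packets carry a control symbol from a fixed finite alphabet,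 and packets sent by nodes that hold the source's message also carry this message. Initially only the source holds the message; a node gets it by receiving a packet from a node that holds it. **Theorem.** For every choice of the constants of the model there is a uniform algorithm (in particular, one that does not know $n$) that performs broadcast in $O(D_G+\log n)$ rounds with high probability. That is, for every $k\in\mathbb N$ there is $C>0$, depending only on $k$ and the constants of the model, such that for every network as above, every source and every adversary obeying the rules, and every integer $T\ge C(D_G+\log n)$, all nodes hold the message after $T$ rounds with probability at least $1-n^{-k}$. -/

import Mathlib

open scoped NNReal ENNReal

noncomputable section

namespace WirelessBroadcast

/-- The constants of the communication model. None of them depends on the network or on the number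
of nodes. The signal of a transmitting node `u` has strength `P / d(u,v)^ζ` at `v`. The constants
`ρc`, `Ic` (clear channel) and `Iack` (acknowledgement) belong to the precision `ε / 2`. -/
structure Model where
  /-- precision: nodes at distance at most `(1 - ε) R` are neighbours -/
  ε : ℝ
  /-- maximum transmission distance -/
  R : ℝ
  /-- transmission power -/
  P : ℝ
  /-- metricity (path loss exponent) -/
  ζ : ℝ
  /-- growth exponent of the bounded independence property -/
  lam : ℝ
  /-- leading constant of the bounded independence property -/
  Cind : ℝ
  /-- radius (in units of `R`) of the zone that has to be silent on a clear channel -/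
  ρc : ℝ
  /-- interference tolerated on a clear channel -/
  Ic : ℝ
  /-- interference up to which a successful transmission is sure to be acknowledged -/
  Iack : ℝ
  /-- contention from which on contention detection is reliable -/
  φ₀ : ℝ
  /-- base of the failure probability of the detection of a busy channel -/
  h₁ : ℝ
  /-- base of the success probability of the detection of an idle channel -/
  h₂ : ℝ
  /-- radius of the vicinity (in units of `R`) in contention detection -/
  ρ : ℝ
  /-- outside interference tolerated in the detection of an idle channel -/
  Icd : ℝ
  ε_pos : 0 < ε
  ε_lt_one : ε < 1
  R_pos : 0 < R
  P_pos : 0 < P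
  one_le_lam : 1 ≤ lam
  lam_lt_ζ : lam < ζ
  Cind_pos : 0 < Cind
  ρc_nonneg : 0 ≤ ρc
  Ic_pos : 0 < Ic
  Iack_pos : 0 < Iack
  one_le_φ₀ : 1 ≤ φ₀
  one_lt_h₁ : 1 < h₁
  one_lt_h₂ : 1 < h₂
  one_lt_ρ : 1 < ρ
  Icd_pos : 0 < Icd

/-! ### Static networks -/

/-- `S` is an `r`-packing of `D`: the balls of radius `r` around the nodes of `S` are contained in
`D` and pairwise disjoint. Balls are sets of nodes. -/
def IsPacking {V : Type} [MetricSpace V] (r : ℝ) (S : Finset V) (D : Set V) : Prop :=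
  (∀ u ∈ S, Metric.ball u r ⊆ D) ∧
    (S : Set V).PairwiseDisjoint fun u => Metric.ball u r

/-- `(r, lam)`-bounded independence with leading constant `C`. -/
def BoundedIndependence (V : Type) [MetricSpace V] (r lam C : ℝ) : Prop :=
  ∀ q : ℝ, 1 ≤ q → ∀ v : V, ∀ S : Finset V,
    IsPacking r S (Metric.ball v (q * r)) → (S.card : ℝ) ≤ C * q ^ lam

/-- The communication graph: distinct nodes are adjacent iff they are at distance at most
`(1 - ε) R`. -/
def commGraph (M : Model) (V : Type) [MetricSpace V] : SimpleGraph V where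
  Adj u v := u ≠ v ∧ dist u v ≤ (1 - M.ε) * M.R
  symm := ⟨fun u v h => ⟨h.1.symm, by rw [dist_comm]; exact h.2⟩⟩
  loopless := ⟨fun _ h => h.1 rfl⟩

/-! ### Algorithms -/

/-- What a node learns in a round. -/
structure Observation (Msg : Type) where
  /-- whether the node itself transmitted -/
  sent : Bool
  /-- the packets received: a control message, and whether the packet carries the broadcast
  message -/
  received : Set (Msg × Bool)
  /-- contention detection: `true` is a busy channel, `false` is an idle channel -/
  busy : Bool
  /-- successful transmission detection (not meaningful unless the node transmitted) -/
  ack : Bool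
  /-- near transmission detection -/
  ntd : Bool

/-- A uniform distributed algorithm. All nodes run the same program, which depends neither on the
network nor on the number of nodes. Initially a node only knows whether it is the source. In every
round it transmits with a probability determined by its current state, and then it updates its
state from what it has observed. Control messages come from a fixed finite alphabet; in addition,
every transmission of a node that holds the broadcast message carries that message. -/
structure Algorithm where
  State : Type
  Msg : Type
  finite_msg : Finite Msg
  init : Bool → State
  prob : State → ℝ≥0
  prob_le_one : ∀ q, prob q ≤ 1
  msg : State → Msg
  next : State → Observation Msg → State

/-! ### Executions -/

/-- The part of a round that is not decided by the nodes. -/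
structure Outcome (V : Type) where
  /-- `received v` is the set of the nodes whose transmission is received by `v` -/
  received : V → Finset V
  ack : V → Bool
  busy : V → Bool

/-- The rounds that have passed, the most recent one first: the set of transmitting nodes and the
outcome of each round. -/
abbrev History (V : Type) := List (Finset V × Outcome V)

/-- An adaptive adversary: it knows the history and the set of the nodes that transmit in the
current round, and determines the outcome of the round, possibly at random. -/
abbrev Adversary (V : Type) := History V → Finset V → PMF (Outcome V)

/-- The nodes that hold the broadcast message after a history, when `s` is the source. -/
def informed {V : Type} (s : V) : History V → Set V
  | [] => {s}
  | (_, o) :: h => {v | v ∈ informed s h ∨ ∃ u ∈ o.received v, u ∈ informed s h}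

open Classical in
/-- The states of the nodes after a history, when `s` is the source. All nodes start
simultaneously. Near transmission detection at precision `ε / 2` reports whether the node has
received the transmission of a node at distance less than `ε R / 4`. -/
def state {V : Type} [MetricSpace V] (M : Model) (A : Algorithm) (s : V) :
    History V → V → A.State
  | [], v => A.init (decide (v = s))
  | (S, o) :: h, v => A.next (state M A s h v)
      { sent := decide (v ∈ S)
        received := {x | ∃ u ∈ o.received v,
          x = (A.msg (state M A s h u), decide (u ∈ informed s h))}
        busy := o.busy v
        ack := o.ack v
        ntd := decide (∃ u ∈ o.received v, dist u v < M.ε / 4 * M.R) }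

open Classical in
/-- The law of the random set that contains every `v` independently with probability `p v`. -/
def independentSet {V : Type} [Fintype V] (p : V → ℝ≥0) (hp : ∀ v, p v ≤ 1) : PMF (Finset V) :=
  PMF.ofFintype (fun S => (∏ v ∈ S, (p v : ℝ≥0∞)) * ∏ v ∈ Finset.univ \ S, (1 - (p v : ℝ≥0∞))) <| by
    have h := Finset.prod_add (fun v => (p v : ℝ≥0∞)) (fun v => 1 - (p v : ℝ≥0∞)) Finset.univ
    rw [Finset.powerset_univ] at h
    rw [← h]
    refine Finset.prod_eq_one fun v _ => add_tsub_cancel_of_le ?_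
    exact_mod_cast hp v

section Execution

variable {V : Type} [Fintype V] [MetricSpace V] (M : Model) (A : Algorithm) (s : V)

/-- The probability with which `v` transmits in the round after the history `h`. -/
def transmitProb (h : History V) (v : V) : ℝ≥0 := A.prob (state M A s h v)

/-- The law of the round after the history `h`: the nodes transmit independently of one another,
then the adversary determines the outcome. -/
def roundLaw (adv : Adversary V) (h : History V) : PMF (Finset V × Outcome V) :=
  (independentSet (transmitProb M A s h) fun _ => A.prob_le_one _).bind fun S =>
    (adv h S).map fun o => (S, o)

/-- The law of the history of the first `t` rounds. -/
def law (adv : Adversary V) : ℕ → PMF (History V)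
  | 0 => PMF.pure []
  | t + 1 => (law adv t).bind fun h => (roundLaw M A s adv h).map fun x => x :: h

open Classical in
/-- The contention in a set `B` of nodes in the round after `h`. -/
def contention (h : History V) (B : Set V) : ℝ :=
  ∑ v with v ∈ B, (transmitProb M A s h v : ℝ)

end Execution

open Classical in
/-- The total interference at `u` that is caused by the nodes of `S` other than `u`. -/
def interference {V : Type} [MetricSpace V] (M : Model) (S : Finset V) (u : V) : ℝ :=
  ∑ w ∈ S.erase u, M.P / dist w u ^ M.ζ

open Classical in
/-- The interference at `v` that is caused by the nodes of `S` outside the vicinity of `v`. -/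
def outsideInterference {V : Type} [MetricSpace V] (M : Model) (S : Finset V) (v : V) : ℝ :=
  ∑ w ∈ S with w ∉ Metric.ball v (M.ρ * M.R), M.P / dist w v ^ M.ζ

/-- The transmission of `u` is received by all nodes at distance at most `(1 - ε/2) R` from `u`. -/
def MassDelivers {V : Type} [MetricSpace V] (M : Model) (o : Outcome V) (u : V) : Prop :=
  ∀ v, v ≠ u → dist u v ≤ (1 - M.ε / 2) * M.R → u ∈ o.received v

/-- The outcome `o` of a round in which exactly the nodes of `S` transmit obeys the rules of
communication and acknowledgement, at precision `ε / 2`. Everything else is up to the adversary. -/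
structure Legal {V : Type} [MetricSpace V] (M : Model) (S : Finset V) (o : Outcome V) : Prop where
  /-- only transmissions of other nodes are received -/
  received_sent : ∀ u v, u ∈ o.received v → u ∈ S ∧ u ≠ v
  /-- success on a clear channel -/
  succClear : ∀ u ∈ S, (∀ w ∈ S, w ≠ u → w ∉ Metric.ball u (M.ρc * M.R)) →
    interference M S u ≤ M.Ic → MassDelivers M o u
  /-- under low interference a transmission that reaches all neighbours is acknowledged -/
  ack_of_massDelivers : ∀ u ∈ S, MassDelivers M o u → interference M S u ≤ M.Iack → o.ack u = true
  /-- a transmission that misses a neighbour is not acknowledged -/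
  not_ack : ∀ u ∈ S, ¬ MassDelivers M o u → o.ack u = false

/-- Contention detection in the round after the history `h`. All probabilities are conditional on
`h`. -/
structure ContentionDetection {V : Type} [Fintype V] [MetricSpace V] (M : Model) (A : Algorithm)
    (s : V) (adv : Adversary V) (h : History V) : Prop where
  /-- under high contention in the close neighbourhood of `v`, all nodes there detect a busy channel
  with probability at least `1 - h₁ ^ (-φ)` -/
  busy : ∀ (v : V) (φ : ℝ), M.φ₀ < φ → φ < contention M A s h (Metric.ball v (M.R / 2)) →
    ENNReal.ofReal (1 - M.h₁ ^ (-φ)) ≤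
      (roundLaw M A s adv h).toOuterMeasure
        {x | ∀ w ∈ Metric.ball v (M.R / 2), x.2.busy w = true}
  /-- under low contention in the vicinity of `v`, given that the interference from outside the
  vicinity is low, `v` detects an idle channel with probability at least `h₂ ^ (-η)` -/
  idle : ∀ (v : V) (η : ℝ), 0 < η → contention M A s h (Metric.ball v (M.ρ * M.R)) ≤ η →
    ENNReal.ofReal (M.h₂ ^ (-η)) *
        (roundLaw M A s adv h).toOuterMeasure {x | outsideInterference M x.1 v < M.Icd} ≤
      (roundLaw M A s adv h).toOuterMeasure
        {x | outsideInterference M x.1 v < M.Icd ∧ x.2.busy v = false}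

/-- The adversary obeys the rules of the model after every history that can occur when the algorithm
`A` runs with source `s`. -/
def Admissible {V : Type} [Fintype V] [MetricSpace V] (M : Model) (A : Algorithm) (s : V)
    (adv : Adversary V) : Prop :=
  ∀ t, ∀ h ∈ (law M A s adv t).support,
    (∀ x ∈ (roundLaw M A s adv h).support, Legal M x.1 x.2) ∧ ContentionDetection M A s adv h

end WirelessBroadcast

end

/-! Winners of an election are acknowledged and hear no near transmission, hence they are pairwise
at distance at least εR/4. Bounded independence with λ < ζ then bounds both the number of winners in
a ball and the signal that they could cause from afar. In dissemination rounds a node transmits with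
half the frequency of its wins, so the probabilities are half a time average of indicators of
separated sets and obey the same bounds (`sum_wins_mul_le`, `moderate_dissemination`). In such a
`Moderate` environment some transmission near a node x reaches everything within (1 - ε/2)R, with
probability proportional to the total transmission probability near x (`le_roundLaw_clear`). If wins
near every node have constant frequency, the message thus advances by one hop with constant
probability per dissemination round, and a Chernoff bound along a shortest path gives D_G + log n.

It remains to see that every node is often notified by near winners (`le_hits`). The contention is
bounded on average: the potential 2^-(level+1) γ^pause drops whenever a high contention is detected,
is not raised by a notification because γ^S ≤ 2, and forgets its initial value in O(log n) rounds
(`lateContention_add_mass_le`). So most election rounds are moderate around x (`few_immoderate`). A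
moderate round with non-negligible contention near x produces a winner there with constant
probability, and a winner notifies its surroundings successfully with constant probability. Each
successful notification silences a ball for S election rounds, so for large S such rounds are rare
(`mul_notifications_le`). If x were notified rarely, it would seldom be paused, and in most of its
remaining rounds the surroundings would be quiet and x would sense an idle channel. Its level would
then decrease more often than it increases, which is impossible for a natural number.

The counting statements hold for each individual history (`Valid`). Randomness enters only through
conditional lower bounds on success probabilities, which `law_chernoff` turns into frequencies, and
through the exponential moment of undetected contention (`law_failedContention_le`). -/

set_option linter.unusedSectionVars false

noncomputable section

namespace WirelessBroadcast

/-! ### Expectations of `ℝ≥0∞`-valued functions -/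

/-- The expectation of `F` under `p`. -/
def mean {α : Type*} (p : PMF α) (F : α → ℝ≥0∞) : ℝ≥0∞ := ∑' a, p a * F a

section Mean

variable {α β : Type*}

lemma mean_pure (a : α) (F : α → ℝ≥0∞) : mean (PMF.pure a) F = F a := by
  unfold mean
  rw [tsum_eq_single a]
  · simp
  · intro b hb
    simp [PMF.pure_apply, hb]

lemma mean_bind (p : PMF α) (k : α → PMF β) (F : β → ℝ≥0∞) :
    mean (p.bind k) F = mean p fun a => mean (k a) F := by
  unfold mean
  simp only [PMF.bind_apply, ← ENNReal.tsum_mul_right, ← ENNReal.tsum_mul_left]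
  rw [ENNReal.tsum_comm]
  simp only [mul_assoc]

lemma mean_map (p : PMF α) (g : α → β) (F : β → ℝ≥0∞) :
    mean (p.map g) F = mean p fun a => F (g a) := by
  rw [← PMF.bind_pure_comp, mean_bind]
  simp [mean_pure]

lemma mean_mono {p : PMF α} {F G : α → ℝ≥0∞} (h : ∀ a ∈ p.support, F a ≤ G a) :
    mean p F ≤ mean p G := by
  refine ENNReal.tsum_le_tsum fun a => ?_
  by_cases ha : a ∈ p.support
  · gcongr
    exact h a ha
  · rw [PMF.mem_support_iff, not_not] at ha
    simp [ha]

lemma mean_congr {p : PMF α} {F G : α → ℝ≥0∞} (h : ∀ a ∈ p.support, F a = G a) :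
    mean p F = mean p G :=
  le_antisymm (mean_mono fun a ha => (h a ha).le) (mean_mono fun a ha => (h a ha).ge)

lemma mean_const (p : PMF α) (c : ℝ≥0∞) : mean p (fun _ => c) = c := by
  unfold mean
  rw [ENNReal.tsum_mul_right, PMF.tsum_coe, one_mul]

lemma mean_add (p : PMF α) (F G : α → ℝ≥0∞) :
    mean p (fun a => F a + G a) = mean p F + mean p G := by
  unfold mean
  simp only [mul_add]
  exact ENNReal.tsum_add

lemma mean_const_mul (p : PMF α) (c : ℝ≥0∞) (F : α → ℝ≥0∞) :
    mean p (fun a => c * F a) = c * mean p F := by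
  unfold mean
  rw [← ENNReal.tsum_mul_left]
  exact tsum_congr fun a => by ring

lemma toOuterMeasure_eq_mean (p : PMF α) (s : Set α) [DecidablePred (· ∈ s)] :
    p.toOuterMeasure s = mean p fun a => if a ∈ s then 1 else 0 := by
  rw [PMF.toOuterMeasure_apply]
  unfold mean
  refine tsum_congr fun a => ?_
  by_cases ha : a ∈ s <;> simp [ha]

/-- Markov's inequality: such an `F` dominates the indicator of the event on the support. -/
lemma toOuterMeasure_le_mean {p : PMF α} {s : Set α} {F : α → ℝ≥0∞}
    (h : ∀ a ∈ p.support, a ∈ s → 1 ≤ F a) : p.toOuterMeasure s ≤ mean p F := by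
  classical
  rw [toOuterMeasure_eq_mean]
  refine mean_mono fun a ha => ?_
  by_cases hs : a ∈ s
  · simpa [hs] using h a ha hs
  · simp [hs]

lemma toOuterMeasure_le_one (p : PMF α) (s : Set α) : p.toOuterMeasure s ≤ 1 := by
  refine (toOuterMeasure_le_mean (F := fun _ => 1) fun _ _ _ => le_rfl).trans ?_
  rw [mean_const]

lemma toOuterMeasure_mono_of_support {p : PMF α} {s t : Set α}
    (h : ∀ a ∈ p.support, a ∈ s → a ∈ t) : p.toOuterMeasure s ≤ p.toOuterMeasure t := by
  classical
  rw [toOuterMeasure_eq_mean p t]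
  refine toOuterMeasure_le_mean fun a ha hs => ?_
  simp [h a ha hs]

lemma toOuterMeasure_add_compl (p : PMF α) (s : Set α) :
    p.toOuterMeasure s + p.toOuterMeasure sᶜ = 1 := by
  classical
  rw [toOuterMeasure_eq_mean, toOuterMeasure_eq_mean, ← mean_add]
  conv_rhs => rw [← mean_const p 1]
  refine mean_congr fun a _ => ?_
  by_cases ha : a ∈ s <;> simp [ha]

lemma toOuterMeasure_compl_le {p : PMF α} {s : Set α} {q : ℝ}
    (h : ENNReal.ofReal (1 - q) ≤ p.toOuterMeasure s) :
    p.toOuterMeasure sᶜ ≤ ENNReal.ofReal q := by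
  have h1 := toOuterMeasure_add_compl p s
  have hs : p.toOuterMeasure s ≠ ⊤ := ((toOuterMeasure_le_one p s).trans_lt ENNReal.one_lt_top).ne
  have h2 : (1 : ℝ≥0∞) ≤ p.toOuterMeasure s + ENNReal.ofReal q := by
    calc (1 : ℝ≥0∞) = ENNReal.ofReal ((1 - q) + q) := by simp
      _ ≤ ENNReal.ofReal (1 - q) + ENNReal.ofReal q := ENNReal.ofReal_add_le
      _ ≤ _ := by gcongr
  rw [← h1] at h2
  exact (ENNReal.add_le_add_iff_left hs).1 h2

lemma le_toOuterMeasure_of_compl_le {p : PMF α} {s : Set α} {q : ℝ}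
    (h : p.toOuterMeasure sᶜ ≤ ENNReal.ofReal q) (hq : 0 ≤ q) :
    ENNReal.ofReal (1 - q) ≤ p.toOuterMeasure s := by
  have h1 := toOuterMeasure_add_compl p s
  rw [ENNReal.ofReal_sub _ hq, ENNReal.ofReal_one, tsub_le_iff_right, ← h1]
  gcongr

end Mean

/-! ### Sums along a history -/

/-- The sum of `f` over the rounds of a history. -/
def total {V : Type} (f : History V → Finset V × Outcome V → ℝ) : History V → ℝ
  | [] => 0
  | x :: h => total f h + f h x

section Total

variable {V : Type}

@[simp] lemma total_nil (f : History V → Finset V × Outcome V → ℝ) : total f [] = 0 := rfl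

@[simp] lemma total_cons (f : History V → Finset V × Outcome V → ℝ) (x : Finset V × Outcome V)
    (h : History V) : total f (x :: h) = total f h + f h x := rfl

open Classical in
/-- The indicator of a proposition. -/
def ind (p : Prop) : ℝ := if p then 1 else 0

lemma ind_pos {p : Prop} (h : p) : ind p = 1 := by simp [ind, h]

lemma ind_neg {p : Prop} (h : ¬ p) : ind p = 0 := by simp [ind, h]

lemma ind_nonneg (p : Prop) : 0 ≤ ind p := by
  unfold ind; split_ifs <;> norm_num

lemma ind_le_one (p : Prop) : ind p ≤ 1 := by
  unfold ind; split_ifs <;> norm_num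

lemma ind_mono {p q : Prop} (h : p → q) : ind p ≤ ind q := by
  by_cases hp : p
  · rw [ind_pos hp, ind_pos (h hp)]
  · rw [ind_neg hp]; exact ind_nonneg q

lemma total_mono {f g : History V → Finset V × Outcome V → ℝ} (hfg : ∀ h x, f h x ≤ g h x)
    (h : History V) : total f h ≤ total g h := by
  induction h with
  | nil => simp
  | cons x h ih => simpa using add_le_add ih (hfg h x)

lemma total_nonneg {f : History V → Finset V × Outcome V → ℝ} (hf : ∀ h x, 0 ≤ f h x)
    (h : History V) : 0 ≤ total f h := by
  induction h with
  | nil => simp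
  | cons x h ih => simpa using add_nonneg ih (hf h x)

lemma total_add (f g : History V → Finset V × Outcome V → ℝ) (h : History V) :
    total (fun h x => f h x + g h x) h = total f h + total g h := by
  induction h with
  | nil => simp
  | cons x h ih => simp only [total_cons, ih]; ring

lemma total_sub (f g : History V → Finset V × Outcome V → ℝ) (h : History V) :
    total (fun h x => f h x - g h x) h = total f h - total g h := by
  induction h with
  | nil => simp
  | cons x h ih => simp only [total_cons, ih]; ring

lemma total_const_mul (c : ℝ) (f : History V → Finset V × Outcome V → ℝ) (h : History V) :
    total (fun h x => c * f h x) h = c * total f h := by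
  induction h with
  | nil => simp
  | cons x h ih => simp only [total_cons, ih]; ring

lemma total_sum {ι : Type*} (J : Finset ι) (f : ι → History V → Finset V × Outcome V → ℝ)
    (h : History V) : total (fun h x => ∑ i ∈ J, f i h x) h = ∑ i ∈ J, total (f i) h := by
  induction h with
  | nil => simp
  | cons x h ih => simp only [total_cons, ih, Finset.sum_add_distrib]

end Total

/-! ### Exponential moments and concentration along an execution -/

section Law

variable {V : Type} [Fintype V] [MetricSpace V] {M : Model} {A : Algorithm} {s : V}
  {adv : Adversary V}

lemma mean_law_succ (t : ℕ) (F : History V → ℝ≥0∞) :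
    mean (law M A s adv (t + 1)) F =
      mean (law M A s adv t) fun h => mean (roundLaw M A s adv h) fun x => F (x :: h) := by
  rw [law, mean_bind]
  simp only [mean_map]

lemma mem_support_law_zero {h : History V} (hh : h ∈ (law M A s adv 0).support) : h = [] := by
  simpa [law] using hh

lemma mem_support_law_succ {t : ℕ} {h : History V} :
    h ∈ (law M A s adv (t + 1)).support ↔
      ∃ h' ∈ (law M A s adv t).support, ∃ x ∈ (roundLaw M A s adv h').support, h = x :: h' := by
  rw [law, PMF.mem_support_bind_iff]
  simp only [PMF.support_map, Set.mem_image]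
  constructor
  · rintro ⟨h', hh', x, hx, rfl⟩
    exact ⟨h', hh', x, hx, rfl⟩
  · rintro ⟨h', hh', x, hx, rfl⟩
    exact ⟨h', hh', x, hx, rfl⟩

lemma length_of_mem_support {t : ℕ} {h : History V} (hh : h ∈ (law M A s adv t).support) :
    h.length = t := by
  induction t generalizing h with
  | zero => rw [mem_support_law_zero hh]; rfl
  | succ t ih =>
    obtain ⟨h', hh', x, -, rfl⟩ := mem_support_law_succ.1 hh
    simp [ih hh']

/-- The exponential of a sum of increments with conditional exponential moment at most `1`. -/
lemma mean_exp_total_le {f : History V → Finset V × Outcome V → ℝ}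
    (hf : ∀ t, ∀ h ∈ (law M A s adv t).support,
      mean (roundLaw M A s adv h) (fun x => ENNReal.ofReal (Real.exp (f h x))) ≤ 1) (t : ℕ) :
    mean (law M A s adv t) (fun h => ENNReal.ofReal (Real.exp (total f h))) ≤ 1 := by
  induction t with
  | zero => simp [law, mean_pure]
  | succ t ih =>
    rw [mean_law_succ]
    refine le_trans (mean_mono fun h hh => ?_) ih
    simp only [total_cons, Real.exp_add]
    calc mean (roundLaw M A s adv h)
          (fun x => ENNReal.ofReal (Real.exp (total f h) * Real.exp (f h x)))
        = ENNReal.ofReal (Real.exp (total f h)) *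
            mean (roundLaw M A s adv h) (fun x => ENNReal.ofReal (Real.exp (f h x))) := by
          rw [← mean_const_mul]
          exact mean_congr fun x _ => ENNReal.ofReal_mul (Real.exp_pos _).le
      _ ≤ ENNReal.ofReal (Real.exp (total f h)) * 1 := by gcongr; exact hf t h hh
      _ = _ := mul_one _

/-- Markov's inequality for the exponential of the total, a supermartingale by the hypothesis on the
increments. -/
lemma law_total_ge_le {f : History V → Finset V × Outcome V → ℝ}
    (hf : ∀ t, ∀ h ∈ (law M A s adv t).support,
      mean (roundLaw M A s adv h) (fun x => ENNReal.ofReal (Real.exp (f h x))) ≤ 1) (t : ℕ)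
    (θ : ℝ) :
    (law M A s adv t).toOuterMeasure {h | θ ≤ total f h} ≤ ENNReal.ofReal (Real.exp (-θ)) := by
  calc (law M A s adv t).toOuterMeasure {h | θ ≤ total f h}
      ≤ mean (law M A s adv t) (fun h => ENNReal.ofReal (Real.exp (-θ)) *
          ENNReal.ofReal (Real.exp (total f h))) := by
        refine toOuterMeasure_le_mean fun h _ hh => ?_
        rw [← ENNReal.ofReal_mul (Real.exp_pos _).le, ← Real.exp_add]
        rw [Set.mem_ofPred_eq] at hh
        exact ENNReal.one_le_ofReal.2 (Real.one_le_exp (by linarith))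
    _ = ENNReal.ofReal (Real.exp (-θ)) *
          mean (law M A s adv t) (fun h => ENNReal.ofReal (Real.exp (total f h))) :=
        mean_const_mul _ _ _
    _ ≤ ENNReal.ofReal (Real.exp (-θ)) * 1 := by gcongr; exact mean_exp_total_le hf t
    _ = _ := mul_one _

/-- This is the one-step estimate behind `law_chernoff`: with tilt l = p - p', the variable exp(l(p'
- 1_B)) has mean at most 1 if B has probability p. Since e^(-l) ≤ 1 - l + l² and p' = p - l ≤ p(1 -
l), one has 1 - p(1 - e^(-l)) ≤ 1 - l p' ≤ e^(-l p'). -/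
lemma exp_mul_one_sub_le {p p' : ℝ} (hp' : 0 ≤ p') (hpp : p' ≤ p) (hp : p ≤ 1) :
    Real.exp ((p - p') * p') ≤
      1 + (Real.exp ((p - p') * p') - Real.exp ((p - p') * (p' - 1))) * p := by
  set l := p - p' with hl
  have hl0 : 0 ≤ l := by linarith
  have h1 : Real.exp (l * (p' - 1)) = Real.exp (l * p') * Real.exp (-l) := by
    rw [← Real.exp_add]; congr 1; ring
  have h2 : Real.exp (-l) * (1 + l) ≤ 1 := by
    have := Real.add_one_le_exp l
    calc Real.exp (-l) * (1 + l) ≤ Real.exp (-l) * Real.exp l := by gcongr; linarith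
      _ = 1 := by rw [← Real.exp_add]; simp
  have h3 : Real.exp (-l) ≤ 1 - l + l ^ 2 := by
    have hpos := Real.exp_pos (-l)
    -- The right side equals 1 + l³, and the left side is at most 1.
    have : Real.exp (-l) * (1 + l) ≤ (1 - l + l ^ 2) * (1 + l) := by
      nlinarith [pow_nonneg hl0 3]
    exact le_of_mul_le_mul_right this (by linarith)
  have h4 : 1 - p * (1 - Real.exp (-l)) ≤ 1 - l * p' := by
    have : p' ≤ p * (1 - l) := by nlinarith
    have h5 : l - l ^ 2 ≤ 1 - Real.exp (-l) := by linarith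
    have h6 : p * (l - l ^ 2) ≤ p * (1 - Real.exp (-l)) :=
      mul_le_mul_of_nonneg_left h5 (by linarith)
    nlinarith
  have h5 : Real.exp (l * p') * (1 - p * (1 - Real.exp (-l))) ≤ 1 := by
    calc Real.exp (l * p') * (1 - p * (1 - Real.exp (-l)))
        ≤ Real.exp (l * p') * Real.exp (-(l * p')) := by
          gcongr
          have := Real.add_one_le_exp (-(l * p'))
          linarith
      _ = 1 := by rw [← Real.exp_add]; simp
  rw [h1]
  nlinarith

/-- If an event `B` has conditional probability at least `p` in every round that satisfies `P`, then
it is unlikely that it happens much less often than `p' < p` times the number of these rounds. -/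
lemma law_chernoff {P : History V → Prop} {B : History V → Finset V × Outcome V → Prop} {p p' : ℝ}
    (hp' : 0 ≤ p') (hpp : p' ≤ p) (hp : p ≤ 1)
    (hB : ∀ t, ∀ h ∈ (law M A s adv t).support, P h →
      ENNReal.ofReal p ≤ (roundLaw M A s adv h).toOuterMeasure {x | B h x}) (t : ℕ) (θ : ℝ) :
    (law M A s adv t).toOuterMeasure
        {h | θ ≤ p' * total (fun h _ => ind (P h)) h - total (fun h x => ind (P h ∧ B h x)) h} ≤
      ENNReal.ofReal (Real.exp (-((p - p') * θ))) := by
  classical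
  set l := p - p' with hl
  have hl0 : 0 ≤ l := by linarith
  have key := law_total_ge_le (M := M) (A := A) (s := s) (adv := adv)
    (f := fun h x => l * (p' * ind (P h) - ind (P h ∧ B h x))) ?_ t (l * θ)
  · refine le_trans (toOuterMeasure_mono_of_support fun h _ hh => ?_) key
    rw [Set.mem_ofPred_eq] at hh ⊢
    rw [total_const_mul, total_sub, total_const_mul]
    gcongr
  · intro t h hh
    by_cases hP : P h
    · have hsimp : ∀ x, l * (p' * ind (P h) - ind (P h ∧ B h x)) =
          if B h x then l * (p' - 1) else l * p' := by
        intro x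
        by_cases hx : B h x <;> simp [ind, hP, hx]
      set D := Real.exp (l * p') - Real.exp (l * (p' - 1)) with hD
      have hD0 : 0 ≤ D := by
        rw [hD, sub_nonneg]; exact Real.exp_le_exp.2 (by nlinarith)
      -- The exponential takes only two values, which differ by `D`. The identity is kept additive
      -- because subtraction in `ℝ≥0∞` truncates; only a lower bound for the probability of `B` is
      -- then needed.
      have h1 : mean (roundLaw M A s adv h)
          (fun x => ENNReal.ofReal (Real.exp (l * (p' * ind (P h) - ind (P h ∧ B h x))))) +
          ENNReal.ofReal D * (roundLaw M A s adv h).toOuterMeasure {x | B h x} =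
          ENNReal.ofReal (Real.exp (l * p')) := by
        rw [toOuterMeasure_eq_mean, ← mean_const_mul, ← mean_add]
        conv_rhs => rw [← mean_const (roundLaw M A s adv h) (ENNReal.ofReal (Real.exp (l * p')))]
        refine mean_congr fun x _ => ?_
        rw [hsimp]
        by_cases hx : B h x
        · simp only [hx, if_true, Set.mem_ofPred_eq, mul_one]
          rw [← ENNReal.ofReal_add (Real.exp_pos _).le hD0, hD]
          congr 1; ring
        · simp [hx]
      have h2 : ENNReal.ofReal (D * p) ≤
          ENNReal.ofReal D * (roundLaw M A s adv h).toOuterMeasure {x | B h x} := by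
        rw [ENNReal.ofReal_mul hD0]
        gcongr
        exact hB t h hh hP
      have h3 : ENNReal.ofReal (Real.exp (l * p')) ≤ 1 + ENNReal.ofReal (D * p) := by
        rw [← ENNReal.ofReal_one, ← ENNReal.ofReal_add zero_le_one (mul_nonneg hD0 (by linarith))]
        exact ENNReal.ofReal_le_ofReal (exp_mul_one_sub_le hp' hpp hp)
      have h4 := (add_le_add_right h2 _).trans (h1.le.trans h3)
      exact (ENNReal.add_le_add_iff_right ENNReal.ofReal_ne_top).1 h4
    · have : ∀ x, l * (p' * ind (P h) - ind (P h ∧ B h x)) = 0 := by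
        intro x; simp [ind, hP]
      simp [this, mean_const]

/-- A union bound over the rounds of an execution. -/
lemma law_one_le_total_le (Q : History V → Prop) (T : ℕ) :
    (law M A s adv T).toOuterMeasure {h | 1 ≤ total (fun h _ => ind (Q h)) h} ≤
      ∑ t ∈ Finset.range T, (law M A s adv t).toOuterMeasure {h | Q h} := by
  classical
  have key : ∀ T, mean (law M A s adv T)
      (fun h => ENNReal.ofReal (total (fun h _ => ind (Q h)) h)) ≤
      ∑ t ∈ Finset.range T, (law M A s adv t).toOuterMeasure {h | Q h} := by
    intro T
    induction T with
    | zero => simp [law, mean_pure]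
    | succ T ih =>
      rw [mean_law_succ, Finset.sum_range_succ]
      refine le_trans ?_ (add_le_add_left ih _)
      rw [toOuterMeasure_eq_mean, ← mean_add]
      refine mean_mono fun h _ => ?_
      simp only [total_cons, mean_const]
      rw [ENNReal.ofReal_add (total_nonneg (fun _ _ => ind_nonneg _) h) (ind_nonneg _)]
      gcongr
      unfold ind
      split_ifs with h1 h2 <;> simp_all
  exact (toOuterMeasure_le_mean fun h _ hh => ENNReal.one_le_ofReal.2 hh).trans (key T)

end Law

/-! ### Random sets with independent elements -/

section IndependentSet

variable {V : Type} [Fintype V] {p : V → ℝ≥0} {hp : ∀ v, p v ≤ 1}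

open Classical in
lemma independentSet_apply (S : Finset V) : independentSet p hp S =
    (∏ v ∈ S, (p v : ℝ≥0∞)) * ∏ v ∈ Finset.univ \ S, (1 - (p v : ℝ≥0∞)) := rfl

open Classical in
-- Expand the product of the sums `a v + b v`, where `a` vanishes on `Y` and `b` on `X`: only the
-- sets that contain `X` and avoid `Y` survive, and each factor is `p v`, `1 - p v` or 1.
lemma independentSet_subset_disjoint {X Y : Finset V} (hXY : Disjoint X Y) :
    (independentSet p hp).toOuterMeasure {S | X ⊆ S ∧ Disjoint S Y} =
      (∏ v ∈ X, (p v : ℝ≥0∞)) * ∏ v ∈ Y, (1 - (p v : ℝ≥0∞)) := by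
  set a : V → ℝ≥0∞ := fun v => if v ∈ Y then 0 else p v with ha
  set b : V → ℝ≥0∞ := fun v => if v ∈ X then 0 else 1 - (p v : ℝ≥0∞) with hb
  have h1 : (independentSet p hp).toOuterMeasure {S | X ⊆ S ∧ Disjoint S Y} =
      ∑ S : Finset V, (∏ v ∈ S, a v) * ∏ v ∈ Finset.univ \ S, b v := by
    rw [PMF.toOuterMeasure_apply_fintype]
    refine Finset.sum_congr rfl fun S _ => ?_
    by_cases hS : X ⊆ S ∧ Disjoint S Y
    · rw [Set.indicator_of_mem (by exact hS), independentSet_apply]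
      congr 1
      · refine Finset.prod_congr rfl fun v hv => ?_
        rw [ha]; simp [Finset.disjoint_left.1 hS.2 hv]
      · refine Finset.prod_congr rfl fun v hv => ?_
        have : v ∉ X := fun h => (Finset.mem_sdiff.1 hv).2 (hS.1 h)
        rw [hb]; simp [this]
    · rw [Set.indicator_of_notMem (by exact hS)]
      symm
      rw [not_and_or] at hS
      rcases hS with hS | hS
      · obtain ⟨v, hvX, hvS⟩ := Finset.not_subset.1 hS
        have : ∏ v ∈ Finset.univ \ S, b v = 0 :=
          Finset.prod_eq_zero (i := v) (by simp [hvS]) (by simp [hb, hvX])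
        rw [this, mul_zero]
      · obtain ⟨v, hvS, hvY⟩ := Finset.not_disjoint_iff.1 hS
        have : ∏ v ∈ S, a v = 0 := Finset.prod_eq_zero (i := v) hvS (by simp [ha, hvY])
        rw [this, zero_mul]
  have h2 := Finset.prod_add a b Finset.univ
  rw [Finset.powerset_univ] at h2
  rw [h1, ← h2]
  have h3 : ∀ v, a v + b v =
      (if v ∈ X then (p v : ℝ≥0∞) else 1) * (if v ∈ Y then 1 - (p v : ℝ≥0∞) else 1) := by
    intro v
    have hv1 : (p v : ℝ≥0∞) + (1 - p v) = 1 := add_tsub_cancel_of_le (by exact_mod_cast hp v)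
    by_cases hX : v ∈ X
    · have hY : v ∉ Y := Finset.disjoint_left.1 hXY hX
      simp [ha, hb, hX, hY]
    · by_cases hY : v ∈ Y <;> simp [ha, hb, hX, hY, hv1]
  simp only [h3, Finset.prod_mul_distrib, Finset.prod_ite_mem, Finset.univ_inter]

lemma prob_ne_zero_of_mem_support {S : Finset V} (hS : S ∈ (independentSet p hp).support) {v : V}
    (hv : v ∈ S) : p v ≠ 0 := by
  classical
  intro h0
  rw [PMF.mem_support_iff, independentSet_apply] at hS
  exact hS (by rw [Finset.prod_eq_zero hv (by simp [h0]), zero_mul])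

lemma mem_of_prob_eq_one {S : Finset V} (hS : S ∈ (independentSet p hp).support) {v : V}
    (hv : p v = 1) : v ∈ S := by
  classical
  by_contra h
  rw [PMF.mem_support_iff, independentSet_apply] at hS
  exact hS (by rw [Finset.prod_eq_zero (i := v) (s := Finset.univ \ S) (by simp [h]) (by simp [hv]),
    mul_zero])

open Classical in
/-- Markov's inequality for a weighted sum over the random set, conditionally on an event that only
concerns other elements. -/
lemma independentSet_markov {X Y W : Finset V} (hXY : Disjoint X Y) (hWX : Disjoint W X)
    (hWY : Disjoint W Y) {g : V → ℝ} (hg : ∀ w, 0 ≤ g w) {θ : ℝ} (hθ : 0 < θ) :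
    (independentSet p hp).toOuterMeasure
        {S | (X ⊆ S ∧ Disjoint S Y) ∧ θ ≤ ∑ w ∈ W with w ∈ S, g w} ≤
      (independentSet p hp).toOuterMeasure {S | X ⊆ S ∧ Disjoint S Y} *
        ENNReal.ofReal ((∑ w ∈ W, p w * g w) / θ) := by
  set E := (independentSet p hp).toOuterMeasure {S | X ⊆ S ∧ Disjoint S Y} with hE
  have h1 : ∀ w ∈ W, (independentSet p hp).toOuterMeasure
      {S | (X ⊆ S ∧ Disjoint S Y) ∧ w ∈ S} = E * p w := by
    intro w hw
    have hwX : w ∉ X := Finset.disjoint_left.1 hWX hw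
    have hwY : w ∉ Y := Finset.disjoint_left.1 hWY hw
    have h2 := independentSet_subset_disjoint (p := p) (hp := hp) (X := insert w X) (Y := Y)
      (Finset.disjoint_insert_left.2 ⟨hwY, hXY⟩)
    rw [Finset.prod_insert hwX] at h2
    rw [hE, independentSet_subset_disjoint hXY]
    calc _ = (independentSet p hp).toOuterMeasure {S | insert w X ⊆ S ∧ Disjoint S Y} := by
          congr 1
          ext S
          simp only [Set.mem_ofPred_eq, Finset.insert_subset_iff]
          tauto
      _ = _ := by rw [h2]; ring
  calc (independentSet p hp).toOuterMeasure
        {S | (X ⊆ S ∧ Disjoint S Y) ∧ θ ≤ ∑ w ∈ W with w ∈ S, g w}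
      ≤ mean (independentSet p hp) (fun S => ∑ w ∈ W, ENNReal.ofReal (g w / θ) *
          (if S ∈ {S | (X ⊆ S ∧ Disjoint S Y) ∧ w ∈ S} then 1 else 0)) := by
        refine toOuterMeasure_le_mean fun S _ hS => ?_
        obtain ⟨hS1, hS2⟩ := hS
        calc (1 : ℝ≥0∞) ≤ ENNReal.ofReal ((∑ w ∈ W with w ∈ S, g w) / θ) :=
              ENNReal.one_le_ofReal.2 ((one_le_div hθ).2 hS2)
          _ = ∑ w ∈ W with w ∈ S, ENNReal.ofReal (g w / θ) := by
              rw [Finset.sum_div, ENNReal.ofReal_sum_of_nonneg]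
              exact fun w _ => div_nonneg (hg w) hθ.le
          _ = _ := by
              rw [Finset.sum_filter]
              refine Finset.sum_congr rfl fun w _ => ?_
              by_cases hw : w ∈ S <;> simp [hS1, hw]
    _ = ∑ w ∈ W, ENNReal.ofReal (g w / θ) * (E * p w) := by
        have : ∀ J : Finset V, mean (independentSet p hp) (fun S => ∑ w ∈ J,
            ENNReal.ofReal (g w / θ) *
            (if S ∈ {S | (X ⊆ S ∧ Disjoint S Y) ∧ w ∈ S} then 1 else 0)) =
            ∑ w ∈ J, ENNReal.ofReal (g w / θ) * (independentSet p hp).toOuterMeasure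
              {S | (X ⊆ S ∧ Disjoint S Y) ∧ w ∈ S} := by
          intro J
          induction J using Finset.induction_on with
          | empty => simp [mean_const]
          | insert w J hw ih =>
            simp only [Finset.sum_insert hw]
            rw [mean_add, ih, mean_const_mul, ← toOuterMeasure_eq_mean]
        rw [this]
        exact Finset.sum_congr rfl fun w hw => by rw [h1 w hw]
    _ = E * ENNReal.ofReal ((∑ w ∈ W, p w * g w) / θ) := by
        rw [Finset.sum_div, ENNReal.ofReal_sum_of_nonneg
          (fun w _ => div_nonneg (mul_nonneg (p w).coe_nonneg (hg w)) hθ.le), Finset.mul_sum]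
        refine Finset.sum_congr rfl fun w _ => ?_
        rw [mul_div_assoc, ENNReal.ofReal_mul (p w).coe_nonneg, ENNReal.ofReal_coe_nnreal]
        ring

open Classical in
lemma independentSet_sum_ge_le (W : Finset V) {g : V → ℝ} (hg : ∀ w, 0 ≤ g w) {θ : ℝ}
    (hθ : 0 < θ) :
    (independentSet p hp).toOuterMeasure {S | θ ≤ ∑ w ∈ W with w ∈ S, g w} ≤
      ENNReal.ofReal ((∑ w ∈ W, p w * g w) / θ) := by
  have := independentSet_markov (p := p) (hp := hp) (X := ∅) (Y := ∅) (W := W) (by simp) (by simp)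
    (by simp) hg hθ
  simp only [Finset.empty_subset, Finset.disjoint_empty_right, true_and, and_self] at this
  refine this.trans ?_
  calc _ ≤ 1 * ENNReal.ofReal ((∑ w ∈ W, p w * g w) / θ) := by
        gcongr
        exact toOuterMeasure_le_one _ _
    _ = _ := one_mul _

/-- Here e^(-2q)(1 + 2q) ≤ 1, while (1 - q)(1 + 2q) ≥ 1 for q ≤ 1/2. -/
lemma exp_neg_two_mul_le {q : ℝ} (h0 : 0 ≤ q) (h1 : q ≤ 1 / 2) : Real.exp (-(2 * q)) ≤ 1 - q := by
  have h2 := Real.add_one_le_exp (2 * q)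
  have h3 : Real.exp (-(2 * q)) * Real.exp (2 * q) = 1 := by rw [← Real.exp_add]; simp
  have h4 := Real.exp_pos (-(2 * q))
  nlinarith

open Classical in
/-- With moderate probabilities in `B` and a small expected weight of the random set in `W`, it
happens with substantial probability that an element of `U` is the only random element of `B` and
the weight in `W` is small. -/
lemma independentSet_isolated {B W U : Finset V} (hBW : Disjoint B W) (hU : U ⊆ B) {g : V → ℝ}
    (hg : ∀ w, 0 ≤ g w) (hhalf : ∀ v, p v ≤ 1 / 2) {K θ : ℝ} (hθ : 0 < θ)
    (hK : ∑ v ∈ B, (p v : ℝ) ≤ K) (hW : ∑ w ∈ W, p w * g w ≤ θ / 2) :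
    ENNReal.ofReal (Real.exp (-(2 * K)) / 2 * ∑ u ∈ U, (p u : ℝ)) ≤
      (independentSet p hp).toOuterMeasure {S | ∃ u ∈ U, u ∈ S ∧ (∀ w ∈ S, w ∈ B → w = u) ∧
        ∑ w ∈ W with w ∈ S, g w < θ} := by
  have hhalf' : ∀ v, (p v : ℝ) ≤ 1 / 2 := fun v => by
    have := NNReal.coe_le_coe.2 (hhalf v)
    simpa using this
  -- `E u` has probability at least p(u)e^(-2K). It concerns only elements of `B`, so the weight in
  -- `W` keeps its mean under conditioning, and Markov at twice the mean leaves at least half of `E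
  -- u`.
  set E : V → Set (Finset V) := fun u => {S | {u} ⊆ S ∧ Disjoint S (B.erase u)} with hEdef
  set G : Set (Finset V) := {S | θ ≤ ∑ w ∈ W with w ∈ S, g w} with hG
  have hEu : ∀ u ∈ U, ENNReal.ofReal (Real.exp (-(2 * K)) / 2 * p u) ≤
      (independentSet p hp).toOuterMeasure (E u \ G) := by
    intro u hu
    have hd : Disjoint {u} (B.erase u) := by simp
    have h1 := independentSet_subset_disjoint (p := p) (hp := hp) hd
    have h2 := independentSet_markov (p := p) (hp := hp) (W := W) hd
      (Finset.disjoint_singleton_right.2 (Finset.disjoint_left.1 hBW (hU hu)))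
      (hBW.symm.mono_right (Finset.erase_subset _ _)) hg hθ
    have h3 : ENNReal.ofReal ((∑ w ∈ W, p w * g w) / θ) ≤ 1 / 2 := by
      rw [show (1 / 2 : ℝ≥0∞) = ENNReal.ofReal (1 / 2) by
        rw [ENNReal.ofReal_div_of_pos (by norm_num)]; simp]
      refine ENNReal.ofReal_le_ofReal ?_
      rw [div_le_iff₀ hθ]; linarith
    have h4 : ENNReal.ofReal (Real.exp (-(2 * K)) * p u) ≤
        (independentSet p hp).toOuterMeasure (E u) := by
      rw [hEdef]; dsimp only
      rw [h1, Finset.prod_singleton]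
      have : ∏ v ∈ B.erase u, (1 - (p v : ℝ≥0∞)) =
          ENNReal.ofReal (∏ v ∈ B.erase u, (1 - (p v : ℝ))) := by
        rw [ENNReal.ofReal_prod_of_nonneg (fun v _ => by linarith [hhalf' v])]
        refine Finset.prod_congr rfl fun v _ => ?_
        rw [ENNReal.ofReal_sub _ (p v).coe_nonneg]; simp
      rw [this, mul_comm, ENNReal.ofReal_mul (p u).coe_nonneg, ENNReal.ofReal_coe_nnreal]
      gcongr
      calc Real.exp (-(2 * K)) ≤ Real.exp (∑ v ∈ B.erase u, -(2 * (p v : ℝ))) := by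
            refine Real.exp_le_exp.2 ?_
            rw [Finset.sum_neg_distrib, ← Finset.mul_sum]
            have : ∑ v ∈ B.erase u, (p v : ℝ) ≤ ∑ v ∈ B, (p v : ℝ) :=
              Finset.sum_le_sum_of_subset_of_nonneg (Finset.erase_subset _ _)
                fun v _ _ => (p v).coe_nonneg
            linarith
        _ = ∏ v ∈ B.erase u, Real.exp (-(2 * (p v : ℝ))) := Real.exp_sum _ _
        _ ≤ _ := Finset.prod_le_prod (fun v _ => (Real.exp_pos _).le)
            fun v _ => exp_neg_two_mul_le (p v).coe_nonneg (hhalf' v)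
    have h5 : (independentSet p hp).toOuterMeasure (E u) ≤
        (independentSet p hp).toOuterMeasure (E u \ G) +
          (independentSet p hp).toOuterMeasure (E u) / 2 := by
      calc _ ≤ (independentSet p hp).toOuterMeasure ((E u \ G) ∪ (E u ∩ G)) :=
            toOuterMeasure_mono_of_support fun S _ hS => by
              by_cases hSG : S ∈ G
              · exact Or.inr ⟨hS, hSG⟩
              · exact Or.inl ⟨hS, hSG⟩
        _ ≤ _ := (MeasureTheory.measure_union_le _ _).trans (by
            gcongr
            refine (h2.trans (mul_le_mul_right h3 _)).trans (le_of_eq ?_)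
            rw [mul_one_div])
    have hfin : (independentSet p hp).toOuterMeasure (E u) ≠ ⊤ :=
      ((toOuterMeasure_le_one _ _).trans_lt ENNReal.one_lt_top).ne
    have h6 : (independentSet p hp).toOuterMeasure (E u) / 2 ≤
        (independentSet p hp).toOuterMeasure (E u \ G) := by
      have h7 : (independentSet p hp).toOuterMeasure (E u) / 2 +
          (independentSet p hp).toOuterMeasure (E u) / 2 ≤
          (independentSet p hp).toOuterMeasure (E u \ G) +
          (independentSet p hp).toOuterMeasure (E u) / 2 := by
        rwa [ENNReal.add_halves]
      exact (ENNReal.add_le_add_iff_right (ENNReal.div_ne_top hfin two_ne_zero)).1 h7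
    refine le_trans ?_ h6
    rw [div_mul_eq_mul_div, ENNReal.ofReal_div_of_pos (by norm_num)]
    simp only [ENNReal.ofReal_ofNat]
    gcongr
  calc ENNReal.ofReal (Real.exp (-(2 * K)) / 2 * ∑ u ∈ U, (p u : ℝ))
      = ∑ u ∈ U, ENNReal.ofReal (Real.exp (-(2 * K)) / 2 * p u) := by
        rw [Finset.mul_sum, ENNReal.ofReal_sum_of_nonneg]
        exact fun u _ => by positivity
    _ ≤ ∑ u ∈ U, (independentSet p hp).toOuterMeasure (E u \ G) := Finset.sum_le_sum hEu
    _ ≤ _ := by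
        have hsum : ∀ J : Finset V, ∑ u ∈ J, (independentSet p hp).toOuterMeasure (E u \ G) =
            mean (independentSet p hp) fun S => ∑ u ∈ J, if S ∈ E u \ G then 1 else 0 := by
          intro J
          induction J using Finset.induction_on with
          | empty => simp [mean_const]
          | insert w J hw ih =>
            simp only [Finset.sum_insert hw]
            rw [mean_add, ih, ← toOuterMeasure_eq_mean]
        rw [hsum, toOuterMeasure_eq_mean]
        -- The events for different `u` are disjoint because `U ⊆ B`; hence their probabilities add
        -- up.
        have huniq : ∀ (S : Finset V), ∀ u ∈ U, S ∈ E u \ G →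
            u ∈ S ∧ (∀ w ∈ S, w ∈ B → w = u) ∧ ∑ w ∈ W with w ∈ S, g w < θ := by
          rintro S u hu ⟨⟨h1, h2⟩, h3⟩
          refine ⟨by simpa using h1, fun w hw hwB => ?_, not_le.1 h3⟩
          by_contra hne
          exact Finset.disjoint_left.1 h2 hw (Finset.mem_erase.2 ⟨hne, hwB⟩)
        refine mean_mono fun S _ => ?_
        by_cases hex : ∃ u ∈ U, S ∈ E u \ G
        · obtain ⟨u, hu, huS⟩ := hex
          have hu' := huniq S u hu huS
          have hz : ∀ w ∈ U, w ≠ u → (if S ∈ E w \ G then (1 : ℝ≥0∞) else 0) = 0 := by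
            intro w hw hne
            refine if_neg fun h => hne ?_
            exact hu'.2.1 w (huniq S w hw h).1 (hU hw)
          have hin : S ∈ {S | ∃ u ∈ U, u ∈ S ∧ (∀ w ∈ S, w ∈ B → w = u) ∧
            ∑ w ∈ W with w ∈ S, g w < θ} := ⟨u, hu, hu'⟩
          rw [Finset.sum_eq_single_of_mem u hu hz, if_pos huS, if_pos hin]
        · push Not at hex
          rw [Finset.sum_eq_zero fun u hu => if_neg (hex u hu)]
          exact zero_le

end IndependentSet

/-! ### Rounds -/

section Round

variable {V : Type} [Fintype V] [MetricSpace V] {M : Model} {A : Algorithm} {s : V}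
  {adv : Adversary V}

lemma mean_roundLaw (h : History V) (F : Finset V × Outcome V → ℝ≥0∞) :
    mean (roundLaw M A s adv h) F =
      mean (independentSet (transmitProb M A s h) fun _ => A.prob_le_one _)
        fun S => mean (adv h S) fun o => F (S, o) := by
  unfold roundLaw
  rw [mean_bind]
  simp only [mean_map]

/-- The adversary acts after the transmitters have been drawn, so it cannot influence events that
concern only them. -/
lemma roundLaw_fst (h : History V) (E : Set (Finset V)) :
    (roundLaw M A s adv h).toOuterMeasure {x | x.1 ∈ E} =
      (independentSet (transmitProb M A s h) fun _ => A.prob_le_one _).toOuterMeasure E := by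
  classical
  rw [toOuterMeasure_eq_mean, toOuterMeasure_eq_mean, mean_roundLaw]
  refine mean_congr fun S _ => ?_
  by_cases hS : S ∈ E <;> simp [hS, mean_const]

lemma fst_mem_support {h : History V} {x : Finset V × Outcome V}
    (hx : x ∈ (roundLaw M A s adv h).support) :
    x.1 ∈ (independentSet (transmitProb M A s h) fun _ => A.prob_le_one _).support := by
  unfold roundLaw at hx
  rw [PMF.mem_support_bind_iff] at hx
  obtain ⟨S, hS, hx⟩ := hx
  rw [PMF.support_map] at hx
  obtain ⟨o, -, rfl⟩ := hx
  exact hS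

/-- The round `x` can follow the history `h`. -/
structure RoundOK (M : Model) (A : Algorithm) (s : V) (h : History V)
    (x : Finset V × Outcome V) : Prop where
  legal : Legal M x.1 x.2
  prob_ne_zero : ∀ v ∈ x.1, transmitProb M A s h v ≠ 0
  mem_of_prob : ∀ v, transmitProb M A s h v = 1 → v ∈ x.1

/-- All rounds of a history obey the rules. -/
def Valid (M : Model) (A : Algorithm) (s : V) : History V → Prop
  | [] => True
  | x :: h => Valid M A s h ∧ RoundOK M A s h x

lemma roundOK_of_mem_support (hadm : Admissible M A s adv) {t : ℕ} {h : History V}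
    (hh : h ∈ (law M A s adv t).support) {x : Finset V × Outcome V}
    (hx : x ∈ (roundLaw M A s adv h).support) : RoundOK M A s h x where
  legal := (hadm t h hh).1 x hx
  prob_ne_zero _ hv := prob_ne_zero_of_mem_support (fst_mem_support hx) hv
  mem_of_prob _ hv := mem_of_prob_eq_one (fst_mem_support hx) hv

/-- This is the passage from the random execution to single histories, on which all counting
arguments run. -/
lemma valid_of_mem_support (hadm : Admissible M A s adv) {t : ℕ} {h : History V}
    (hh : h ∈ (law M A s adv t).support) : Valid M A s h := by
  induction t generalizing h with
  | zero => rw [mem_support_law_zero hh]; trivial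
  | succ t ih =>
    obtain ⟨h', hh', x, hx, rfl⟩ := mem_support_law_succ.1 hh
    exact ⟨ih hh', roundOK_of_mem_support hadm hh' hx⟩

end Round

/-! ### Separated sets of nodes -/

section Geometry

variable {V : Type} [MetricSpace V]

/-- Distinct elements of `Z` are at distance at least `d`. -/
def Separated (d : ℝ) (Z : Finset V) : Prop :=
  ∀ u ∈ Z, ∀ v ∈ Z, u ≠ v → d ≤ dist u v

lemma Separated.subset {d : ℝ} {Z Z' : Finset V} (hZ : Separated d Z) (h : Z' ⊆ Z) :
    Separated d Z' :=
  fun u hu v hv => hZ u (h hu) v (h hv)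

/-- The `r`-balls around the points are disjoint and lie in the ball of radius `(q + 1) * r` around
`x`. -/
lemma Separated.card_le {r lam C : ℝ} (hb : BoundedIndependence V r lam C) {q : ℝ}
    (hq : 0 ≤ q) {Z : Finset V} (hZ : Separated (2 * r) Z) {x : V}
    (hx : ∀ z ∈ Z, dist z x ≤ q * r) : (Z.card : ℝ) ≤ C * (q + 1) ^ lam := by
  refine hb (q + 1) (by linarith) x Z ⟨fun u hu v hv => ?_, fun u hu v hv huv => ?_⟩
  · rw [Metric.mem_ball] at hv ⊢
    have := dist_triangle v u x
    have := hx u hu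
    linarith
  · refine Metric.ball_disjoint_ball ?_
    have := hZ u hu v hv huv
    linarith

/-- The points are split into shells 2^j ℓ ≤ d < 2^(j+1) ℓ. A shell holds O((2^j ℓ/r)^λ) points with
at most (2^j ℓ)^(-ζ) each, which gives a geometric progression of ratio 2^(λ-ζ). -/
lemma sum_rpow_dyadic_le {r lam C ζ ℓ : ℝ} (hb : BoundedIndependence V r lam C) (hr : 0 < r)
    (hC : 0 ≤ C) (hlam : 0 ≤ lam) (hζ : 0 ≤ ζ) (hℓ : r ≤ ℓ) {Z : Finset V}
    (hZ : Separated (2 * r) Z) (x : V) (J : ℕ) :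
    ∑ z ∈ Z with ℓ ≤ dist z x ∧ dist z x < 2 ^ J * ℓ, dist z x ^ (-ζ) ≤
      ∑ j ∈ Finset.range J, C * (4 / r) ^ lam * ℓ ^ (lam - ζ) * ((2 : ℝ) ^ (lam - ζ)) ^ j := by
  have hℓ0 : 0 < ℓ := hr.trans_le hℓ
  induction J with
  | zero =>
    rw [Finset.sum_eq_zero]
    · simp
    · intro z hz
      have := (Finset.mem_filter.1 hz).2
      simp only [pow_zero, one_mul] at this
      linarith [this.1, this.2]
  | succ J ih =>
    rw [Finset.sum_range_succ]
    set Z' := Z.filter fun z => 2 ^ J * ℓ ≤ dist z x ∧ dist z x < 2 ^ (J + 1) * ℓ with hZ'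
    have hpos : (0 : ℝ) < 2 ^ J * ℓ := by positivity
    have h1 : ∑ z ∈ Z with ℓ ≤ dist z x ∧ dist z x < 2 ^ (J + 1) * ℓ, dist z x ^ (-ζ) ≤
        ∑ z ∈ Z with ℓ ≤ dist z x ∧ dist z x < 2 ^ J * ℓ, dist z x ^ (-ζ) +
          ∑ z ∈ Z', dist z x ^ (-ζ) := by
      classical
      refine le_trans (Finset.sum_le_sum_of_subset_of_nonneg (t := (Z.filter fun z =>
        ℓ ≤ dist z x ∧ dist z x < 2 ^ J * ℓ) ∪ Z') (fun z hz => ?_)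
        fun z _ _ => Real.rpow_nonneg dist_nonneg _) ?_
      · simp only [Finset.mem_union, Finset.mem_filter, hZ'] at hz ⊢
        rcases lt_or_ge (dist z x) (2 ^ J * ℓ) with h | h
        · exact Or.inl ⟨hz.1, hz.2.1, h⟩
        · exact Or.inr ⟨hz.1, h, hz.2.2⟩
      · rw [← Finset.sum_union_inter]
        exact le_add_of_nonneg_right
          (Finset.sum_nonneg fun z _ => Real.rpow_nonneg dist_nonneg _)
    have h2 : ∑ z ∈ Z', dist z x ^ (-ζ) ≤ Z'.card * (2 ^ J * ℓ) ^ (-ζ) := by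
      rw [← nsmul_eq_mul]
      refine Finset.sum_le_card_nsmul _ _ _ fun z hz => ?_
      exact Real.rpow_le_rpow_of_nonpos hpos (Finset.mem_filter.1 hz).2.1 (by linarith)
    have h3 : (Z'.card : ℝ) ≤ C * (4 / r * (2 ^ J * ℓ)) ^ lam := by
      have h4 := (hZ.subset (Finset.filter_subset _ _)).card_le hb
        (q := 2 ^ (J + 1) * ℓ / r) (by positivity) (Z := Z') (x := x) (fun z hz => by
          rw [div_mul_cancel₀ _ hr.ne']
          exact (Finset.mem_filter.1 hz).2.2.le)
      refine h4.trans ?_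
      gcongr
      -- Since r ≤ ℓ, the summand 1 in `Separated.card_le` is absorbed by doubling the radius; this
      -- is the origin of the 4.
      have h5 : (1 : ℝ) ≤ 2 * 2 ^ J * ℓ / r := by
        rw [le_div_iff₀ hr]
        have : (1 : ℝ) ≤ 2 ^ J := one_le_pow₀ (by norm_num)
        nlinarith
      have h6 : 4 / r * (2 ^ J * ℓ) = 2 * 2 ^ J * ℓ / r + 2 * 2 ^ J * ℓ / r := by ring
      rw [h6, pow_succ, mul_comm ((2 : ℝ) ^ J) 2]
      linarith
    have h7 : C * (4 / r * (2 ^ J * ℓ)) ^ lam * (2 ^ J * ℓ) ^ (-ζ) =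
        C * (4 / r) ^ lam * ℓ ^ (lam - ζ) * ((2 : ℝ) ^ (lam - ζ)) ^ J := by
      rw [Real.mul_rpow (by positivity) hpos.le, mul_assoc, mul_assoc ((4 / r) ^ lam),
        ← Real.rpow_add hpos, Real.mul_rpow (by positivity) hℓ0.le, ← sub_eq_add_neg,
        ← Real.rpow_natCast ((2 : ℝ) ^ (lam - ζ)), ← Real.rpow_mul (by norm_num),
        ← Real.rpow_natCast 2 J, ← Real.rpow_mul (by norm_num), mul_comm (J : ℝ)]
      ring
    have h8 : (Z'.card : ℝ) * (2 ^ J * ℓ) ^ (-ζ) ≤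
        C * (4 / r * (2 ^ J * ℓ)) ^ lam * (2 ^ J * ℓ) ^ (-ζ) := by
      gcongr
    linarith

end Geometry

/-- The total signal strength from far away, for separated senders, tends to zero with the
distance. -/
lemma exists_tail_le {r lam C ζ : ℝ} (hr : 0 < r) (hC : 0 ≤ C) (hlam : 0 ≤ lam) (hζ : lam < ζ)
    {δ : ℝ} (hδ : 0 < δ) : ∃ L : ℝ, ∀ (V : Type) [MetricSpace V], BoundedIndependence V r lam C →
      ∀ Z : Finset V, Separated (2 * r) Z → ∀ (x : V) (ℓ : ℝ), L ≤ ℓ →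
        ∑ z ∈ Z with ℓ ≤ dist z x, dist z x ^ (-ζ) ≤ δ := by
  set b : ℝ := (2 : ℝ) ^ (lam - ζ) with hbdef
  have hb0 : 0 ≤ b := by positivity
  have hb1 : b < 1 := Real.rpow_lt_one_of_one_lt_of_neg (by norm_num) (by linarith)
  set D : ℝ := C * (4 / r) ^ lam * (1 - b)⁻¹ with hD
  have htend : Filter.Tendsto (fun ℓ : ℝ => D * ℓ ^ (-(ζ - lam))) Filter.atTop (nhds 0) := by
    simpa using (tendsto_rpow_neg_atTop (y := ζ - lam) (by linarith)).const_mul D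
  obtain ⟨L, hL⟩ := Filter.eventually_atTop.1 ((htend.eventually_le_const hδ).and
    (Filter.eventually_ge_atTop r))
  refine ⟨L, fun V _ hbi Z hZ x ℓ hℓ => ?_⟩
  obtain ⟨h1, h2⟩ := hL ℓ hℓ
  have hℓ0 : 0 < ℓ := hr.trans_le h2
  -- Finitely many shells contain the finite set `Z`; the bound for them does not depend on how many
  -- there are.
  obtain ⟨J, hJ⟩ : ∃ J : ℕ, ∀ z ∈ Z, dist z x < 2 ^ J * ℓ := by
    obtain ⟨B, hB⟩ := (Z.image fun z => dist z x).exists_le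
    obtain ⟨J, hJ⟩ := pow_unbounded_of_one_lt (B / ℓ) (one_lt_two (α := ℝ))
    refine ⟨J, fun z hz => ?_⟩
    rw [div_lt_iff₀ hℓ0] at hJ
    exact (hB _ (Finset.mem_image_of_mem _ hz)).trans_lt hJ
  have h3 := sum_rpow_dyadic_le hbi hr hC hlam (by linarith : 0 ≤ ζ) h2 hZ x J
  have h4 : (Z.filter fun z => ℓ ≤ dist z x) =
      Z.filter fun z => ℓ ≤ dist z x ∧ dist z x < 2 ^ J * ℓ :=
    Finset.filter_congr fun z hz => by simp [hJ z hz]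
  rw [h4]
  refine h3.trans (le_trans ?_ h1)
  rw [← Finset.mul_sum, hD, neg_sub]
  have h5 : ∑ j ∈ Finset.range J, b ^ j ≤ (1 - b)⁻¹ := by
    rw [← tsum_geometric_of_lt_one hb0 hb1]
    exact (summable_geometric_of_lt_one hb0 hb1).sum_le_tsum _ fun _ _ => by positivity
  calc _ ≤ C * (4 / r) ^ lam * ℓ ^ (lam - ζ) * (1 - b)⁻¹ := by gcongr
    _ = _ := by ring

/-! ### Nets and sums over the nodes -/

section Net

variable {V : Type} [Fintype V] [MetricSpace V]

/-- A separated set of maximal cardinality covers everything: an uncovered point could be added. -/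
lemma exists_net (d : ℝ) (hd : 0 < d) :
    ∃ Y : Finset V, Separated d Y ∧ ∀ w, ∃ y ∈ Y, dist w y < d := by
  classical
  obtain ⟨Y, hY, hmax⟩ := Finset.exists_max_image
    (Finset.univ.filter fun Y : Finset V => Separated d Y) Finset.card
    ⟨∅, Finset.mem_filter.2 ⟨Finset.mem_univ _, fun u hu => absurd hu (Finset.notMem_empty u)⟩⟩
  rw [Finset.mem_filter] at hY
  refine ⟨Y, hY.2, fun w => ?_⟩
  by_contra hcon
  push Not at hcon
  have hw : w ∉ Y := fun h => by
    have := hcon w h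
    rw [dist_self] at this
    linarith
  have h1 := hmax (insert w Y) (by
    refine Finset.mem_filter.2 ⟨Finset.mem_univ _, fun u hu v hv huv => ?_⟩
    rw [Finset.mem_insert] at hu hv
    rcases hu with rfl | hu <;> rcases hv with rfl | hv
    · exact absurd rfl huv
    · exact hcon v hv
    · rw [dist_comm]; exact hcon u hu
    · exact hY.2 u hu v hv huv)
  rw [Finset.card_insert_of_notMem hw] at h1
  omega

open Classical in
-- Each node is assigned to one net point near it. Weighted sums over all nodes are thereby
-- controlled by the contention in small balls, the only quantity that contention detection speaks
-- of.
lemma sum_mul_le_net {d : ℝ} {Y : Finset V} (hY : ∀ w, ∃ y ∈ Y, dist w y < d) {p g G : V → ℝ}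
    (hp : ∀ w, 0 ≤ p w) (hG : ∀ y, 0 ≤ G y) (W : Finset V)
    (hgG : ∀ w ∈ W, ∀ y ∈ Y, dist w y < d → g w ≤ G y) :
    ∑ w ∈ W, p w * g w ≤ ∑ y ∈ Y, G y * ∑ w with w ∈ Metric.ball y d, p w := by
  choose c hcY hcd using hY
  calc ∑ w ∈ W, p w * g w ≤ ∑ w ∈ W, p w * G (c w) := by
        refine Finset.sum_le_sum fun w hw => ?_
        exact mul_le_mul_of_nonneg_left (hgG w hw _ (hcY w) (hcd w)) (hp w)
    _ ≤ ∑ w, p w * G (c w) :=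
        Finset.sum_le_sum_of_subset_of_nonneg (Finset.subset_univ _)
          fun w _ _ => mul_nonneg (hp w) (hG _)
    _ = ∑ y ∈ Y, ∑ w with c w = y, p w * G (c w) :=
        (Finset.sum_fiberwise_of_maps_to (fun w _ => hcY w) _).symm
    _ ≤ _ := by
        refine Finset.sum_le_sum fun y _ => ?_
        rw [Finset.mul_sum]
        refine le_trans (le_of_eq ?_) (Finset.sum_le_sum_of_subset_of_nonneg
          (s := Finset.univ.filter fun w => c w = y) (fun w hw => ?_)
          fun w _ _ => mul_nonneg (hG _) (hp w))
        · refine Finset.sum_congr rfl fun w hw => ?_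
          rw [(Finset.mem_filter.1 hw).2]; ring
        · rw [Finset.mem_filter] at hw ⊢
          exact ⟨Finset.mem_univ _, by rw [Metric.mem_ball, ← hw.2]; exact hcd w⟩

end Net

/-! ### The algorithm -/

/-- The local state of a node. -/
structure NodeState where
  /-- the number of the rounds that have passed -/
  clock : ℕ
  /-- whether the node is the source -/
  src : Bool
  /-- a contending node transmits with probability `2 ^ (-(level + 1))` -/
  level : ℕ
  /-- the number of election rounds for which the node does not contend -/
  pause : ℕ
  /-- whether the node has won the last election round -/
  fresh : Bool
  /-- the number of election rounds that the node has won -/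
  wins : ℕ

/-- The transmission probability in a given state. Round `0` belongs to the source. Afterwards,
rounds of three kinds alternate: election rounds (`clock % 3 = 1`), in which the nodes that are not
paused contend with a probability that is adapted to the contention; notification rounds
(`clock % 3 = 2`), in which the winners of the preceding election round transmit; and dissemination
rounds (`clock % 3 = 0`), in which a node transmits with a probability proportional to the frequency
of its wins so far. -/
def NodeState.prob (q : NodeState) : ℝ≥0 :=
  if q.clock % 3 = 1 then (if q.pause = 0 then (1 / 2) ^ (q.level + 1) else 0)
  else if q.clock % 3 = 2 then (if q.fresh then 1 / 2 else 0)
  else if q.clock = 0 then (if q.src then 1 else 0)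
  else min (1 / 2) (q.wins / (2 * ((q.clock / 3 : ℕ) : ℝ≥0)))

/-- A node wins an election round if its transmission is acknowledged and it receives no near
transmission. -/
def Observation.won (o : Observation Unit) : Bool := o.sent && o.ack && !o.ntd

/-- The state update; a node that has won or is notified by a near winner pauses for `S` election
rounds and halves its probability. -/
def NodeState.next (S : ℕ) (q : NodeState) (o : Observation Unit) : NodeState :=
  if q.clock % 3 = 1 then
    { clock := q.clock + 1
      src := q.src
      level := if q.pause = 0 then (if o.busy then q.level + 1 else q.level - 1) else q.level
      pause := q.pause - 1
      fresh := o.won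
      wins := q.wins + if o.won then 1 else 0 }
  else if q.clock % 3 = 2 then
    { clock := q.clock + 1
      src := q.src
      level := q.level + if q.fresh || o.ntd then 1 else 0
      pause := if q.fresh || o.ntd then S else q.pause
      fresh := false
      wins := q.wins }
  else { q with clock := q.clock + 1 }

lemma NodeState.prob_le_one (q : NodeState) : q.prob ≤ 1 := by
  have h : (1 / 2 : ℝ≥0) ≤ 1 := by
    rw [← NNReal.coe_le_coe]; norm_num
  unfold NodeState.prob
  split_ifs
  · exact pow_le_one₀ zero_le h
  · exact zero_le
  · exact h
  · exact zero_le
  · exact le_rfl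
  · exact zero_le
  · exact (min_le_left _ _).trans h

/-- The broadcast algorithm with pauses of length `S`. -/
def broadcast (S : ℕ) : Algorithm where
  State := NodeState
  Msg := Unit
  finite_msg := inferInstance
  init b := ⟨0, b, 0, 0, false, 0⟩
  prob := NodeState.prob
  prob_le_one := NodeState.prob_le_one
  msg _ := ()
  next := NodeState.next S

/-! ### Evolution of the node states in the three kinds of rounds -/

section Steps

variable {V : Type} [MetricSpace V] {M : Model} {S : ℕ} {s : V}

/-- The state of a node that runs the broadcast algorithm. -/
def node (M : Model) (S : ℕ) (s : V) (h : History V) (v : V) : NodeState :=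
  state M (broadcast S) s h v

/-- `v` receives a transmission from a node at distance less than `ε R / 4`. -/
def NearReception (M : Model) (x : Finset V × Outcome V) (v : V) : Prop :=
  ∃ u ∈ x.2.received v, dist u v < M.ε / 4 * M.R

/-- `v` wins the election round `x`. -/
def Wins (M : Model) (x : Finset V × Outcome V) (v : V) : Prop :=
  v ∈ x.1 ∧ x.2.ack v = true ∧ ¬ NearReception M x v

open Classical in
lemma node_nil (v : V) : node M S s [] v = ⟨0, decide (v = s), 0, 0, false, 0⟩ := by
  unfold node state broadcast
  rfl

open Classical in
/-- The observation of `v` in a round. -/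
def observe (M : Model) (s : V) (h : History V) (x : Finset V × Outcome V) (v : V) :
    Observation Unit where
  sent := decide (v ∈ x.1)
  received := {y | ∃ u ∈ x.2.received v, y = ((), decide (u ∈ informed s h))}
  busy := x.2.busy v
  ack := x.2.ack v
  ntd := decide (NearReception M x v)

lemma node_cons (h : History V) (x : Finset V × Outcome V) (v : V) :
    node M S s (x :: h) v = (node M S s h v).next S (observe M s h x v) := by
  obtain ⟨T, o⟩ := x
  unfold node
  rw [state]
  refine congrArg (NodeState.next S (node M S s h v)) ?_
  unfold observe
  congr 1
  exact decide_eq_decide.2 Iff.rfl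

lemma won_observe (h : History V) (x : Finset V × Outcome V) (v : V) :
    (observe M s h x v).won = true ↔ Wins M x v := by
  simp [observe, Observation.won, Wins, and_assoc]

lemma node_clock (h : History V) (v : V) : (node M S s h v).clock = h.length := by
  induction h with
  | nil => rw [node_nil]; rfl
  | cons x h ih =>
    rw [node_cons, NodeState.next]
    split_ifs <;> simp [ih]

lemma node_src (h : History V) (v : V) : (node M S s h v).src = true ↔ v = s := by
  induction h with
  | nil => rw [node_nil]; simp
  | cons x h ih =>
    rw [node_cons, NodeState.next]
    split_ifs <;> simpa using ih

section Election

variable {h : History V}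

lemma next_election (hh : h.length % 3 = 1) (x : Finset V × Outcome V) (v : V) :
    (node M S s h v).next S (observe M s h x v) =
    { clock := (node M S s h v).clock + 1
      src := (node M S s h v).src
      level := if (node M S s h v).pause = 0 then
        (if x.2.busy v then (node M S s h v).level + 1 else (node M S s h v).level - 1)
        else (node M S s h v).level
      pause := (node M S s h v).pause - 1
      fresh := (observe M s h x v).won
      wins := (node M S s h v).wins + if (observe M s h x v).won then 1 else 0 } := by
  rw [NodeState.next, if_pos (by rw [node_clock]; exact hh)]
  rfl

lemma pause_election (hh : h.length % 3 = 1) (x : Finset V × Outcome V) (v : V) :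
    (node M S s (x :: h) v).pause = (node M S s h v).pause - 1 := by
  rw [node_cons, next_election hh]

lemma fresh_election (hh : h.length % 3 = 1) (x : Finset V × Outcome V) (v : V) :
    (node M S s (x :: h) v).fresh = true ↔ Wins M x v := by
  rw [node_cons, next_election hh, won_observe]

open Classical in
lemma wins_election (hh : h.length % 3 = 1) (x : Finset V × Outcome V) (v : V) :
    (node M S s (x :: h) v).wins = (node M S s h v).wins + if Wins M x v then 1 else 0 := by
  rw [node_cons, next_election hh]
  simp only [won_observe]

lemma level_election_paused (hh : h.length % 3 = 1) (x : Finset V × Outcome V) (v : V)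
    (hp : (node M S s h v).pause ≠ 0) :
    (node M S s (x :: h) v).level = (node M S s h v).level := by
  rw [node_cons, next_election hh]
  simp only [if_neg hp]

lemma level_election_busy (hh : h.length % 3 = 1) (x : Finset V × Outcome V) (v : V)
    (hp : (node M S s h v).pause = 0) (hb : x.2.busy v = true) :
    (node M S s (x :: h) v).level = (node M S s h v).level + 1 := by
  rw [node_cons, next_election hh]
  simp only [if_pos hp, hb, if_true]

lemma level_election_idle (hh : h.length % 3 = 1) (x : Finset V × Outcome V) (v : V)
    (hp : (node M S s h v).pause = 0) (hb : x.2.busy v = false) :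
    (node M S s (x :: h) v).level = (node M S s h v).level - 1 := by
  rw [node_cons, next_election hh]
  simp [if_pos hp, hb]

end Election

section Notification

variable {h : History V}

/-- `v` has won the last election round or is notified of a near winner. -/
def Hit (M : Model) (S : ℕ) (s : V) (h : History V) (x : Finset V × Outcome V) (v : V) : Prop :=
  (node M S s h v).fresh = true ∨ NearReception M x v

lemma next_notification (hh : h.length % 3 = 2) (x : Finset V × Outcome V) (v : V) :
    (node M S s h v).next S (observe M s h x v) =
    { clock := (node M S s h v).clock + 1
      src := (node M S s h v).src
      level := (node M S s h v).level +
        if (node M S s h v).fresh || (observe M s h x v).ntd then 1 else 0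
      pause := if (node M S s h v).fresh || (observe M s h x v).ntd then S
        else (node M S s h v).pause
      fresh := false
      wins := (node M S s h v).wins } := by
  rw [NodeState.next, if_neg (by rw [node_clock]; omega), if_pos (by rw [node_clock]; exact hh)]

lemma hit_iff (h : History V) (x : Finset V × Outcome V) (v : V) :
    ((node M S s h v).fresh || (observe M s h x v).ntd) = true ↔
    Hit M S s h x v := by
  simp [Hit, observe]

open Classical in
lemma pause_notification (hh : h.length % 3 = 2) (x : Finset V × Outcome V) (v : V) :
    (node M S s (x :: h) v).pause =
    if Hit M S s h x v then S else (node M S s h v).pause := by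
  rw [node_cons, next_notification hh]
  simp only [hit_iff]

open Classical in
lemma level_notification (hh : h.length % 3 = 2) (x : Finset V × Outcome V) (v : V) :
    (node M S s (x :: h) v).level =
    (node M S s h v).level + if Hit M S s h x v then 1 else 0 := by
  rw [node_cons, next_notification hh]
  simp only [hit_iff]

lemma fresh_notification (hh : h.length % 3 = 2) (x : Finset V × Outcome V) (v : V) :
    (node M S s (x :: h) v).fresh = false := by
  rw [node_cons, next_notification hh]

lemma wins_notification (hh : h.length % 3 = 2) (x : Finset V × Outcome V) (v : V) :
    (node M S s (x :: h) v).wins = (node M S s h v).wins := by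
  rw [node_cons, next_notification hh]

end Notification

lemma node_dissemination {h : History V} (hh : h.length % 3 = 0) (x : Finset V × Outcome V)
    (v : V) : node M S s (x :: h) v =
      { node M S s h v with clock := (node M S s h v).clock + 1 } := by
  rw [node_cons, NodeState.next, if_neg (by rw [node_clock]; omega),
    if_neg (by rw [node_clock]; omega)]

end Steps

/-! ### Deterministic properties of executions -/

section Invariants

variable {V : Type} [Fintype V] [MetricSpace V] {M : Model} {S : ℕ} {s : V}

lemma transmitProb_eq (h : History V) (v : V) :
    transmitProb M (broadcast S) s h v = (node M S s h v).prob := rfl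

lemma transmitProb_election {h : History V} (hh : h.length % 3 = 1) (v : V) :
    transmitProb M (broadcast S) s h v =
      if (node M S s h v).pause = 0 then (1 / 2) ^ ((node M S s h v).level + 1) else 0 := by
  rw [transmitProb_eq, NodeState.prob, if_pos (by rw [node_clock]; exact hh)]

lemma transmitProb_notification {h : History V} (hh : h.length % 3 = 2) (v : V) :
    transmitProb M (broadcast S) s h v = if (node M S s h v).fresh then 1 / 2 else 0 := by
  rw [transmitProb_eq, NodeState.prob, if_neg (by rw [node_clock]; omega),
    if_pos (by rw [node_clock]; exact hh)]

lemma transmitProb_start (v : V) :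
    transmitProb M (broadcast S) s [] v = if (node M S s [] v).src then 1 else 0 := by
  rw [transmitProb_eq, NodeState.prob]
  simp [node_clock]

lemma transmitProb_dissemination {h : History V} (hh : h.length % 3 = 0) (h0 : h.length ≠ 0)
    (v : V) : transmitProb M (broadcast S) s h v =
      min (1 / 2) ((node M S s h v).wins / (2 * ((h.length / 3 : ℕ) : ℝ≥0))) := by
  rw [transmitProb_eq, NodeState.prob, node_clock, if_neg (by omega), if_neg (by omega), if_neg h0]

lemma transmitProb_le_half {h : History V} (h0 : h.length ≠ 0) (v : V) :
    transmitProb M (broadcast S) s h v ≤ 1 / 2 := by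
  have hlt : h.length % 3 < 3 := Nat.mod_lt _ (by norm_num)
  have h1 : (1 / 2 : ℝ≥0) ≤ 1 := by rw [← NNReal.coe_le_coe]; norm_num
  interval_cases hh : h.length % 3
  · rw [transmitProb_dissemination hh h0]
    exact min_le_left _ _
  · rw [transmitProb_election hh]
    split_ifs
    · rw [pow_succ]
      exact mul_le_of_le_one_left zero_le (pow_le_one₀ zero_le h1)
    · exact zero_le
  · rw [transmitProb_notification hh]
    split_ifs
    · exact le_rfl
    · exact zero_le

lemma near_le_reach (M : Model) : M.ε / 4 * M.R ≤ (1 - M.ε / 2) * M.R := by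
  have := M.ε_lt_one
  have := M.R_pos
  gcongr
  linarith

/-- The number of election rounds of a history. -/
def elections (h : History V) : ℝ := total (fun h _ => ind (h.length % 3 = 1)) h

lemma elections_eq (h : History V) : elections h = ((h.length + 1) / 3 : ℕ) := by
  unfold elections
  induction h with
  | nil => simp
  | cons x h ih =>
    rw [total_cons, ih, List.length_cons]
    by_cases hh : h.length % 3 = 1
    · rw [ind_pos hh, show (h.length + 1 + 1) / 3 = (h.length + 1) / 3 + 1 by omega]
      push_cast
      rfl
    · rw [ind_neg hh, show (h.length + 1 + 1) / 3 = (h.length + 1) / 3 by omega, add_zero]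

lemma elections_cons (x : Finset V × Outcome V) (h : History V) :
    elections (x :: h) = elections h + ind (h.length % 3 = 1) := rfl

lemma elections_nonneg (h : History V) : 0 ≤ elections h :=
  total_nonneg (fun _ _ => ind_nonneg _) h

lemma massDelivers_of_ack {A : Algorithm} {h : History V} {x : Finset V × Outcome V}
    (hx : RoundOK M A s h x) {u : V} (hu : u ∈ x.1) (ha : x.2.ack u = true) :
    MassDelivers M x.2 u := by
  by_contra hcon
  have := hx.legal.not_ack u hu hcon
  rw [ha] at this
  exact Bool.noConfusion this

/-- If two winners were close, the acknowledgement of one would mean that the other received its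
transmission, and this near reception would have prevented the other from winning. -/
lemma separated_of_wins {A : Algorithm} {h : History V} {x : Finset V × Outcome V}
    (hx : RoundOK M A s h x) {u v : V} (hu : Wins M x u) (hv : Wins M x v) (huv : u ≠ v) :
    M.ε / 4 * M.R ≤ dist u v := by
  by_contra hcon
  push Not at hcon
  refine hv.2.2 ⟨u, ?_, hcon⟩
  exact massDelivers_of_ack hx hu.1 hu.2.1 v huv.symm (hcon.le.trans (near_le_reach M))

lemma pause_eq_zero_of_wins {h : History V} (hh : h.length % 3 = 1) {x : Finset V × Outcome V}
    (hx : RoundOK M (broadcast S) s h x) {v : V} (hv : Wins M x v) :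
    (node M S s h v).pause = 0 := by
  have := hx.prob_ne_zero v hv.1
  rw [transmitProb_election hh] at this
  by_contra hcon
  exact this (if_neg hcon)

lemma fresh_of_mem {h : History V} (hh : h.length % 3 = 2) {x : Finset V × Outcome V}
    (hx : RoundOK M (broadcast S) s h x) {v : V} (hv : v ∈ x.1) :
    (node M S s h v).fresh = true := by
  have := hx.prob_ne_zero v hv
  rw [transmitProb_notification hh] at this
  by_contra hcon
  exact this (if_neg hcon)

lemma near_pos (M : Model) : 0 < M.ε / 4 * M.R := by
  have := M.ε_pos
  have := M.R_pos
  positivity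

lemma exists_fresh_of_hit {h : History V} (hh : h.length % 3 = 2) {x : Finset V × Outcome V}
    (hx : RoundOK M (broadcast S) s h x) {v : V} (hv : Hit M S s h x v) :
    ∃ u, (node M S s h u).fresh = true ∧ dist u v < M.ε / 4 * M.R := by
  rcases hv with hv | ⟨u, hu, huv⟩
  · exact ⟨v, hv, by rw [dist_self]; exact near_pos M⟩
  · exact ⟨u, fresh_of_mem hh hx (hx.legal.received_sent u v hu).1, huv⟩

/-- A winner has transmitted, so its pause was 0, and truncated subtraction keeps it at 0 until the
notification round. This is why no running pause ever covers a node that notifies. -/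
lemma fresh_spec {h : History V} (hv : Valid M (broadcast S) s h) :
    (∀ u, (node M S s h u).fresh = true → h.length % 3 = 2 ∧ (node M S s h u).pause = 0) ∧
      ∀ u v, (node M S s h u).fresh = true → (node M S s h v).fresh = true → u ≠ v →
        M.ε / 4 * M.R ≤ dist u v := by
  induction h with
  | nil => simp [node_nil]
  | cons x h ih =>
    obtain ⟨hv, hx⟩ := hv
    have ih := ih hv
    have hlt : h.length % 3 < 3 := Nat.mod_lt _ (by norm_num)
    interval_cases hh : h.length % 3
    · simp only [node_dissemination hh]
      have hno : ∀ u, (node M S s h u).fresh ≠ true := fun u hu => by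
        have := (ih.1 u hu).1
        omega
      exact ⟨fun u hu => absurd hu (hno u), fun u v hu => absurd hu (hno u)⟩
    · simp only [fresh_election hh, pause_election hh, List.length_cons]
      refine ⟨fun u hu => ⟨by omega, ?_⟩, fun u v hu hv huv => separated_of_wins hx hu hv huv⟩
      rw [pause_eq_zero_of_wins hh hx hu]
    · simp [fresh_notification hh]

open Classical in
/-- The winners of the last election round. -/
def freshSet (M : Model) (S : ℕ) (s : V) (h : History V) : Finset V :=
  Finset.univ.filter fun v => (node M S s h v).fresh = true

lemma mem_freshSet {h : History V} {v : V} :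
    v ∈ freshSet M S s h ↔ (node M S s h v).fresh = true := by
  simp [freshSet]

lemma freshSet_separated {h : History V} (hv : Valid M (broadcast S) s h) :
    Separated (M.ε / 4 * M.R) (freshSet M S s h) := by
  intro u hu v hv' huv
  exact (fresh_spec hv).2 u v (mem_freshSet.1 hu) (mem_freshSet.1 hv') huv

open Classical in
lemma wins_cons_of_election {h : History V} (hh : h.length % 3 = 1) (x : Finset V × Outcome V)
    (v : V) : ((node M S s (x :: h) v).wins : ℝ) =
      (node M S s h v).wins + if v ∈ freshSet M S s (x :: h) then 1 else 0 := by
  rw [wins_election hh]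
  simp only [mem_freshSet, fresh_election hh]
  push_cast
  rfl

lemma wins_cons_of_not_election {h : History V} (hh : h.length % 3 ≠ 1)
    (x : Finset V × Outcome V) (v : V) :
    (node M S s (x :: h) v).wins = (node M S s h v).wins := by
  have hlt : h.length % 3 < 3 := Nat.mod_lt _ (by norm_num)
  by_cases hh2 : h.length % 3 = 2
  · rw [wins_notification hh2]
  · rw [node_dissemination (by omega)]

/-- The number of rounds in which `v` is notified. -/
def hits (M : Model) (S : ℕ) (s : V) (v : V) (h : History V) : ℝ :=
  total (fun h x => ind (h.length % 3 = 2 ∧ Hit M S s h x v)) h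

open Classical in
-- Each hit is charged to a fresh node within εR/4. The sum over fresh nodes on the left holds the
-- wins that are counted already but still await their notification round, where they pay for the
-- hit.
lemma hits_le_sum_wins {h : History V} (hv : Valid M (broadcast S) s h) (v : V) :
    hits M S s v h + ∑ u with dist u v < M.ε / 4 * M.R,
        (if u ∈ freshSet M S s h then (1 : ℝ) else 0) ≤
      ∑ u with dist u v < M.ε / 4 * M.R, ((node M S s h u).wins : ℝ) := by
  unfold hits
  induction h with
  | nil => simp [node_nil, mem_freshSet]
  | cons x h ih =>
    obtain ⟨hv, hx⟩ := hv
    have ih := ih hv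
    have hnn : 0 ≤ ∑ u with dist u v < M.ε / 4 * M.R,
        (if u ∈ freshSet M S s h then (1 : ℝ) else 0) :=
      Finset.sum_nonneg fun u _ => by split_ifs <;> norm_num
    rw [total_cons]
    have hlt : h.length % 3 < 3 := Nat.mod_lt _ (by norm_num)
    interval_cases hh : h.length % 3
    · simp only [mem_freshSet, node_dissemination hh] at ih ⊢
      rw [ind_neg (by norm_num), add_zero]
      exact ih
    · rw [ind_neg (by norm_num), add_zero]
      simp only [wins_cons_of_election hh, Finset.sum_add_distrib]
      linarith
    · simp only [wins_cons_of_not_election (by omega : h.length % 3 ≠ 1)]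
      have h0 : ∑ u with dist u v < M.ε / 4 * M.R,
          (if u ∈ freshSet M S s (x :: h) then (1 : ℝ) else 0) = 0 :=
        Finset.sum_eq_zero fun u _ => by simp [mem_freshSet, fresh_notification hh]
      rw [h0, add_zero]
      by_cases hhit : Hit M S s h x v
      · obtain ⟨u, hu, huv⟩ := exists_fresh_of_hit hh hx hhit
        have h1 : 1 ≤ ∑ u with dist u v < M.ε / 4 * M.R,
            (if u ∈ freshSet M S s h then (1 : ℝ) else 0) := by
          refine le_trans ?_ (Finset.single_le_sum (fun u _ => by split_ifs <;> norm_num)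
            (Finset.mem_filter.2 ⟨Finset.mem_univ u, huv⟩))
          rw [if_pos (mem_freshSet.2 hu)]
        have := ind_le_one (True ∧ Hit M S s h x v)
        linarith
      · rw [ind_neg (by tauto)]
        linarith

/-- Each election adds the `g`-weight of its winners, a separated set. Divided by the number of
elections, the win counts thus inherit every bound that holds for separated sets. -/
lemma sum_wins_mul_le {h : History V} (hv : Valid M (broadcast S) s h) {g : V → ℝ} {G : ℝ}
    (hG : ∀ Z : Finset V, Separated (M.ε / 4 * M.R) Z → ∑ z ∈ Z, g z ≤ G) :
    ∑ w, ((node M S s h w).wins : ℝ) * g w ≤ G * elections h := by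
  classical
  induction h with
  | nil => simp [node_nil, elections]
  | cons x h ih =>
    have ih := ih hv.1
    rw [elections_cons]
    by_cases hh : h.length % 3 = 1
    · rw [ind_pos hh]
      have h1 := hG _ (freshSet_separated hv)
      simp only [wins_cons_of_election hh, add_mul, Finset.sum_add_distrib, ite_mul, one_mul,
        zero_mul, Finset.sum_ite_mem, Finset.univ_inter]
      linarith
    · rw [ind_neg hh, add_zero]
      simpa only [wins_cons_of_not_election hh] using ih

/-- The sharper bound just before an election is what lets the induction pass that election. -/
lemma wins_le (h : History V) (v : V) : 3 * (node M S s h v).wins ≤ h.length + 1 ∧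
    (h.length % 3 = 1 → 3 * (node M S s h v).wins ≤ h.length) := by
  classical
  induction h with
  | nil => simp [node_nil]
  | cons x h ih =>
    by_cases hh : h.length % 3 = 1
    · rw [wins_election hh, List.length_cons]
      split_ifs <;> omega
    · rw [wins_cons_of_not_election hh, List.length_cons]
      omega

/-! ### Pauses and levels -/

/-- A hit sets the pause to `S`, and each paused election uses up one unit of it. -/
lemma paused_add_pause_le (v : V) (h : History V) :
    total (fun h _ => ind (h.length % 3 = 1 ∧ (node M S s h v).pause ≠ 0)) h +
      (node M S s h v).pause ≤ S * hits M S s v h := by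
  unfold hits
  induction h with
  | nil => simp [node_nil]
  | cons x h ih =>
    rw [total_cons, total_cons]
    have hlt : h.length % 3 < 3 := Nat.mod_lt _ (by norm_num)
    interval_cases hh : h.length % 3
    · rw [node_dissemination hh, ind_neg (by norm_num), ind_neg (by norm_num), add_zero, add_zero]
      exact ih
    · rw [pause_election hh, ind_neg (p := _ ∧ Hit M S s h x v) (by norm_num), add_zero]
      by_cases hp : (node M S s h v).pause = 0
      · rw [ind_neg (by simp [hp]), hp]
        rw [hp] at ih
        simpa using ih
      · rw [ind_pos ⟨rfl, hp⟩, Nat.cast_sub (Nat.one_le_iff_ne_zero.2 hp)]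
        push_cast
        linarith
    · rw [pause_notification hh, ind_neg (p := _ ∧ (node M S s h v).pause ≠ 0) (by norm_num),
        add_zero, mul_add]
      have h0 : 0 ≤ total (fun h _ => ind (h.length % 3 = 1 ∧ (node M S s h v).pause ≠ 0)) h :=
        total_nonneg (fun _ _ => ind_nonneg _) h
      by_cases hhit : Hit M S s h x v
      · rw [ind_pos ⟨rfl, hhit⟩, if_pos hhit, mul_one]
        have : (0 : ℝ) ≤ (node M S s h v).pause := Nat.cast_nonneg _
        linarith
      · rw [ind_neg (by tauto), if_neg hhit, mul_zero, add_zero]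
        exact ih

/-- The level rises by at most 1 per contending election and per hit. A detected idle channel lowers
it instead, a swing of 2 against the budget; `hLow` ensures that the truncated subtraction really
lowers it. -/
lemma level_add_le (v : V) {Low : History V → Prop}
    (hLow : ∀ h : History V, h.length % 3 = 1 → (node M S s h v).pause = 0 → Low h →
      1 ≤ (node M S s h v).level) (h : History V) :
    (node M S s h v).level + 2 * total (fun h x => ind ((h.length % 3 = 1 ∧
        (node M S s h v).pause = 0 ∧ Low h) ∧ x.2.busy v = false)) h ≤
      total (fun h _ => ind (h.length % 3 = 1 ∧ (node M S s h v).pause = 0)) h +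
        hits M S s v h := by
  unfold hits
  induction h with
  | nil => simp [node_nil]
  | cons x h ih =>
    simp only [total_cons]
    have hlt : h.length % 3 < 3 := Nat.mod_lt _ (by norm_num)
    by_cases hh : h.length % 3 = 1
    · rw [ind_neg (p := _ ∧ Hit M S s h x v) (by omega), add_zero]
      by_cases hp : (node M S s h v).pause = 0
      · rw [ind_pos (p := _ ∧ (node M S s h v).pause = 0) ⟨hh, hp⟩]
        cases hb : x.2.busy v with
        | true =>
          rw [level_election_busy hh x v hp hb, ind_neg (by simp), add_zero]
          push_cast
          linarith
        | false =>
          rw [level_election_idle hh x v hp hb]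
          by_cases hl : Low h
          · rw [ind_pos ⟨⟨hh, hp, hl⟩, rfl⟩, Nat.cast_sub (hLow h hh hp hl)]
            push_cast
            linarith
          · rw [ind_neg (by tauto), add_zero]
            have : (((node M S s h v).level - 1 : ℕ) : ℝ) ≤ (node M S s h v).level := by
              exact_mod_cast Nat.sub_le _ _
            linarith
      · rw [level_election_paused hh x v hp, ind_neg (by tauto), ind_neg (by tauto), add_zero,
          add_zero]
        exact ih
    · rw [ind_neg (p := _ ∧ x.2.busy v = false) (by tauto),
        ind_neg (p := _ ∧ (node M S s h v).pause = 0) (by tauto), add_zero, add_zero]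
      by_cases hh2 : h.length % 3 = 2
      · rw [level_notification hh2]
        by_cases hhit : Hit M S s h x v
        · rw [ind_pos ⟨hh2, hhit⟩, if_pos hhit]
          push_cast
          linarith
        · rw [ind_neg (by tauto), if_neg hhit, add_zero, add_zero]
          exact ih
      · rw [node_dissemination (by omega), ind_neg (by tauto), add_zero]
        exact ih

/-! ### Successful notifications -/

/-- `u` has won the last election round and notifies all neighbours. -/
def Notifies (M : Model) (S : ℕ) (s : V) (h : History V) (x : Finset V × Outcome V) (u : V) :
    Prop :=
  h.length % 3 = 2 ∧ (node M S s h u).fresh = true ∧ MassDelivers M x.2 u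

lemma hit_of_notifies {h : History V} {x : Finset V × Outcome V} {u v : V}
    (hu : Notifies M S s h x u) (huv : dist u v < M.ε / 4 * M.R) : Hit M S s h x v := by
  by_cases huv' : v = u
  · exact Or.inl (huv' ▸ hu.2.1)
  · exact Or.inr ⟨u, hu.2.2 v huv' (huv.le.trans (near_le_reach M)), huv⟩

open Classical in
/-- The remaining time of the pause that `u` has imposed on its vicinity by its last successful
notification. -/
def timer (M : Model) (S : ℕ) (s : V) (u : V) : History V → ℕ
  | [] => 0
  | x :: h => if Notifies M S s h x u then S else
      if h.length % 3 = 1 then timer M S s u h - 1 else timer M S s u h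

lemma timer_le (u : V) (h : History V) : timer M S s u h ≤ S := by
  induction h with
  | nil => exact Nat.zero_le _
  | cons x h ih =>
    rw [timer]
    split_ifs <;> omega

/-- A successful notification by `u` reaches `v` and sets its pause to `S`. Afterwards both count
down together, and any further hit only resets the pause to `S`. -/
lemma timer_le_pause {u v : V} (huv : dist u v < M.ε / 4 * M.R) (h : History V) :
    timer M S s u h ≤ (node M S s h v).pause := by
  induction h with
  | nil => exact Nat.zero_le _
  | cons x h ih =>
    have hle := timer_le (M := M) (S := S) (s := s) u h
    have hlt : h.length % 3 < 3 := Nat.mod_lt _ (by norm_num)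
    rw [timer]
    by_cases hn : Notifies M S s h x u
    · rw [if_pos hn, pause_notification hn.1, if_pos (hit_of_notifies hn huv)]
    · rw [if_neg hn]
      interval_cases hh : h.length % 3
      · rw [if_neg (by norm_num), node_dissemination hh]
        exact ih
      · rw [if_pos rfl, pause_election hh]
        omega
      · rw [if_neg (by norm_num), pause_notification hh]
        split_ifs <;> omega

lemma timer_eq_zero_of_fresh {h : History V} (hv : Valid M (broadcast S) s h) {u v : V}
    (hu : (node M S s h u).fresh = true) (huv : dist u v < M.ε / 4 * M.R) :
    timer M S s v h = 0 := by
  have h1 := timer_le_pause (M := M) (S := S) (s := s) (u := v) (v := u)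
    (by rwa [dist_comm]) h
  rw [((fresh_spec hv).1 u hu).2] at h1
  omega

/-- A node that starts its timer has just won, so it was not paused and no timer near it was
running; timers that start together belong to winners of the same election. -/
lemma timer_separated {h : History V} (hv : Valid M (broadcast S) s h) {u v : V}
    (hu : timer M S s u h ≠ 0) (hv' : timer M S s v h ≠ 0) (huv : u ≠ v) :
    M.ε / 4 * M.R ≤ dist u v := by
  induction h with
  | nil => exact absurd rfl hu
  | cons x h ih =>
    obtain ⟨hv, hx⟩ := hv
    have hold : ∀ w, ¬ Notifies M S s h x w → timer M S s w (x :: h) ≠ 0 →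
        timer M S s w h ≠ 0 := by
      intro w hw
      rw [timer, if_neg hw]
      split_ifs <;> omega
    by_contra hcon
    push Not at hcon
    by_cases hnu : Notifies M S s h x u
    · by_cases hnv : Notifies M S s h x v
      · exact absurd ((fresh_spec hv).2 u v hnu.2.1 hnv.2.1 huv) (not_le.2 hcon)
      · exact hold v hnv hv' (timer_eq_zero_of_fresh hv hnu.2.1 hcon)
    · by_cases hnv : Notifies M S s h x v
      · exact hold u hnu hu (timer_eq_zero_of_fresh hv hnv.2.1 (by rwa [dist_comm]))
      · exact absurd (ih hv (hold u hnu hu) (hold v hnv hv')) (not_le.2 hcon)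

/-- Successful notifications in a region of bounded size are rare, because each of them silences its
vicinity for `S` election rounds. -/
lemma mul_notifications_le {U : Finset V} {N : ℝ}
    (hN : ∀ Z ⊆ U, Separated (M.ε / 4 * M.R) Z → (Z.card : ℝ) ≤ N) {h : History V}
    (hv : Valid M (broadcast S) s h) :
    S * total (fun h x => ind (∃ u ∈ U, Notifies M S s h x u)) h ≤ N * elections h + N * S := by
  classical
  have hcard : ∀ h : History V, Valid M (broadcast S) s h →
      ((U.filter fun u => timer M S s u h ≠ 0).card : ℝ) ≤ N := fun h hv =>
    hN _ (Finset.filter_subset _ _) fun u hu v hv' huv =>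
      timer_separated hv (Finset.mem_filter.1 hu).2 (Finset.mem_filter.1 hv').2 huv
  -- Potential argument with the sum of the timers: a round with a successful notification raises it
  -- by at least `S`, since that timer was at 0, and an election lowers it by at most the number of
  -- running timers.
  have key : S * total (fun h x => ind (∃ u ∈ U, Notifies M S s h x u)) h ≤
      N * elections h + ∑ u ∈ U, (timer M S s u h : ℝ) := by
    induction h with
    | nil => simp [elections, timer]
    | cons x h ih =>
      obtain ⟨hv, hx⟩ := hv
      have ih := ih hv
      rw [total_cons, elections_cons]
      by_cases hh : h.length % 3 = 1
      · have hno : ∀ u, ¬ Notifies M S s h x u := fun u hu => by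
          have := hu.1
          omega
        rw [ind_neg (by push Not; exact fun u _ => hno u), ind_pos hh, add_zero]
        have h1 : ∑ u ∈ U, (timer M S s u h : ℝ) ≤
            ∑ u ∈ U, (timer M S s u (x :: h) : ℝ) +
              (U.filter fun u => timer M S s u h ≠ 0).card := by
          rw [Finset.card_filter]
          push_cast
          rw [← Finset.sum_add_distrib]
          refine Finset.sum_le_sum fun u _ => ?_
          rw [timer, if_neg (hno u), if_pos hh]
          norm_cast
          split_ifs <;> omega
        have := hcard h hv
        linarith
      · rw [ind_neg hh, add_zero]
        have hmono : ∀ u, timer M S s u h ≤ timer M S s u (x :: h) := fun u => by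
          rw [timer, if_neg hh]
          split_ifs
          · exact timer_le u h
          · exact le_rfl
        by_cases hex : ∃ u ∈ U, Notifies M S s h x u
        · obtain ⟨u, huU, hu⟩ := hex
          rw [ind_pos ⟨u, huU, hu⟩]
          have h0 : timer M S s u h = 0 :=
            timer_eq_zero_of_fresh hv hu.2.1 (by rw [dist_self]; exact near_pos M)
          have h1 : timer M S s u (x :: h) = S := by rw [timer, if_pos hu]
          rw [← Finset.add_sum_erase _ _ huU] at ih ⊢
          have h2 : ∑ u ∈ U.erase u, (timer M S s u h : ℝ) ≤
              ∑ u ∈ U.erase u, (timer M S s u (x :: h) : ℝ) :=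
            Finset.sum_le_sum fun w _ => by exact_mod_cast hmono w
          rw [h1]
          rw [h0] at ih
          push_cast at ih
          linarith
        · rw [ind_neg hex, add_zero]
          have h2 : ∑ u ∈ U, (timer M S s u h : ℝ) ≤ ∑ u ∈ U, (timer M S s u (x :: h) : ℝ) :=
            Finset.sum_le_sum fun w _ => by exact_mod_cast hmono w
          linarith
  refine key.trans ?_
  have h1 : ∑ u ∈ U, (timer M S s u h : ℝ) ≤
      ∑ u ∈ U, if timer M S s u h ≠ 0 then (S : ℝ) else 0 := by
    refine Finset.sum_le_sum fun u _ => ?_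
    split_ifs with h0
    · exact_mod_cast timer_le u h
    · simp only [ne_eq, not_not] at h0
      simp [h0]
  rw [← Finset.sum_filter, Finset.sum_const, nsmul_eq_mul] at h1
  have h2 := mul_le_mul_of_nonneg_right (hcard h hv) (Nat.cast_nonneg (α := ℝ) S)
  linarith

end Invariants

/-! ### The contention is moderate most of the time -/

section Contention

variable {V : Type} [Fintype V] [MetricSpace V] {M : Model} {S : ℕ} {s : V}

lemma contention_nonneg {A : Algorithm} (h : History V) (B : Set V) :
    0 ≤ contention M A s h B :=
  Finset.sum_nonneg fun _ _ => NNReal.coe_nonneg _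

/-- The potential of a node: its probability when it contends, increased by a factor `γ` for each
election round for which it is still paused. -/
def potential (M : Model) (S : ℕ) (s : V) (γ : ℝ) (h : History V) (v : V) : ℝ :=
  (1 / 2) ^ ((node M S s h v).level + 1) * γ ^ (node M S s h v).pause

open Classical in
/-- The total potential of a set of nodes. -/
def mass (M : Model) (S : ℕ) (s : V) (γ : ℝ) (B : Set V) (h : History V) : ℝ :=
  ∑ v with v ∈ B, potential M S s γ h v

/-- Contention detection fails to report a high contention in `B` to all nodes of `B`. -/
def BusyFails (M : Model) (S : ℕ) (s : V) (B : Set V) (h : History V)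
    (x : Finset V × Outcome V) : Prop :=
  h.length % 3 = 1 ∧ M.φ₀ < contention M (broadcast S) s h B ∧ ¬ ∀ w ∈ B, x.2.busy w = true

variable {γ : ℝ}

lemma potential_nonneg (hγ : 1 ≤ γ) (h : History V) (v : V) : 0 ≤ potential M S s γ h v := by
  unfold potential
  positivity

lemma mass_nonneg (hγ : 1 ≤ γ) (B : Set V) (h : History V) : 0 ≤ mass M S s γ B h :=
  Finset.sum_nonneg fun v _ => potential_nonneg hγ h v

lemma coe_transmitProb_election {h : History V} (hh : h.length % 3 = 1) (v : V) :
    (transmitProb M (broadcast S) s h v : ℝ) =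
      if (node M S s h v).pause = 0 then (1 / 2) ^ ((node M S s h v).level + 1) else 0 := by
  rw [transmitProb_election hh]
  split_ifs <;> simp

lemma potential_election_paused {h : History V} (hh : h.length % 3 = 1) (hγ : 1 ≤ γ)
    (x : Finset V × Outcome V) {v : V} (hp : (node M S s h v).pause ≠ 0) :
    potential M S s γ (x :: h) v =
      γ⁻¹ * potential M S s γ h v - transmitProb M (broadcast S) s h v / 4 := by
  unfold potential
  rw [coe_transmitProb_election hh, if_neg hp, level_election_paused hh x v hp, pause_election hh]
  obtain ⟨m, hm⟩ := Nat.exists_eq_succ_of_ne_zero hp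
  rw [hm, Nat.succ_sub_one, pow_succ γ]
  have : γ ≠ 0 := by linarith
  field_simp
  ring

/-- For a contending node the new potential p/2 equals (3/4)p - p/4, and 3/4 ≤ γ⁻¹ by the choice of
γ. The term p/4 is the gain that later pays for the contention. -/
lemma potential_election_busy {h : History V} (hh : h.length % 3 = 1) (hγ : 1 ≤ γ)
    (hγ' : γ ≤ 4 / 3) (x : Finset V × Outcome V) {v : V} (hb : x.2.busy v = true) :
    potential M S s γ (x :: h) v ≤
      γ⁻¹ * potential M S s γ h v - transmitProb M (broadcast S) s h v / 4 := by
  by_cases hp : (node M S s h v).pause = 0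
  · unfold potential
    rw [coe_transmitProb_election hh, if_pos hp, level_election_busy hh x v hp hb,
      pause_election hh, hp, pow_zero, mul_one, mul_one, pow_succ _ (_ + 1)]
    have h1 : (3 / 4 : ℝ) ≤ γ⁻¹ := by
      rw [le_inv_comm₀ (by norm_num) (by linarith)]; linarith
    have h2 : (0 : ℝ) ≤ (1 / 2) ^ ((node M S s h v).level + 1) := by positivity
    nlinarith
  · exact (potential_election_paused hh hγ x hp).le

/-- At worst the probability doubles, and 2 = 3/4 - 1/4 + 3/2. -/
lemma potential_election {h : History V} (hh : h.length % 3 = 1) (hγ : 1 ≤ γ)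
    (hγ' : γ ≤ 4 / 3) (x : Finset V × Outcome V) (v : V) :
    potential M S s γ (x :: h) v ≤ γ⁻¹ * potential M S s γ h v -
      transmitProb M (broadcast S) s h v / 4 + 3 / 2 * transmitProb M (broadcast S) s h v := by
  have hnn : (0 : ℝ) ≤ transmitProb M (broadcast S) s h v := NNReal.coe_nonneg _
  by_cases hp : (node M S s h v).pause = 0
  · cases hb : x.2.busy v with
    | true =>
      have := potential_election_busy (M := M) (S := S) (s := s) hh hγ hγ' x hb
      linarith
    | false =>
      unfold potential
      rw [coe_transmitProb_election hh, if_pos hp, level_election_idle hh x v hp hb,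
        pause_election hh, hp, pow_zero, mul_one, mul_one]
      have h1 : (3 / 4 : ℝ) ≤ γ⁻¹ := by
        rw [le_inv_comm₀ (by norm_num) (by linarith)]; linarith
      have h2 : (0 : ℝ) ≤ (1 / 2) ^ ((node M S s h v).level + 1) := by positivity
      have h3 : ((1 : ℝ) / 2) ^ ((node M S s h v).level - 1 + 1) ≤
          2 * (1 / 2) ^ ((node M S s h v).level + 1) := by
        have h4 : ((1 : ℝ) / 2) ^ ((node M S s h v).level - 1 + 1) ≤
            (1 / 2) ^ (node M S s h v).level :=
          pow_le_pow_of_le_one (by norm_num) (by norm_num) (by omega)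
        rw [pow_succ _ (node M S s h v).level]
        linarith
      nlinarith
  · have := potential_election_paused (M := M) (S := S) (s := s) hh hγ x hp
    linarith

/-- If the contention is at most φ₀, the growth is O(φ₀); if it is larger and all of `B` senses
Busy, there is no growth; otherwise the contention is booked as failed. -/
lemma mass_election_le {h : History V} (hh : h.length % 3 = 1) (hγ : 1 ≤ γ)
    (hγ' : γ ≤ 4 / 3) (x : Finset V × Outcome V) (B : Set V) :
    mass M S s γ B (x :: h) ≤ γ⁻¹ * mass M S s γ B h - contention M (broadcast S) s h B / 4 +
      3 / 2 * M.φ₀ +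
      3 / 2 * (contention M (broadcast S) s h B * ind (BusyFails M S s B h x)) := by
  classical
  have hφ := M.one_le_φ₀
  have hc := contention_nonneg (M := M) (A := broadcast S) (s := s) h B
  have hgen : mass M S s γ B (x :: h) ≤ γ⁻¹ * mass M S s γ B h -
      contention M (broadcast S) s h B / 4 + 3 / 2 * contention M (broadcast S) s h B := by
    unfold mass contention
    rw [Finset.mul_sum, Finset.mul_sum, Finset.sum_div, ← Finset.sum_sub_distrib,
      ← Finset.sum_add_distrib]
    exact Finset.sum_le_sum fun v _ => potential_election hh hγ hγ' x v
  by_cases hf : BusyFails M S s B h x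
  · rw [ind_pos hf]
    linarith
  · rw [ind_neg hf]
    by_cases hφc : M.φ₀ < contention M (broadcast S) s h B
    · have hb : ∀ w ∈ B, x.2.busy w = true := by
        by_contra hb
        exact hf ⟨hh, hφc, hb⟩
      have : mass M S s γ B (x :: h) ≤ γ⁻¹ * mass M S s γ B h -
          contention M (broadcast S) s h B / 4 := by
        unfold mass contention
        rw [Finset.mul_sum, Finset.sum_div, ← Finset.sum_sub_distrib]
        exact Finset.sum_le_sum fun v hv =>
          potential_election_busy hh hγ hγ' x (hb v (Finset.mem_filter.1 hv).2)
      linarith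
    · linarith

/-- A hit halves the probability, and the new pause costs a factor γ^S ≤ 2. This balance is why a
notified node also raises its level. -/
lemma mass_le_of_not_election {h : History V} (hh : h.length % 3 ≠ 1) (hγ : 1 ≤ γ)
    (hS : γ ^ S ≤ 2) (x : Finset V × Outcome V) (B : Set V) :
    mass M S s γ B (x :: h) ≤ mass M S s γ B h := by
  refine Finset.sum_le_sum fun v _ => ?_
  unfold potential
  have hlt : h.length % 3 < 3 := Nat.mod_lt _ (by norm_num)
  by_cases hh2 : h.length % 3 = 2
  · rw [level_notification hh2, pause_notification hh2]
    split_ifs with hit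
    · rw [pow_succ _ (_ + 1), mul_assoc]
      have h1 : (1 : ℝ) ≤ γ ^ (node M S s h v).pause := one_le_pow₀ hγ
      gcongr
      linarith
    · simp
  · rw [node_dissemination (by omega)]

lemma total_eq_zero_of_length_le {f : History V → Finset V × Outcome V → ℝ} {t₀ : ℕ}
    (hf : ∀ (h : History V) x, h.length < t₀ → f h x = 0) {h : History V} (hh : h.length ≤ t₀) :
    total f h = 0 := by
  induction h with
  | nil => rfl
  | cons x h ih =>
    rw [List.length_cons] at hh
    rw [total_cons, ih (by omega), hf h x (by omega), add_zero]

/-- The sum of the contention in `B` over the election rounds from round `t₀` on. -/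
def lateContention (M : Model) (S : ℕ) (s : V) (t₀ : ℕ) (B : Set V) (h : History V) : ℝ :=
  total (fun h _ => ind (h.length % 3 = 1 ∧ t₀ ≤ h.length) * contention M (broadcast S) s h B) h

/-- The sum of the contention in `B` over the rounds in which its detection fails. -/
def failedContention (M : Model) (S : ℕ) (s : V) (B : Set V) (h : History V) : ℝ :=
  total (fun h x => contention M (broadcast S) s h B * ind (BusyFails M S s B h x)) h

lemma failedContention_nonneg (B : Set V) (h : History V) :
    0 ≤ failedContention M S s B h :=
  total_nonneg (fun h _ => mul_nonneg (contention_nonneg h B) (ind_nonneg _)) h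

/-- The drift inequality is summed up. Before `t₀` its contraction is used to shrink the initial
mass, at most `Fintype.card V`, geometrically; from `t₀` on the contraction is dropped and a quarter
of the contention is collected. -/
lemma lateContention_add_mass_le (hγ : 1 ≤ γ) (hγ' : γ ≤ 4 / 3) (hS : γ ^ S ≤ 2) (t₀ : ℕ)
    (B : Set V) (h : History V) :
    lateContention M S s t₀ B h / 4 + mass M S s γ B h ≤
      γ⁻¹ ^ ((min h.length t₀ + 1) / 3) * Fintype.card V + 3 / 2 * M.φ₀ * elections h +
        3 / 2 * failedContention M S s B h := by
  classical
  have hφ := M.one_le_φ₀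
  have hγ1 : γ⁻¹ ≤ 1 := inv_le_one_of_one_le₀ hγ
  have hγ0 : 0 ≤ γ⁻¹ := by positivity
  induction h with
  | nil =>
    have : mass M S s γ B ([] : History V) ≤ Fintype.card V := by
      unfold mass potential
      simp only [node_nil, pow_zero, mul_one, zero_add, pow_one]
      rw [Finset.sum_const, nsmul_eq_mul]
      have h1 : ((Finset.univ.filter fun v => v ∈ B).card : ℝ) ≤ Fintype.card V := by
        exact_mod_cast Finset.card_le_univ _
      have h2 : (0 : ℝ) ≤ (Finset.univ.filter fun v => v ∈ B).card := Nat.cast_nonneg _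
      linarith
    simpa [lateContention, failedContention, elections] using this
  | cons x h ih =>
    have hm := mass_nonneg (M := M) (S := S) (s := s) hγ B h
    have hF : failedContention M S s B (x :: h) = failedContention M S s B h +
      contention M (broadcast S) s h B * ind (BusyFails M S s B h x) := rfl
    have hL : lateContention M S s t₀ B (x :: h) = lateContention M S s t₀ B h +
      ind (h.length % 3 = 1 ∧ t₀ ≤ h.length) * contention M (broadcast S) s h B := rfl
    have hFn := failedContention_nonneg (M := M) (S := S) (s := s) B h
    have hen := elections_nonneg h
    have hc := contention_nonneg (M := M) (A := broadcast S) (s := s) h B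
    rw [hF, hL, elections_cons, List.length_cons]
    by_cases hh : h.length % 3 = 1
    · have hstep := mass_election_le (M := M) (S := S) (s := s) hh hγ hγ' x B
      rw [ind_pos hh]
      by_cases ht : t₀ ≤ h.length
      · rw [ind_pos ⟨hh, ht⟩, min_eq_right (by omega)]
        rw [min_eq_right ht] at ih
        nlinarith
      · rw [ind_neg (by tauto), zero_mul, add_zero, min_eq_left (by omega),
          show (h.length + 1 + 1) / 3 = (h.length + 1) / 3 + 1 by omega, pow_succ]
        have hL0 : lateContention M S s t₀ B h = 0 :=
          total_eq_zero_of_length_le (t₀ := t₀)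
            (fun h x hlt => by rw [ind_neg (by omega), zero_mul]) (by omega)
        rw [hL0, min_eq_left (by omega)] at ih
        rw [hL0]
        have h1 := mul_le_mul_of_nonneg_left ih hγ0
        have h2 : γ⁻¹ * (3 / 2 * M.φ₀ * elections h + 3 / 2 * failedContention M S s B h) ≤
            1 * (3 / 2 * M.φ₀ * elections h + 3 / 2 * failedContention M S s B h) := by
          gcongr
        nlinarith
    · have hstep := mass_le_of_not_election (M := M) (S := S) (s := s) hh hγ hS x B
      have hnf : ¬ BusyFails M S s B h x := fun hf => hh hf.1
      rw [ind_neg (by tauto), ind_neg hh, ind_neg hnf]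
      have : γ⁻¹ ^ ((min h.length t₀ + 1) / 3) ≤ γ⁻¹ ^ ((min (h.length + 1) t₀ + 1) / 3) := by
        refine pow_le_pow_of_le_one hγ0 hγ1 ?_
        rcases le_total t₀ h.length with ht | ht
        · omega
        · rcases Nat.lt_or_ge h.length t₀ with ht' | ht'
          · rw [min_eq_left (by omega)]; omega
          · omega
      have h3 := mul_le_mul_of_nonneg_right this (Nat.cast_nonneg (α := ℝ) (Fintype.card V))
      linarith

variable {adv : Adversary V}

open Classical in
-- With a = (log h₁)/2 the factor e^(ac) of a failure at contention c is outweighed by its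
-- probability, so a failed election contributes at most 2 to the exponential moment. The
-- compensator log 2 per election restores a supermartingale, and 2 - log 2 ≥ 1 yields the rate.
lemma law_failedContention_le (hadm : Admissible M (broadcast S) s adv) (y : V) (t : ℕ) :
    (law M (broadcast S) s adv t).toOuterMeasure
      {h | 4 / Real.log M.h₁ * ((t + 1) / 3 : ℕ) ≤
        failedContention M S s (Metric.ball y (M.R / 2)) h} ≤
      ENNReal.ofReal (Real.exp (-((t + 1) / 3 : ℕ))) := by
  set B := Metric.ball y (M.R / 2) with hB
  set a := Real.log M.h₁ / 2 with ha
  have hlog : 0 < Real.log M.h₁ := Real.log_pos M.one_lt_h₁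
  have ha0 : 0 < a := by positivity
  have hh1 : 0 < M.h₁ := by linarith [M.one_lt_h₁]
  have hhalf : Real.exp (-Real.log 2) = 1 / 2 := by
    rw [Real.exp_neg, Real.exp_log (by norm_num)]; norm_num
  have key := law_total_ge_le (M := M) (A := broadcast S) (s := s) (adv := adv)
    (f := fun h x => a * (contention M (broadcast S) s h B * ind (BusyFails M S s B h x)) -
      Real.log 2 * ind (h.length % 3 = 1)) ?_ t ((t + 1) / 3 : ℕ)
  · refine le_trans (toOuterMeasure_mono_of_support fun h hh hf => ?_) key
    rw [Set.mem_ofPred_eq] at hf ⊢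
    rw [total_sub, total_const_mul, total_const_mul]
    change _ ≤ a * failedContention M S s B h - Real.log 2 * elections h
    rw [elections_eq, length_of_mem_support hh]
    have h1 := mul_le_mul_of_nonneg_left hf ha0.le
    have h2 : a * (4 / Real.log M.h₁ * (((t + 1) / 3 : ℕ) : ℝ)) = 2 * ((t + 1) / 3 : ℕ) := by
      rw [ha]; field_simp; norm_num
    have h3 : Real.log 2 ≤ 1 := by linarith [Real.log_two_lt_d9]
    have h4 : (0 : ℝ) ≤ ((t + 1) / 3 : ℕ) := Nat.cast_nonneg _
    nlinarith
  · intro t h hh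
    set c := contention M (broadcast S) s h B with hc
    by_cases hel : h.length % 3 = 1
    · by_cases hφ : M.φ₀ < c
      · have hcd := (hadm t h hh).2.busy y ((M.φ₀ + c) / 2) (by linarith)
          (by change _ < c; linarith)
        set φ := (M.φ₀ + c) / 2 with hφdef
        have hcompl := toOuterMeasure_compl_le hcd
        set E : Set (Finset V × Outcome V) := {x | ∀ w ∈ B, x.2.busy w = true} with hE
        have hF : ∀ x, ENNReal.ofReal (Real.exp (a * (c * ind (BusyFails M S s B h x)) -
            Real.log 2 * ind (h.length % 3 = 1))) ≤ ENNReal.ofReal (1 / 2) +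
              ENNReal.ofReal (1 / 2 * Real.exp (a * c)) * (if x ∈ Eᶜ then 1 else 0) := by
          intro x
          rw [ind_pos hel, mul_one, sub_eq_add_neg, Real.exp_add, hhalf]
          by_cases hx : x ∈ E
          · rw [ind_neg fun hf => hf.2.2 hx]
            simp [hx]
          · rw [ind_pos ⟨hel, hφ, hx⟩, mul_one, if_pos (show x ∈ Eᶜ from hx), mul_one, mul_comm]
            exact le_add_of_nonneg_left zero_le
        calc _ ≤ mean (roundLaw M (broadcast S) s adv h) (fun x => ENNReal.ofReal (1 / 2) +
              ENNReal.ofReal (1 / 2 * Real.exp (a * c)) * (if x ∈ Eᶜ then 1 else 0)) :=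
              mean_mono fun x _ => hF x
          _ = ENNReal.ofReal (1 / 2) + ENNReal.ofReal (1 / 2 * Real.exp (a * c)) *
              (roundLaw M (broadcast S) s adv h).toOuterMeasure Eᶜ := by
              rw [mean_add, mean_const, mean_const_mul, ← toOuterMeasure_eq_mean]
          _ ≤ ENNReal.ofReal (1 / 2) + ENNReal.ofReal (1 / 2 * Real.exp (a * c)) *
              ENNReal.ofReal (M.h₁ ^ (-φ)) := by gcongr
          _ = ENNReal.ofReal (1 / 2 + 1 / 2 * (Real.exp (a * c) * M.h₁ ^ (-φ))) := by
              rw [← ENNReal.ofReal_mul (by positivity),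
                ← ENNReal.ofReal_add (by norm_num) (by positivity)]
              congr 1; ring
          _ ≤ 1 := by
              rw [ENNReal.ofReal_le_one, Real.rpow_def_of_pos hh1, ← Real.exp_add]
              have h1 : Real.exp (a * c + Real.log M.h₁ * -φ) ≤ 1 := by
                rw [Real.exp_le_one_iff, ha, hφdef]
                have := M.one_le_φ₀
                nlinarith
              linarith
      · have hnf : ∀ x, ¬ BusyFails M S s B h x := fun x hf => hφ hf.2.1
        simp only [ind_neg (hnf _), ind_pos hel, mul_zero, mul_one, zero_sub, hhalf, mean_const]
        rw [ENNReal.ofReal_le_one]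
        norm_num
    · have hnf : ∀ x, ¬ BusyFails M S s B h x := fun x hf => hel hf.1
      simp [ind_neg (hnf _), ind_neg hel, mean_const]

end Contention

/-! ### Scales -/

/-- A bound on the average contention in election rounds. -/
def avgContention (M : Model) : ℝ := 4 + 6 * M.φ₀ + 24 / Real.log M.h₁

lemma one_le_avgContention (M : Model) : 1 ≤ avgContention M := by
  have := M.one_le_φ₀
  have : 0 ≤ 24 / Real.log M.h₁ := div_nonneg (by norm_num) (Real.log_pos M.one_lt_h₁).le
  unfold avgContention
  linarith

/-- The interference that a node at distance `d` causes. -/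
def signal (M : Model) (d : ℝ) : ℝ := M.P / d ^ M.ζ

lemma ζ_pos (M : Model) : 0 < M.ζ := by linarith [M.one_le_lam, M.lam_lt_ζ]

lemma signal_nonneg (M : Model) {d : ℝ} (hd : 0 ≤ d) : 0 ≤ signal M d :=
  div_nonneg M.P_pos.le (Real.rpow_nonneg hd _)

lemma signal_le_of_half_le (M : Model) {d d' : ℝ} (hd : 0 < d) (h : d / 2 ≤ d') :
    signal M d' ≤ 2 ^ M.ζ * signal M d := by
  have hP := M.P_pos
  have hζ := ζ_pos M
  unfold signal
  have h1 : (d / 2) ^ M.ζ ≤ d' ^ M.ζ := Real.rpow_le_rpow (by positivity) h hζ.le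
  rw [Real.div_rpow hd.le (by norm_num)] at h1
  calc M.P / d' ^ M.ζ ≤ M.P / (d ^ M.ζ / 2 ^ M.ζ) :=
        div_le_div_of_nonneg_left hP.le (by positivity) h1
    _ = _ := by field_simp

/-- The network satisfies the bounded independence property of the model. -/
def Bounded (M : Model) (V : Type) [MetricSpace V] : Prop :=
  BoundedIndependence V (M.ε * M.R / 8) M.lam M.Cind

/-- The constants of the analysis. Within distance `ℓ` of a node, contention is observed; nodes
beyond cause little interference. -/
structure Scale (M : Model) where
  ℓ : ℝ
  K : ℝ
  N : ℝ
  ξ : ℝ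
  η : ℝ
  near_le : 4 * (M.ε / 4 * M.R) ≤ ℓ
  vicinity_le : M.ρ * M.R ≤ ℓ
  clear_le : M.ρc * M.R ≤ ℓ
  ξ_pos : 0 < ξ
  -- The 2 pays for Markov's inequality, and 2^ζ for measuring interference at the sender instead of
  -- the centre of the region, which at most halves the distances.
  ξ_le_clear : ξ * (2 * 2 ^ M.ζ) ≤ M.Ic
  ξ_le_ack : ξ * (2 * 2 ^ M.ζ) ≤ M.Iack
  ξ_le_idle : ξ ≤ M.Icd / 50
  η_pos : 0 < η
  η_le_half : η ≤ 1 / 2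
  η_le_idle : η * signal M (M.ρ * M.R) ≤ M.Icd / 50
  le_idle : 0.96 ≤ M.h₂ ^ (-η)
  N_nonneg : 0 ≤ N
  card_le : ∀ (V : Type) [MetricSpace V], Bounded M V → ∀ (x : V) (Z : Finset V),
    Separated (M.ε / 4 * M.R) Z → (∀ z ∈ Z, dist z x ≤ 2 * ℓ + M.ε / 4 * M.R) → (Z.card : ℝ) ≤ N
  tail_le : ∀ (V : Type) [MetricSpace V], Bounded M V → ∀ (x : V) (Z : Finset V),
    Separated (M.ε / 4 * M.R) Z →
      ∑ z ∈ Z with ℓ / 2 ≤ dist z x, 2 ^ M.ζ * signal M (dist z x) ≤ ξ / (50 * avgContention M)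
  K_pos : 0 < K
  le_K : 50 * N * avgContention M ≤ K

/-- The constants are chosen without circularity: ξ and η from the model, then ℓ from the tail bound
for ξ, then N from ℓ, and K from N. -/
lemma exists_scale (M : Model) : Nonempty (Scale M) := by
  have hζ := ζ_pos M
  have hP := M.P_pos
  have hR := M.R_pos
  have hε := M.ε_pos
  have hρ := M.one_lt_ρ
  have hK₁ := one_le_avgContention M
  have hsig : 0 < signal M (M.ρ * M.R) := by unfold signal; positivity
  have h2ζ : (0 : ℝ) < 2 * 2 ^ M.ζ := by positivity
  obtain ⟨ξ, hξ0, hξ1⟩ : ∃ ξ : ℝ, 0 < ξ ∧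
      ξ ≤ min (min (M.Ic / (2 * 2 ^ M.ζ)) (M.Iack / (2 * 2 ^ M.ζ))) (M.Icd / 50) :=
    ⟨_, lt_min (lt_min (div_pos M.Ic_pos h2ζ) (div_pos M.Iack_pos h2ζ))
      (div_pos M.Icd_pos (by norm_num)), le_rfl⟩
  obtain ⟨hξ1, hξ4⟩ := le_min_iff.1 hξ1
  obtain ⟨hξ2, hξ3⟩ := le_min_iff.1 hξ1
  obtain ⟨η, hη0, hη1, hη2, hη3⟩ : ∃ η : ℝ, 0 < η ∧ η ≤ 1 / 2 ∧
      η * signal M (M.ρ * M.R) ≤ M.Icd / 50 ∧ 0.96 ≤ M.h₂ ^ (-η) := by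
    have hlog : 0 < Real.log M.h₂ := Real.log_pos M.one_lt_h₂
    refine ⟨min (min (1 / 2) (M.Icd / 50 / signal M (M.ρ * M.R))) (0.04 / Real.log M.h₂),
      lt_min (lt_min (by norm_num) (div_pos (div_pos M.Icd_pos (by norm_num)) hsig))
        (by positivity), (min_le_left _ _).trans (min_le_left _ _), ?_, ?_⟩
    · rw [← le_div_iff₀ hsig]
      exact (min_le_left _ _).trans (min_le_right _ _)
    · set η := min (min (1 / 2) (M.Icd / 50 / signal M (M.ρ * M.R))) (0.04 / Real.log M.h₂)
      have h1 : η * Real.log M.h₂ ≤ 0.04 := by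
        rw [← le_div_iff₀ hlog]
        exact min_le_right _ _
      rw [Real.rpow_def_of_pos (by linarith [M.one_lt_h₂])]
      have h2 := Real.add_one_le_exp (Real.log M.h₂ * -η)
      nlinarith
  have h2r : 2 * (M.ε * M.R / 8) = M.ε / 4 * M.R := by ring
  obtain ⟨L, hL⟩ := exists_tail_le (r := M.ε * M.R / 8) (lam := M.lam) (C := M.Cind) (ζ := M.ζ)
    (by positivity) M.Cind_pos.le (by linarith [M.one_le_lam]) M.lam_lt_ζ
    (δ := ξ / (50 * avgContention M) / (2 ^ M.ζ * M.P)) (by positivity)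
  obtain ⟨ℓ, hℓ1, hℓ2, hℓ3, hℓ4⟩ : ∃ ℓ : ℝ, 4 * (M.ε / 4 * M.R) ≤ ℓ ∧ M.ρ * M.R ≤ ℓ ∧
      M.ρc * M.R ≤ ℓ ∧ 2 * L ≤ ℓ :=
    ⟨max (max (4 * (M.ε / 4 * M.R)) (M.ρ * M.R)) (max (M.ρc * M.R) (2 * L)), by simp, by simp,
      by simp, by simp⟩
  have hℓ0 : 0 < ℓ := lt_of_lt_of_le (by positivity) hℓ1
  set q : ℝ := (2 * ℓ + M.ε / 4 * M.R) / (M.ε * M.R / 8) with hq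
  have hq0 : 0 ≤ q := by positivity
  have hN0 : 0 ≤ M.Cind * (q + 1) ^ M.lam := by have := M.Cind_pos; positivity
  refine ⟨⟨ℓ, 50 * (M.Cind * (q + 1) ^ M.lam) * avgContention M + 1, M.Cind * (q + 1) ^ M.lam, ξ,
    η, hℓ1, hℓ2, hℓ3, hξ0, (le_div_iff₀ h2ζ).1 hξ2, (le_div_iff₀ h2ζ).1 hξ3, hξ4, hη0, hη1,
    hη2, hη3, hN0, ?_, ?_, by positivity, by linarith⟩⟩
  · intro V _ hb x Z hZ hx
    refine Separated.card_le hb hq0 (by rwa [h2r]) (x := x) fun z hz => ?_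
    rw [hq, div_mul_cancel₀ _ (by positivity)]
    exact hx z hz
  · intro V _ hb x Z hZ
    have h1 := hL V hb Z (by rwa [h2r]) x (ℓ / 2) (by linarith)
    rw [le_div_iff₀ (by positivity)] at h1
    refine le_trans (le_of_eq ?_) h1
    rw [Finset.sum_mul]
    refine Finset.sum_congr rfl fun z _ => ?_
    unfold signal
    rw [Real.rpow_neg dist_nonneg]
    ring

/-! ### Success probabilities in a moderate environment -/

section Moderate

variable {V : Type} [Fintype V] [MetricSpace V] {M : Model} (c : Scale M)

lemma Scale.ℓ_pos : 0 < c.ℓ := by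
  have := near_pos M
  linarith [c.near_le]

lemma Scale.N_le_K : c.N ≤ c.K := by
  have := one_le_avgContention M
  have := c.N_nonneg
  nlinarith [c.le_K]

lemma Scale.tail_le' (hV : Bounded M V) (x : V) (Z : Finset V)
    (hZ : Separated (M.ε / 4 * M.R) Z) :
    ∑ z ∈ Z with ¬ dist z x < c.ℓ, signal M (dist z x) ≤ c.ξ := by
  have h1 := c.tail_le V hV x Z hZ
  have hK := one_le_avgContention M
  have hℓ := c.ℓ_pos
  have h2 : c.ξ / (50 * avgContention M) ≤ c.ξ := div_le_self c.ξ_pos.le (by linarith)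
  refine le_trans ?_ (h1.trans h2)
  have h3 : (1 : ℝ) ≤ 2 ^ M.ζ := Real.one_le_rpow (by norm_num) (ζ_pos M).le
  calc ∑ z ∈ Z with ¬ dist z x < c.ℓ, signal M (dist z x)
      ≤ ∑ z ∈ Z with ¬ dist z x < c.ℓ, 2 ^ M.ζ * signal M (dist z x) :=
        Finset.sum_le_sum fun z _ => le_mul_of_one_le_left (signal_nonneg M dist_nonneg) h3
    _ ≤ _ := by
        refine Finset.sum_le_sum_of_subset_of_nonneg (fun z hz => ?_)
          fun z _ _ => mul_nonneg (by positivity) (signal_nonneg M dist_nonneg)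
        rw [Finset.mem_filter] at hz ⊢
        exact ⟨hz.1, by linarith [hz.2]⟩

/-- Around `x`, the transmission probabilities are small in total, and little interference has to be
expected from far away. -/
def Moderate (p : V → ℝ≥0) (x : V) : Prop :=
  ∑ v with dist v x < 2 * c.ℓ, (p v : ℝ) ≤ c.K ∧
    ∑ v with ¬ dist v x < c.ℓ, p v * signal M (dist v x) ≤ c.ξ

/-- It suffices that `p` is dominated by separated sets when tested against nonnegative weights. The
two weights that matter are the indicator of a ball and the signal from outside it. -/
lemma moderate_of_le {p : V → ℝ≥0} (hV : Bounded M V)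
    (hp : ∀ (g : V → ℝ) (G : ℝ), (∀ v, 0 ≤ g v) →
      (∀ Z : Finset V, Separated (M.ε / 4 * M.R) Z → ∑ z ∈ Z, g z ≤ G) → ∑ v, p v * g v ≤ G)
    (x : V) : Moderate c p x := by
  constructor
  · refine le_trans ?_ c.N_le_K
    have := hp (fun v => if dist v x < 2 * c.ℓ then 1 else 0) c.N
      (fun v => by split_ifs <;> norm_num) fun Z hZ => by
        rw [← Finset.sum_filter, Finset.sum_const, nsmul_eq_mul, mul_one]
        refine c.card_le V hV x _ (hZ.subset (Finset.filter_subset _ _)) fun z hz => ?_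
        have := near_pos M
        linarith [(Finset.mem_filter.1 hz).2]
    simpa only [mul_ite, mul_one, mul_zero, ← Finset.sum_filter] using this
  · have := hp (fun v => if ¬ dist v x < c.ℓ then signal M (dist v x) else 0) c.ξ
      (fun v => by
        split_ifs
        · exact le_rfl
        · exact signal_nonneg M dist_nonneg) fun Z hZ => by
        rw [← Finset.sum_filter]
        exact c.tail_le' hV x Z hZ
    simpa only [mul_ite, mul_zero, ← Finset.sum_filter] using this

open Classical in
/-- An isolated transmission in an environment with little interference succeeds. -/
lemma clear_of_isolated {A : Algorithm} {s : V} {h : History V} {y : Finset V × Outcome V}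
    (hy : RoundOK M A s h y) {x u : V} (hu : dist u x < c.ℓ) (huS : u ∈ y.1)
    (hiso : ∀ w ∈ y.1, dist w x < 2 * c.ℓ → w = u)
    (hext : ∑ w ∈ Finset.univ.filter (fun w => ¬ dist w x < 2 * c.ℓ) with w ∈ y.1,
      signal M (dist w x) < 2 * c.ξ) : MassDelivers M y.2 u ∧ Wins M y u := by
  have hℓ := c.ℓ_pos
  -- As `u` is within ℓ of `x` and `w` beyond 2ℓ, moving from `x` to `u` loses at most half of the
  -- distance to `w`.
  have hfar : ∀ w ∈ y.1, w ≠ u → 2 * c.ℓ ≤ dist w x ∧ dist w x / 2 ≤ dist w u ∧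
      c.ℓ < dist w u := by
    intro w hw hwu
    have h1 : 2 * c.ℓ ≤ dist w x := by
      by_contra hcon
      exact hwu (hiso w hw (not_le.1 hcon))
    have h2 := dist_triangle w u x
    exact ⟨h1, by linarith, by linarith⟩
  have hint : interference M y.1 u ≤ c.ξ * (2 * 2 ^ M.ζ) := by
    unfold interference
    calc ∑ w ∈ y.1.erase u, M.P / dist w u ^ M.ζ
        ≤ ∑ w ∈ y.1.erase u, 2 ^ M.ζ * signal M (dist w x) := by
          refine Finset.sum_le_sum fun w hw => ?_
          obtain ⟨hwu, hw⟩ := Finset.mem_erase.1 hw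
          obtain ⟨h1, h2, -⟩ := hfar w hw hwu
          exact signal_le_of_half_le M (by linarith) h2
      _ ≤ 2 ^ M.ζ * ∑ w ∈ Finset.univ.filter (fun w => ¬ dist w x < 2 * c.ℓ) with w ∈ y.1,
          signal M (dist w x) := by
          rw [← Finset.mul_sum]
          refine mul_le_mul_of_nonneg_left (Finset.sum_le_sum_of_subset_of_nonneg
            (fun w hw => ?_) fun w _ _ => signal_nonneg M dist_nonneg) (by positivity)
          obtain ⟨hwu, hw⟩ := Finset.mem_erase.1 hw
          simp only [Finset.mem_filter, Finset.mem_univ, true_and]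
          exact ⟨not_lt.2 (hfar w hw hwu).1, hw⟩
      _ ≤ 2 ^ M.ζ * (2 * c.ξ) := by gcongr
      _ = _ := by ring
  have hmass : MassDelivers M y.2 u := by
    refine hy.legal.succClear u huS (fun w hw hwu hball => ?_) (hint.trans c.ξ_le_clear)
    rw [Metric.mem_ball] at hball
    linarith [(hfar w hw hwu).2.2, c.clear_le]
  refine ⟨hmass, huS, hy.legal.ack_of_massDelivers u huS hmass (hint.trans c.ξ_le_ack), ?_⟩
  rintro ⟨w, hw, hwu⟩
  obtain ⟨hwS, hne⟩ := hy.legal.received_sent w u hw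
  have := near_pos M
  linarith [(hfar w hwS hne).2.2, c.near_le]

/-- The rate at which transmissions succeed. -/
def Scale.rate : ℝ := Real.exp (-(2 * c.K)) / 2

lemma Scale.rate_pos : 0 < c.rate := by unfold Scale.rate; positivity

lemma Scale.rate_le_one : c.rate ≤ 1 := by
  unfold Scale.rate
  have : Real.exp (-(2 * c.K)) ≤ 1 := Real.exp_le_one_iff.2 (by linarith [c.K_pos])
  linarith

/-- Combines `independentSet_isolated` for the ball of radius 2ℓ and its complement with
`clear_of_isolated`. It serves all three kinds of rounds, with different sets `U`. -/
lemma le_roundLaw_clear {A : Algorithm} {s : V} {adv : Adversary V} (hadm : Admissible M A s adv)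
    {t : ℕ} {h : History V} (hh : h ∈ (law M A s adv t).support)
    (hhalf : ∀ v, transmitProb M A s h v ≤ 1 / 2) {x : V}
    (hmod : Moderate c (transmitProb M A s h) x) {U : Finset V} (hU : ∀ u ∈ U, dist u x < c.ℓ) :
    ENNReal.ofReal (c.rate * ∑ u ∈ U, (transmitProb M A s h u : ℝ)) ≤
      (roundLaw M A s adv h).toOuterMeasure
        {y | ∃ u ∈ U, MassDelivers M y.2 u ∧ Wins M y u} := by
  classical
  have hℓ := c.ℓ_pos
  -- `Moderate` bounds the expected signal from beyond ℓ by ξ, hence also that from beyond 2ℓ; θ =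
  -- 2ξ is the level required by Markov's inequality.
  have h1 := independentSet_isolated (p := transmitProb M A s h) (hp := fun _ => A.prob_le_one _)
    (B := Finset.univ.filter fun w => dist w x < 2 * c.ℓ)
    (W := Finset.univ.filter fun w => ¬ dist w x < 2 * c.ℓ) (U := U)
    (Finset.disjoint_filter_filter_not _ _ _)
    (fun u hu => Finset.mem_filter.2 ⟨Finset.mem_univ u, by linarith [hU u hu]⟩)
    (g := fun w : V => signal M (dist w x)) (fun w => signal_nonneg M dist_nonneg) hhalf
    (K := c.K) (θ := 2 * c.ξ) (by linarith [c.ξ_pos]) hmod.1 (by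
      have h2 := hmod.2
      rw [mul_div_cancel_left₀ _ (two_ne_zero)]
      refine le_trans (Finset.sum_le_sum_of_subset_of_nonneg (fun w hw => ?_)
        fun w _ _ => mul_nonneg (NNReal.coe_nonneg _) (signal_nonneg M dist_nonneg)) h2
      rw [Finset.mem_filter] at hw ⊢
      exact ⟨hw.1, fun h => hw.2 (by linarith)⟩)
  rw [← roundLaw_fst (adv := adv)] at h1
  refine h1.trans (toOuterMeasure_mono_of_support fun y hy hyE => ?_)
  obtain ⟨u, huU, huS, hiso, hext⟩ := hyE
  refine ⟨u, huU, clear_of_isolated c (roundOK_of_mem_support hadm hh hy) (hU u huU) huS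
    (fun w hw hwx => hiso w hw (Finset.mem_filter.2 ⟨Finset.mem_univ _, hwx⟩)) ?_⟩
  convert hext using 2

end Moderate

/-! ### Every node is often close to a winner -/

section Elections

variable {V : Type} [Fintype V] [MetricSpace V] {M : Model} (c : Scale M) {S : ℕ} {s : V}

lemma near_le_vicinity (M : Model) : M.ε / 4 * M.R ≤ M.R / 2 := by
  have := M.ε_lt_one
  have := M.R_pos
  nlinarith

open Classical in
lemma sum_ball_near_le (h : History V) (y : V) :
    ∑ w with w ∈ Metric.ball y (M.ε / 4 * M.R), (transmitProb M (broadcast S) s h w : ℝ) ≤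
      contention M (broadcast S) s h (Metric.ball y (M.R / 2)) := by
  refine Finset.sum_le_sum_of_subset_of_nonneg (fun w hw => ?_) fun w _ _ => NNReal.coe_nonneg _
  rw [Finset.mem_filter] at hw ⊢
  exact ⟨hw.1, Metric.ball_subset_ball (near_le_vicinity M) hw.2⟩

/-- Markov's inequality over time. A net transfers the bound on the accumulated contention of small
balls to both quantities in `Moderate`; each total is at most its threshold times a/50, so each
threshold is exceeded at most a/50 times. -/
lemma few_immoderate (hV : Bounded M V) {t₀ : ℕ} {h : History V} {a : ℝ} (ha : 0 ≤ a)
    (hlate : ∀ y, lateContention M S s t₀ (Metric.ball y (M.R / 2)) h ≤ avgContention M * a)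
    (x : V) :
    total (fun h _ => ind (h.length % 3 = 1 ∧ t₀ ≤ h.length ∧
      ¬ Moderate c (transmitProb M (broadcast S) s h) x)) h ≤ a / 25 := by
  classical
  obtain ⟨Y, hYsep, hYnet⟩ := exists_net (V := V) (M.ε / 4 * M.R) (near_pos M)
  have hK1 := one_le_avgContention M
  have hnear := near_pos M
  have hℓ := c.ℓ_pos
  set late : History V → Prop := fun h => h.length % 3 = 1 ∧ t₀ ≤ h.length with hlatedef
  set F₁ : History V → ℝ := fun h =>
    ∑ v with dist v x < 2 * c.ℓ, (transmitProb M (broadcast S) s h v : ℝ) with hF₁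
  set F₂ : History V → ℝ := fun h => ∑ v with ¬ dist v x < c.ℓ,
    transmitProb M (broadcast S) s h v * signal M (dist v x) with hF₂
  set Y₁ := Y.filter fun y => dist y x ≤ 2 * c.ℓ + M.ε / 4 * M.R with hY₁
  set Y₂ := Y.filter fun y => c.ℓ / 2 ≤ dist y x with hY₂
  have h1 : ∀ h, F₁ h ≤ ∑ y ∈ Y₁, contention M (broadcast S) s h (Metric.ball y (M.R / 2)) := by
    intro h
    have := sum_mul_le_net hYnet (p := fun w => (transmitProb M (broadcast S) s h w : ℝ))
      (g := fun _ => 1) (G := fun y => if dist y x ≤ 2 * c.ℓ + M.ε / 4 * M.R then 1 else 0)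
      (fun w => NNReal.coe_nonneg _) (fun y => by split_ifs <;> norm_num)
      (Finset.univ.filter fun v => dist v x < 2 * c.ℓ) (fun w hw y _ hwy => by
        have h2 := dist_triangle y w x
        rw [dist_comm y w] at h2
        rw [if_pos (by linarith [(Finset.mem_filter.1 hw).2])])
    simp only [mul_one, ite_mul, one_mul, zero_mul, ← Finset.sum_filter] at this
    exact this.trans (Finset.sum_le_sum fun y _ => sum_ball_near_le h y)
  have h2 : ∀ h, F₂ h ≤ ∑ y ∈ Y₂, 2 ^ M.ζ * signal M (dist y x) *
      contention M (broadcast S) s h (Metric.ball y (M.R / 2)) := by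
    intro h
    have hGnn : ∀ y : V, 0 ≤ 2 ^ M.ζ * signal M (dist y x) := fun y =>
      mul_nonneg (by positivity) (signal_nonneg M dist_nonneg)
    have := sum_mul_le_net hYnet (p := fun w => (transmitProb M (broadcast S) s h w : ℝ))
      (g := fun w => signal M (dist w x))
      (G := fun y => if c.ℓ / 2 ≤ dist y x then 2 ^ M.ζ * signal M (dist y x) else 0)
      (fun w => NNReal.coe_nonneg _) (fun y => by
        split_ifs
        · exact hGnn y
        · exact le_rfl)
      (Finset.univ.filter fun v => ¬ dist v x < c.ℓ) (fun w hw y _ hwy => by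
        have h3 := dist_triangle w y x
        have h4 := dist_triangle y w x
        rw [dist_comm y w] at h4
        have h5 := (Finset.mem_filter.1 hw).2
        have h6 := c.near_le
        rw [if_pos (by linarith)]
        exact signal_le_of_half_le M (by linarith) (by linarith))
    simp only [ite_mul, zero_mul, ← Finset.sum_filter] at this
    exact this.trans (Finset.sum_le_sum fun y _ =>
      mul_le_mul_of_nonneg_left (sum_ball_near_le h y) (hGnn y))
  have h3 : c.K * total (fun h _ => ind (late h ∧ c.K < F₁ h)) h ≤ c.K * (a / 50) := by
    calc c.K * total (fun h _ => ind (late h ∧ c.K < F₁ h)) h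
        = total (fun h _ => c.K * ind (late h ∧ c.K < F₁ h)) h := (total_const_mul _ _ _).symm
      _ ≤ total (fun h _ => ∑ y ∈ Y₁, ind (late h) *
            contention M (broadcast S) s h (Metric.ball y (M.R / 2))) h := by
          refine total_mono (fun h _ => ?_) h
          rw [← Finset.mul_sum]
          by_cases hl : late h
          · rw [ind_pos hl, one_mul]
            refine le_trans ?_ (h1 h)
            by_cases hF : c.K < F₁ h
            · rw [ind_pos ⟨hl, hF⟩, mul_one]; exact hF.le
            · rw [ind_neg (by tauto), mul_zero]
              exact Finset.sum_nonneg fun _ _ => NNReal.coe_nonneg _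
          · rw [ind_neg (by tauto), ind_neg hl, mul_zero, zero_mul]
      _ = ∑ y ∈ Y₁, lateContention M S s t₀ (Metric.ball y (M.R / 2)) h := total_sum _ _ _
      _ ≤ ∑ _y ∈ Y₁, avgContention M * a := Finset.sum_le_sum fun y _ => hlate y
      _ = Y₁.card * (avgContention M * a) := by rw [Finset.sum_const, nsmul_eq_mul]
      _ ≤ c.N * (avgContention M * a) := by
          gcongr
          exact c.card_le V hV x Y₁ (hYsep.subset (Finset.filter_subset _ _)) fun z hz =>
            (Finset.mem_filter.1 hz).2
      _ ≤ c.K * (a / 50) := by nlinarith [c.le_K]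
  have h4 : c.ξ * total (fun h _ => ind (late h ∧ c.ξ < F₂ h)) h ≤ c.ξ * (a / 50) := by
    calc c.ξ * total (fun h _ => ind (late h ∧ c.ξ < F₂ h)) h
        = total (fun h _ => c.ξ * ind (late h ∧ c.ξ < F₂ h)) h := (total_const_mul _ _ _).symm
      _ ≤ total (fun h _ => ∑ y ∈ Y₂, 2 ^ M.ζ * signal M (dist y x) * (ind (late h) *
            contention M (broadcast S) s h (Metric.ball y (M.R / 2)))) h := by
          refine total_mono (fun h _ => ?_) h
          by_cases hl : late h
          · simp only [ind_pos hl, one_mul]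
            refine le_trans ?_ (h2 h)
            by_cases hF : c.ξ < F₂ h
            · rw [ind_pos ⟨hl, hF⟩, mul_one]; exact hF.le
            · rw [ind_neg (by tauto), mul_zero]
              exact Finset.sum_nonneg fun _ _ =>
                mul_nonneg (NNReal.coe_nonneg _) (signal_nonneg M dist_nonneg)
          · rw [ind_neg (by tauto), mul_zero]
            simp [ind_neg hl]
      _ = ∑ y ∈ Y₂, 2 ^ M.ζ * signal M (dist y x) *
            lateContention M S s t₀ (Metric.ball y (M.R / 2)) h := by
          rw [total_sum]
          exact Finset.sum_congr rfl fun y _ => total_const_mul _ _ _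
      _ ≤ ∑ y ∈ Y₂, 2 ^ M.ζ * signal M (dist y x) * (avgContention M * a) :=
          Finset.sum_le_sum fun y _ => mul_le_mul_of_nonneg_left (hlate y)
            (mul_nonneg (by positivity) (signal_nonneg M dist_nonneg))
      _ ≤ c.ξ / (50 * avgContention M) * (avgContention M * a) := by
          rw [← Finset.sum_mul]
          gcongr
          exact c.tail_le V hV x Y hYsep
      _ = c.ξ * (a / 50) := by field_simp
  have h5 := le_of_mul_le_mul_left h3 c.K_pos
  have h6 := le_of_mul_le_mul_left h4 c.ξ_pos
  have h7 : total (fun h _ => ind (h.length % 3 = 1 ∧ t₀ ≤ h.length ∧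
      ¬ Moderate c (transmitProb M (broadcast S) s h) x)) h ≤
      total (fun h _ => ind (late h ∧ c.K < F₁ h) + ind (late h ∧ c.ξ < F₂ h)) h := by
    refine total_mono (fun h _ => ?_) h
    by_cases hbad : h.length % 3 = 1 ∧ t₀ ≤ h.length ∧
      ¬ Moderate c (transmitProb M (broadcast S) s h) x
    · rw [ind_pos hbad]
      obtain ⟨hb1, hb2, hb3⟩ := hbad
      rw [Moderate, not_and_or, not_le, not_le] at hb3
      rcases hb3 with hb3 | hb3
      · rw [ind_pos ⟨⟨hb1, hb2⟩, hb3⟩]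
        linarith [ind_nonneg (late h ∧ c.ξ < F₂ h)]
      · rw [ind_pos (p := late h ∧ c.ξ < F₂ h) ⟨⟨hb1, hb2⟩, hb3⟩]
        linarith [ind_nonneg (late h ∧ c.K < F₁ h)]
    · rw [ind_neg hbad]
      exact add_nonneg (ind_nonneg _) (ind_nonneg _)
  rw [total_add] at h7
  linarith

/-- The contention within distance `ℓ` of `x`. -/
def localContention (c : Scale M) (S : ℕ) (s : V) (h : History V) (x : V) : ℝ :=
  ∑ v with dist v x < c.ℓ, (transmitProb M (broadcast S) s h v : ℝ)

variable {adv : Adversary V}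

/-- Nodes between ρR and ℓ contribute at most η times the signal at ρR, nodes beyond ℓ at most ξ:
together Icd/25 in expectation. By Markov the outside interference is low with probability 0.96, and
0.96² ≥ 0.9. -/
lemma le_roundLaw_idle (hadm : Admissible M (broadcast S) s adv) {t : ℕ} {h : History V}
    (hh : h ∈ (law M (broadcast S) s adv t).support) {x : V}
    (hmod : Moderate c (transmitProb M (broadcast S) s h) x)
    (hlow : localContention c S s h x < c.η) :
    ENNReal.ofReal 0.9 ≤
      (roundLaw M (broadcast S) s adv h).toOuterMeasure {y | y.2.busy x = false} := by
  classical
  set p := transmitProb M (broadcast S) s h with hp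
  have hρR : 0 < M.ρ * M.R := mul_pos (by linarith [M.one_lt_ρ]) M.R_pos
  have hcont : contention M (broadcast S) s h (Metric.ball x (M.ρ * M.R)) ≤ c.η := by
    refine le_trans ?_ hlow.le
    refine Finset.sum_le_sum_of_subset_of_nonneg (fun w hw => ?_) fun w _ _ => NNReal.coe_nonneg _
    rw [Finset.mem_filter, Metric.mem_ball] at hw
    exact Finset.mem_filter.2 ⟨hw.1, hw.2.trans_le c.vicinity_le⟩
  have hidle := (hadm t h hh).2.idle x c.η c.η_pos hcont
  set E : Set (Finset V × Outcome V) := {y | outsideInterference M y.1 x < M.Icd} with hE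
  have hW : ∑ w with w ∉ Metric.ball x (M.ρ * M.R), p w * signal M (dist w x) ≤
      M.Icd / 25 := by
    have h1 : ∀ w, (if w ∉ Metric.ball x (M.ρ * M.R) then p w * signal M (dist w x) else 0) ≤
        (if dist w x < c.ℓ then p w * signal M (M.ρ * M.R) else 0) +
        (if ¬ dist w x < c.ℓ then p w * signal M (dist w x) else 0) := by
      intro w
      have hpw : (0 : ℝ) ≤ p w := NNReal.coe_nonneg _
      have hs1 : 0 ≤ signal M (M.ρ * M.R) := signal_nonneg M hρR.le
      have hs2 : 0 ≤ signal M (dist w x) := signal_nonneg M dist_nonneg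
      by_cases hw : dist w x < c.ℓ
      · rw [if_pos hw, if_neg (not_not.2 hw), add_zero]
        split_ifs with hwb
        · exact mul_nonneg hpw hs1
        · refine mul_le_mul_of_nonneg_left ?_ hpw
          rw [Metric.mem_ball, not_lt] at hwb
          unfold signal
          exact div_le_div_of_nonneg_left M.P_pos.le (Real.rpow_pos_of_pos hρR _)
            (Real.rpow_le_rpow hρR.le hwb (ζ_pos M).le)
      · rw [if_neg hw, if_pos hw, zero_add]
        split_ifs
        · exact mul_nonneg hpw hs2
        · exact le_rfl
    have h2 := Finset.sum_le_sum fun w (_ : w ∈ Finset.univ) => h1 w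
    rw [Finset.sum_add_distrib, ← Finset.sum_filter, ← Finset.sum_filter, ← Finset.sum_filter,
      ← Finset.sum_mul] at h2
    have h3 : (∑ w with dist w x < c.ℓ, (p w : ℝ)) * signal M (M.ρ * M.R) ≤
        c.η * signal M (M.ρ * M.R) :=
      mul_le_mul_of_nonneg_right hlow.le (signal_nonneg M hρR.le)
    linarith [c.η_le_idle, c.ξ_le_idle, hmod.2]
  have hEc : (roundLaw M (broadcast S) s adv h).toOuterMeasure Eᶜ ≤ ENNReal.ofReal 0.04 := by
    have h1 := independentSet_sum_ge_le (p := transmitProb M (broadcast S) s h)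
      (hp := fun _ => (broadcast S).prob_le_one _)
      (Finset.univ.filter fun w => w ∉ Metric.ball x (M.ρ * M.R))
      (g := fun w => signal M (dist w x)) (fun w => signal_nonneg M dist_nonneg) M.Icd_pos
    rw [← roundLaw_fst (adv := adv)] at h1
    refine (toOuterMeasure_mono_of_support fun y _ hy => ?_).trans
      (h1.trans (ENNReal.ofReal_le_ofReal ?_))
    · have hy' : M.Icd ≤ outsideInterference M y.1 x := not_lt.1 hy
      refine hy'.trans (le_of_eq ?_)
      unfold outsideInterference signal
      refine Finset.sum_congr ?_ fun _ _ => rfl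
      ext w
      simp [and_comm]
    · rw [div_le_iff₀ M.Icd_pos]
      linarith
  have hE1 := le_toOuterMeasure_of_compl_le hEc (by norm_num)
  calc ENNReal.ofReal 0.9 ≤ ENNReal.ofReal (0.96 * (1 - 0.04)) :=
        ENNReal.ofReal_le_ofReal (by norm_num)
    _ = ENNReal.ofReal 0.96 * ENNReal.ofReal (1 - 0.04) := ENNReal.ofReal_mul (by norm_num)
    _ ≤ ENNReal.ofReal (M.h₂ ^ (-c.η)) * (roundLaw M (broadcast S) s adv h).toOuterMeasure E := by
        gcongr
        exact c.le_idle
    _ ≤ _ := hidle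
    _ ≤ _ := toOuterMeasure_mono_of_support fun y _ hy => hy.2

/-- Some winner of the current election round is within distance `ℓ` of `x`. -/
def LocalWin (c : Scale M) (x : V) (y : Finset V × Outcome V) : Prop :=
  ∃ u, dist u x < c.ℓ ∧ Wins M y u

lemma le_roundLaw_localWin (hadm : Admissible M (broadcast S) s adv) {t : ℕ} {h : History V}
    (hh : h ∈ (law M (broadcast S) s adv t).support) (hel : h.length % 3 = 1) {x : V}
    (hmod : Moderate c (transmitProb M (broadcast S) s h) x)
    (hhigh : c.η ≤ localContention c S s h x) :
    ENNReal.ofReal (c.rate * c.η) ≤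
      (roundLaw M (broadcast S) s adv h).toOuterMeasure {y | LocalWin c x y} := by
  have h1 := le_roundLaw_clear c hadm hh (fun v => transmitProb_le_half (by omega) v) hmod
    (U := Finset.univ.filter fun u => dist u x < c.ℓ) (fun u hu => (Finset.mem_filter.1 hu).2)
  refine (ENNReal.ofReal_le_ofReal (mul_le_mul_of_nonneg_left hhigh c.rate_pos.le)).trans
    (h1.trans (toOuterMeasure_mono_of_support fun y _ hy => ?_))
  obtain ⟨u, hu, -, hw⟩ := hy
  exact ⟨u, (Finset.mem_filter.1 hu).2, hw⟩

/-- Some winner of the last election round is within distance `ℓ` of `x`. -/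
def LocalFresh (c : Scale M) (S : ℕ) (s : V) (x : V) (h : History V) : Prop :=
  ∃ u, dist u x < c.ℓ ∧ (node M S s h u).fresh = true

open Classical in
-- Only fresh nodes transmit, each with probability 1/2, and they are separated; so the round is
-- moderate without any assumption on the contention.
lemma le_roundLaw_notifies (hV : Bounded M V) (hadm : Admissible M (broadcast S) s adv) {t : ℕ}
    {h : History V} (hh : h ∈ (law M (broadcast S) s adv t).support) (hno : h.length % 3 = 2)
    {x : V} (hfr : LocalFresh c S s x h) :
    ENNReal.ofReal (c.rate / 2) ≤ (roundLaw M (broadcast S) s adv h).toOuterMeasure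
      {y | ∃ u ∈ Finset.univ.filter fun u => dist u x < c.ℓ, Notifies M S s h y u} := by
  have hval := valid_of_mem_support hadm hh
  have hp : ∀ v, (transmitProb M (broadcast S) s h v : ℝ) =
      if v ∈ freshSet M S s h then 1 / 2 else 0 := by
    intro v
    rw [transmitProb_notification hno]
    simp only [mem_freshSet]
    split_ifs <;> simp
  have hmod : Moderate c (transmitProb M (broadcast S) s h) x := by
    refine moderate_of_le c hV (fun g G hg hG => ?_) x
    have h0 : 0 ≤ G := by
      simpa using hG ∅ fun u hu => absurd hu (Finset.notMem_empty u)
    have h1 := hG _ (freshSet_separated hval)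
    simp only [hp, ite_mul, zero_mul, Finset.sum_ite_mem, Finset.univ_inter, ← Finset.mul_sum]
    linarith
  have h1 := le_roundLaw_clear c hadm hh (fun v => transmitProb_le_half (by omega) v) hmod
    (U := Finset.univ.filter fun u => dist u x < c.ℓ) (fun u hu => (Finset.mem_filter.1 hu).2)
  refine le_trans (ENNReal.ofReal_le_ofReal ?_)
    (h1.trans (toOuterMeasure_mono_of_support fun y hy hyE => ?_))
  · obtain ⟨u, hu, huf⟩ := hfr
    rw [div_eq_mul_one_div]
    refine mul_le_mul_of_nonneg_left ?_ c.rate_pos.le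
    refine le_trans (le_of_eq ?_) (Finset.single_le_sum
      (f := fun u => (transmitProb M (broadcast S) s h u : ℝ)) (fun v _ => NNReal.coe_nonneg _)
      (Finset.mem_filter.2 ⟨Finset.mem_univ u, hu⟩))
    rw [hp, if_pos (mem_freshSet.2 huf)]
  · obtain ⟨u, hu, hm, hw⟩ := hyE
    exact ⟨u, hu, hno, fresh_of_mem hno (roundOK_of_mem_support hadm hh hy) hw.1, hm⟩

/-- A win turns the next round into a notification round with a fresh node nearby. The last term
covers a win whose notification round has not taken place yet. -/
lemma localWins_le (x : V) (P : History V → Prop) (h : History V) :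
    total (fun h y => ind ((h.length % 3 = 1 ∧ P h) ∧ LocalWin c x y)) h ≤
      total (fun h _ => ind (h.length % 3 = 2 ∧ LocalFresh c S s x h)) h +
        ind (h.length % 3 = 2 ∧ LocalFresh c S s x h) := by
  induction h with
  | nil => simpa using ind_nonneg _
  | cons y h ih =>
    rw [total_cons, total_cons]
    by_cases hh : h.length % 3 = 1
    · rw [ind_neg (p := h.length % 3 = 2 ∧ _) (by omega)] at ih ⊢
      have : ind ((h.length % 3 = 1 ∧ P h) ∧ LocalWin c x y) ≤
          ind ((y :: h).length % 3 = 2 ∧ LocalFresh c S s x (y :: h)) := by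
        refine ind_mono fun hw => ⟨by rw [List.length_cons]; omega, ?_⟩
        obtain ⟨u, hu, hwin⟩ := hw.2
        exact ⟨u, hu, (fresh_election hh y u).2 hwin⟩
      linarith
    · rw [ind_neg (p := (h.length % 3 = 1 ∧ P h) ∧ _) (by tauto)]
      have := ind_nonneg ((y :: h).length % 3 = 2 ∧ LocalFresh c S s x (y :: h))
      linarith

lemma total_early_le (t₀ : ℕ) (h : History V) :
    total (fun h _ => ind (h.length % 3 = 1 ∧ h.length < t₀)) h ≤ ((t₀ + 1) / 3 : ℕ) := by
  have key : total (fun h _ => ind (h.length % 3 = 1 ∧ h.length < t₀)) h ≤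
      ((min h.length t₀ + 1) / 3 : ℕ) := by
    induction h with
    | nil => simp
    | cons y h ih =>
      rw [total_cons, List.length_cons]
      by_cases hh : h.length % 3 = 1 ∧ h.length < t₀
      · rw [ind_pos hh]
        rw [min_eq_left (by omega)] at ih ⊢
        rw [show (h.length + 1 + 1) / 3 = (h.length + 1) / 3 + 1 by omega]
        push_cast
        linarith
      · rw [ind_neg hh, add_zero]
        refine ih.trans ?_
        norm_cast
        omega
  refine key.trans ?_
  norm_cast
  omega

end Elections

/-! ### Every node is notified at a constant frequency -/

section Coverage

variable {V : Type} [Fintype V] [MetricSpace V] {M : Model} (c : Scale M) {S : ℕ} {s : V}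

/-- The rate of wins in the vicinity of a node with high local contention. -/
def Scale.winRate : ℝ := c.rate * c.η

/-- The rate of successful notifications. -/
def Scale.notifyRate : ℝ := c.rate / 2

lemma Scale.winRate_pos : 0 < c.winRate := mul_pos c.rate_pos c.η_pos

lemma Scale.notifyRate_pos : 0 < c.notifyRate := half_pos c.rate_pos

lemma Scale.winRate_le_one : c.winRate ≤ 1 :=
  mul_le_one₀ c.rate_le_one c.η_pos.le (by linarith [c.η_le_half])

lemma Scale.notifyRate_le_one : c.notifyRate ≤ 1 := by
  have := c.rate_le_one
  unfold Scale.notifyRate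
  linarith

/-- An environment in which it is likely that a node near `x` wins. -/
def Busyish (c : Scale M) (S : ℕ) (s x : V) (h : History V) : Prop :=
  Moderate c (transmitProb M (broadcast S) s h) x ∧ c.η ≤ localContention c S s h x

/-- An environment in which `x` is likely to detect an idle channel. -/
def Quiet (c : Scale M) (S : ℕ) (s x : V) (t₀ : ℕ) (h : History V) : Prop :=
  t₀ ≤ h.length ∧ Moderate c (transmitProb M (broadcast S) s h) x ∧
    localContention c S s h x < c.η

/-- A contending node of level 0 transmits with probability 1/2 ≥ η and so would violate quietness
alone. -/
lemma one_le_level_of_quiet {x : V} {t₀ : ℕ} {h : History V} (hel : h.length % 3 = 1)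
    (hp : (node M S s h x).pause = 0) (hq : Quiet c S s x t₀ h) :
    1 ≤ (node M S s h x).level := by
  by_contra hcon
  have h0 : (node M S s h x).level = 0 := by omega
  have h1 : (transmitProb M (broadcast S) s h x : ℝ) ≤ localContention c S s h x :=
    Finset.single_le_sum (f := fun v => (transmitProb M (broadcast S) s h v : ℝ))
      (fun v _ => NNReal.coe_nonneg _)
      (Finset.mem_filter.2 ⟨Finset.mem_univ x, by rw [dist_self]; exact c.ℓ_pos⟩)
  rw [coe_transmitProb_election hel, if_pos hp, h0] at h1
  have := hq.2.2
  have := c.η_le_half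
  norm_num at h1
  linarith

open Classical in
/-- A node that is rarely notified would mostly detect an idle channel, which is impossible, because
its probability cannot keep growing. -/
lemma le_hits (hV : Bounded M V) (hS1 : 1 ≤ S)
    (hS : 2000 * c.N ≤ c.winRate * c.notifyRate * S) {t₀ : ℕ} {h : History V}
    (hval : Valid M (broadcast S) s h) (ha1 : 1000 ≤ c.winRate * elections h)
    (ha2 : 2000 * c.N ≤ c.winRate * c.notifyRate * elections h)
    (ht₀ : ((t₀ + 1) / 3 : ℕ) ≤ elections h / 50)
    (hlate : ∀ y, lateContention M S s t₀ (Metric.ball y (M.R / 2)) h ≤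
      avgContention M * elections h) (x : V)
    (hX : c.winRate / 2 * total (fun h _ => ind (h.length % 3 = 1 ∧ Busyish c S s x h)) h -
      total (fun h y => ind ((h.length % 3 = 1 ∧ Busyish c S s x h) ∧ LocalWin c x y)) h <
        c.winRate * elections h / 1000)
    (hY : c.notifyRate / 2 * total (fun h _ => ind (h.length % 3 = 2 ∧ LocalFresh c S s x h)) h -
      total (fun h y => ind ((h.length % 3 = 2 ∧ LocalFresh c S s x h) ∧
        ∃ u ∈ Finset.univ.filter fun u => dist u x < c.ℓ, Notifies M S s h y u)) h <
        c.winRate * c.notifyRate * elections h / 2000)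
    (hJ : 0.8 * total (fun h _ => ind (h.length % 3 = 1 ∧ (node M S s h x).pause = 0 ∧
        Quiet c S s x t₀ h)) h -
      total (fun h y => ind ((h.length % 3 = 1 ∧ (node M S s h x).pause = 0 ∧
        Quiet c S s x t₀ h) ∧ y.2.busy x = false)) h < elections h / 100) :
    elections h / (4 * S) ≤ hits M S s x h := by
  set a := elections h with ha
  set X := total (fun h _ => ind (h.length % 3 = 1 ∧ Busyish c S s x h)) h
  set Y := total (fun h y => ind ((h.length % 3 = 1 ∧ Busyish c S s x h) ∧ LocalWin c x y)) h
  set Y₂ := total (fun h _ => ind (h.length % 3 = 2 ∧ LocalFresh c S s x h)) h with hY₂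
  set Z := total (fun h y => ind ((h.length % 3 = 2 ∧ LocalFresh c S s x h) ∧
        ∃ u ∈ Finset.univ.filter fun u => dist u x < c.ℓ, Notifies M S s h y u)) h with hZ
  set I := total (fun h _ => ind (h.length % 3 = 1 ∧ (node M S s h x).pause = 0 ∧
        Quiet c S s x t₀ h)) h with hI
  set J := total (fun h y => ind ((h.length % 3 = 1 ∧ (node M S s h x).pause = 0 ∧
        Quiet c S s x t₀ h) ∧ y.2.busy x = false)) h
  set H := hits M S s x h with hH
  have hSpos : (0 : ℝ) < S := by exact_mod_cast hS1
  have hS1' : (1 : ℝ) ≤ S := by exact_mod_cast hS1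
  have hw := c.winRate_pos
  have hn := c.notifyRate_pos
  have ha0 : 0 ≤ a := elections_nonneg h
  by_contra hcon
  rw [not_le, lt_div_iff₀ (by positivity)] at hcon
  have hYY : Y ≤ Y₂ + 1 :=
    (localWins_le c x (Busyish c S s x) h).trans (by
      have := ind_le_one (h.length % 3 = 2 ∧ LocalFresh c S s x h)
      linarith)
  have hZle : S * Z ≤ c.N * a + c.N * S := by
    have h1 := mul_notifications_le (M := M) (S := S) (s := s)
      (U := Finset.univ.filter fun u => dist u x < c.ℓ) (N := c.N) (fun Z hZU hZ =>
        c.card_le V hV x Z hZ fun z hz => by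
          have := near_pos M
          have := c.ℓ_pos
          linarith [(Finset.mem_filter.1 (hZU hz)).2]) hval
    refine le_trans ?_ h1
    refine mul_le_mul_of_nonneg_left (total_mono (fun h y => ind_mono fun hh => hh.2) h) hSpos.le
  -- Follow the chain backwards: few successful notifications (`Z`) force few rounds with fresh
  -- nodes (`Y₂`), hence few local wins (`Y`), hence few elections with substantial contention
  -- (`X`). The extra 1 in `hYY` is absorbed by `ha1`.
  have hXle : X ≤ a / 50 := by
    have h1 : c.winRate * c.notifyRate * S * Z ≤
        c.winRate * c.notifyRate * (c.N * a + c.N * S) := by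
      rw [mul_assoc]
      exact mul_le_mul_of_nonneg_left hZle (by positivity)
    have h2 : c.N ≤ c.winRate * c.notifyRate * S / 2000 := by linarith
    have h3 : c.N ≤ c.winRate * c.notifyRate * a / 2000 := by linarith
    have h4 : c.N * a + c.N * S ≤ S * (c.winRate * c.notifyRate * a / 1000) := by
      have := mul_le_mul_of_nonneg_right h2 ha0
      have := mul_le_mul_of_nonneg_right h3 hSpos.le
      linarith
    have h5 : Z ≤ c.winRate * c.notifyRate * a / 1000 :=
      le_of_mul_le_mul_left (hZle.trans h4) hSpos
    have h6 : c.notifyRate * Y₂ ≤ c.notifyRate * (c.winRate * a * 3 / 1000) := by linarith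
    have h7 := le_of_mul_le_mul_left h6 hn
    have h8 : c.winRate * X ≤ c.winRate * (a / 50) := by linarith
    exact le_of_mul_le_mul_left h8 hw
  have himm := few_immoderate (M := M) c (S := S) (s := s) hV (t₀ := t₀) ha0 hlate x
  have hearly := (total_early_le t₀ h).trans ht₀
  have hpaused := paused_add_pause_le (M := M) (S := S) (s := s) x h
  have hlevel := level_add_le (M := M) (S := S) (s := s) x (Low := Quiet c S s x t₀)
    (fun h hel hp hq => one_le_level_of_quiet c hel hp hq) h
  set cont := total (fun h _ => ind (h.length % 3 = 1 ∧ (node M S s h x).pause = 0)) h with hcont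
  set paused := total (fun h _ => ind (h.length % 3 = 1 ∧ (node M S s h x).pause ≠ 0)) h
    with hpausedef
  have hsplit : a = cont + paused := by
    rw [ha, elections, hcont, hpausedef, ← total_add]
    congr 1
    funext h _
    by_cases h1 : h.length % 3 = 1 <;> by_cases h2 : (node M S s h x).pause = 0 <;>
      simp [ind, h1, h2]
  -- A contending election is early, immoderate, has substantial contention nearby, or is quiet.
  have hcontle : cont ≤ I + (total (fun h _ => ind (h.length % 3 = 1 ∧ h.length < t₀)) h +
      (total (fun h _ => ind (h.length % 3 = 1 ∧ t₀ ≤ h.length ∧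
        ¬ Moderate c (transmitProb M (broadcast S) s h) x)) h + X)) := by
    rw [← total_add, ← total_add, ← total_add]
    refine total_mono (fun h _ => ?_) h
    have n1 := ind_nonneg (h.length % 3 = 1 ∧ (node M S s h x).pause = 0 ∧ Quiet c S s x t₀ h)
    have n2 := ind_nonneg (h.length % 3 = 1 ∧ h.length < t₀)
    have n3 := ind_nonneg (h.length % 3 = 1 ∧ t₀ ≤ h.length ∧
        ¬ Moderate c (transmitProb M (broadcast S) s h) x)
    have n4 := ind_nonneg (h.length % 3 = 1 ∧ Busyish c S s x h)
    by_cases hc : h.length % 3 = 1 ∧ (node M S s h x).pause = 0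
    · rw [ind_pos hc]
      by_cases h1 : h.length < t₀
      · rw [ind_pos (p := _ ∧ h.length < t₀) ⟨hc.1, h1⟩]; linarith
      · by_cases h2 : Moderate c (transmitProb M (broadcast S) s h) x
        · by_cases h3 : c.η ≤ localContention c S s h x
          · rw [ind_pos (p := _ ∧ Busyish c S s x h) ⟨hc.1, h2, h3⟩]; linarith
          · rw [ind_pos (p := _ ∧ _ ∧ Quiet c S s x t₀ h)
              ⟨hc.1, hc.2, not_lt.1 h1, h2, not_le.1 h3⟩]
            linarith
        · rw [ind_pos (p := _ ∧ _ ∧ ¬ Moderate c _ x) ⟨hc.1, not_lt.1 h1, h2⟩]; linarith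
    · rw [ind_neg hc]; linarith
  have hpn : (0 : ℝ) ≤ (node M S s h x).pause := Nat.cast_nonneg _
  have hln : (0 : ℝ) ≤ (node M S s h x).level := Nat.cast_nonneg _
  have hHn : 0 ≤ H := total_nonneg (fun _ _ => ind_nonneg _) h
  have hH4 : 4 * H ≤ H * (4 * S) := by nlinarith
  have ha3 : 0 < a := by
    by_contra h0
    have : a = 0 := le_antisymm (not_lt.1 h0) ha0
    rw [this] at ha1
    linarith
  -- With cont > 3a/4, I ≥ cont - 0.08a and J > 0.8 I - a/100, the budget 2J ≤ cont + H gives 0.6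
  -- cont < 0.148a + H, which contradicts H < a/4.
  linarith

variable {adv : Adversary V}

/-- With γ = 1 + 1/(3(S + 1)) one has γ^S ≤ e^(1/3) < 2. -/
lemma exists_growth (S : ℕ) : ∃ γ : ℝ, 1 < γ ∧ γ ≤ 4 / 3 ∧ γ ^ S ≤ 2 := by
  have hS : (0 : ℝ) < S + 1 := by positivity
  have h1 : 1 / (3 * ((S : ℝ) + 1)) ≤ 1 / 3 := by
    rw [div_le_div_iff₀ (by positivity) (by norm_num)]
    have : (0 : ℝ) ≤ S := Nat.cast_nonneg S
    linarith
  refine ⟨1 + 1 / (3 * (S + 1)), by linarith [show 0 < 1 / (3 * ((S : ℝ) + 1)) by positivity],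
    by linarith, ?_⟩
  calc (1 + 1 / (3 * ((S : ℝ) + 1))) ^ S ≤ Real.exp (1 / (3 * (S + 1))) ^ S := by
        gcongr
        linarith [Real.add_one_le_exp (1 / (3 * ((S : ℝ) + 1)))]
    _ = Real.exp (S * (1 / (3 * (S + 1)))) := by rw [← Real.exp_nat_mul]
    _ ≤ Real.exp (Real.log 2) := by
        refine Real.exp_le_exp.2 ?_
        have h2 : (S : ℝ) * (1 / (3 * (S + 1))) ≤ 1 / 3 := by
          rw [mul_one_div, div_le_div_iff₀ (by positivity) (by norm_num)]
          linarith
        linarith [Real.log_two_gt_d9]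
    _ = 2 := Real.exp_log (by norm_num)

/-- Multiplying the drift estimate by 4 explains `avgContention`: 4 for the initial mass, which has
shrunk to at most 1, 6φ₀ for the growth at low contention, and 6 · 4/log h₁ for the failures. -/
lemma late_le_of_failed {γ : ℝ} (hγ : 1 ≤ γ) (hγ' : γ ≤ 4 / 3) (hS : γ ^ S ≤ 2) {t₀ : ℕ}
    {h : History V} (hn : (Fintype.card V : ℝ) ≤ γ ^ ((t₀ + 1) / 3)) (ht₀ : t₀ ≤ h.length)
    (ha : 1 ≤ elections h) {B : Set V}
    (hF : failedContention M S s B h ≤ 4 / Real.log M.h₁ * elections h) :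
    lateContention M S s t₀ B h ≤ avgContention M * elections h := by
  have h1 := lateContention_add_mass_le (M := M) (S := S) (s := s) hγ hγ' hS t₀ B h
  have h2 := mass_nonneg (M := M) (S := S) (s := s) hγ B h
  rw [min_eq_right ht₀, inv_pow] at h1
  have hpos : 0 < γ ^ ((t₀ + 1) / 3) := by positivity
  have h3 : (γ ^ ((t₀ + 1) / 3))⁻¹ * (Fintype.card V : ℝ) ≤ 1 := by
    rw [inv_mul_le_iff₀ hpos]; linarith
  unfold avgContention
  have : (24 : ℝ) / Real.log M.h₁ = 6 * (4 / Real.log M.h₁) := by ring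
  rw [this]
  nlinarith

open Classical in
-- Union bound: each node has four bad events, one for each probabilistic hypothesis of `le_hits`,
-- and the exponent is a common lower bound for the four decay rates.
lemma law_hits_lt_le (hV : Bounded M V) (hS1 : 1 ≤ S)
    (hS : 2000 * c.N ≤ c.winRate * c.notifyRate * S) {γ : ℝ} (hγ : 1 ≤ γ) (hγ' : γ ≤ 4 / 3)
    (hγS : γ ^ S ≤ 2) (hadm : Admissible M (broadcast S) s adv) {t : ℕ} {a : ℝ}
    (hat : a = ((t + 1) / 3 : ℕ)) (ha1 : 1000 ≤ c.winRate * a)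
    (ha2 : 2000 * c.N ≤ c.winRate * c.notifyRate * a) {m : ℕ} (hm : (m : ℝ) ≤ a / 50)
    (hcard : (Fintype.card V : ℝ) ≤ γ ^ m) :
    (law M (broadcast S) s adv t).toOuterMeasure {h | ∃ x, hits M S s x h < a / (4 * S)} ≤
      ENNReal.ofReal (4 * Fintype.card V *
        Real.exp (-((c.winRate ^ 2 * c.notifyRate ^ 2 / 10000) * a))) := by
  have hw := c.winRate_pos
  have hn := c.notifyRate_pos
  have hw1 := c.winRate_le_one
  have hn1 := c.notifyRate_le_one
  have ha0 : 0 ≤ a := by rw [hat]; positivity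
  have ha1' : 1 ≤ a := by nlinarith
  set P := (law M (broadcast S) s adv t).toOuterMeasure with hP
  set c₀ := c.winRate ^ 2 * c.notifyRate ^ 2 / 10000 with hc₀
  have hsq1 : c.winRate ^ 2 * c.notifyRate ^ 2 ≤ c.winRate ^ 2 :=
    mul_le_of_le_one_right (by positivity) (pow_le_one₀ hn.le hn1)
  have hsq2 : c.winRate ^ 2 * c.notifyRate ^ 2 ≤ c.winRate * c.notifyRate ^ 2 :=
    mul_le_mul_of_nonneg_right (by nlinarith) (by positivity)
  have hsq3 : c.winRate ^ 2 * c.notifyRate ^ 2 ≤ 1 :=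
    mul_le_one₀ (pow_le_one₀ hw.le hw1) (by positivity) (pow_le_one₀ hn.le hn1)
  have hexp : ∀ b : ℝ, c₀ * a ≤ b →
      ENNReal.ofReal (Real.exp (-b)) ≤ ENNReal.ofReal (Real.exp (-(c₀ * a))) := fun b hb =>
    ENNReal.ofReal_le_ofReal (Real.exp_le_exp.2 (by linarith))
  set e := ENNReal.ofReal (Real.exp (-(c₀ * a))) with he
  -- Exactly `m` elections precede round `3 * m`, enough for γ^m to outweigh the number of nodes.
  set t₀ := 3 * m with ht₀
  have hm' : (t₀ + 1) / 3 = m := by omega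
  have hmt : t₀ ≤ t := by
    have h1 : (m : ℝ) ≤ ((t + 1) / 3 : ℕ) := by rw [← hat]; linarith
    have h2 : m ≤ (t + 1) / 3 := by exact_mod_cast h1
    have h3 : ((m : ℝ)) * 50 ≤ ((t + 1) / 3 : ℕ) := by rw [← hat]; linarith
    have h4 : m * 50 ≤ (t + 1) / 3 := by exact_mod_cast h3
    omega
  set F : V → Set (History V) := fun y => {h | 4 / Real.log M.h₁ * ((t + 1) / 3 : ℕ) ≤
        failedContention M S s (Metric.ball y (M.R / 2)) h} with hF
  set E₁ : V → Set (History V) := fun x => {h | c.winRate * a / 1000 ≤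
    c.winRate / 2 * total (fun h _ => ind (h.length % 3 = 1 ∧ Busyish c S s x h)) h -
      total (fun h y => ind ((h.length % 3 = 1 ∧ Busyish c S s x h) ∧ LocalWin c x y)) h} with hE₁
  set E₂ : V → Set (History V) := fun x => {h | c.winRate * c.notifyRate * a / 2000 ≤
    c.notifyRate / 2 * total (fun h _ => ind (h.length % 3 = 2 ∧ LocalFresh c S s x h)) h -
      total (fun h y => ind ((h.length % 3 = 2 ∧ LocalFresh c S s x h) ∧
        ∃ u ∈ Finset.univ.filter fun u => dist u x < c.ℓ, Notifies M S s h y u)) h} with hE₂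
  set E₃ : V → Set (History V) := fun x => {h | a / 100 ≤
    0.8 * total (fun h _ => ind (h.length % 3 = 1 ∧ (node M S s h x).pause = 0 ∧
        Quiet c S s x t₀ h)) h -
      total (fun h y => ind ((h.length % 3 = 1 ∧ (node M S s h x).pause = 0 ∧
        Quiet c S s x t₀ h) ∧ y.2.busy x = false)) h} with hE₃
  have hPF : ∀ y, P (F y) ≤ e := fun y => by
    refine (law_failedContention_le hadm y t).trans ?_
    rw [← hat]
    refine hexp a ?_
    rw [hc₀]
    nlinarith
  have hP1 : ∀ x, P (E₁ x) ≤ e := fun x => by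
    refine (law_chernoff (P := fun h => h.length % 3 = 1 ∧ Busyish c S s x h)
      (B := fun _ y => LocalWin c x y) (p := c.winRate) (p' := c.winRate / 2) (by positivity)
      (by linarith) hw1 (fun t h hh hb => le_roundLaw_localWin c hadm hh hb.1 hb.2.1 hb.2.2)
      t _).trans (hexp _ ?_)
    rw [hc₀]
    nlinarith
  have hP2 : ∀ x, P (E₂ x) ≤ e := fun x => by
    refine (law_chernoff (P := fun h => h.length % 3 = 2 ∧ LocalFresh c S s x h)
      (B := fun h y => ∃ u ∈ Finset.univ.filter fun u => dist u x < c.ℓ, Notifies M S s h y u)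
      (p := c.notifyRate) (p' := c.notifyRate / 2) (by positivity)
      (by linarith) hn1 (fun t h hh hb => le_roundLaw_notifies c hV hadm hh hb.1 hb.2)
      t _).trans (hexp _ ?_)
    rw [hc₀]
    have := mul_le_mul_of_nonneg_right hsq2 ha0
    nlinarith
  have hP3 : ∀ x, P (E₃ x) ≤ e := fun x => by
    refine (law_chernoff (P := fun h => h.length % 3 = 1 ∧ (node M S s h x).pause = 0 ∧
        Quiet c S s x t₀ h) (B := fun _ y => y.2.busy x = false) (p := 0.9) (p' := 0.8)
      (by norm_num) (by norm_num) (by norm_num)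
      (fun t h hh hb => le_roundLaw_idle c hadm hh hb.2.2.2.1 hb.2.2.2.2) t _).trans (hexp _ ?_)
    rw [hc₀]
    have := mul_le_mul_of_nonneg_right hsq3 ha0
    norm_num
    nlinarith
  have hsub : P {h | ∃ x, hits M S s x h < a / (4 * S)} ≤
      P ((⋃ y, F y) ∪ ⋃ x, (E₁ x ∪ (E₂ x ∪ E₃ x))) := by
    refine toOuterMeasure_mono_of_support fun h hh hlt => ?_
    by_contra hcon
    simp only [Set.mem_union, Set.mem_iUnion, not_or, not_exists] at hcon
    obtain ⟨hcF, hcE⟩ := hcon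
    obtain ⟨x, hx⟩ := hlt
    obtain ⟨h1, h2, h3⟩ := hcE x
    have hlen := length_of_mem_support hh
    have hae : elections h = a := by rw [elections_eq, hlen, hat]
    refine absurd hx (not_lt.2 ?_)
    rw [← hae]
    refine le_hits c hV hS1 hS (t₀ := t₀) (valid_of_mem_support hadm hh) (by rwa [hae])
      (by rwa [hae]) (by rw [hm', hae]; exact hm) (fun y => ?_) x ?_ ?_ ?_
    · refine late_le_of_failed hγ hγ' hγS (by rwa [hm']) (by omega) (by rwa [hae]) ?_
      rw [hae, hat]
      exact (not_le.1 (hcF y)).le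
    · rw [hae]; exact not_le.1 h1
    · rw [hae]; exact not_le.1 h2
    · rw [hae]; exact not_le.1 h3
  refine hsub.trans ?_
  calc P ((⋃ y, F y) ∪ ⋃ x, (E₁ x ∪ (E₂ x ∪ E₃ x)))
      ≤ ∑ y, P (F y) + ∑ x, (P (E₁ x) + (P (E₂ x) + P (E₃ x))) := by
        refine (MeasureTheory.measure_union_le _ _).trans (add_le_add ?_ ?_)
        · exact (MeasureTheory.measure_iUnion_fintype_le _ _)
        · refine (MeasureTheory.measure_iUnion_fintype_le _ _).trans
            (Finset.sum_le_sum fun x _ => ?_)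
          exact (MeasureTheory.measure_union_le _ _).trans
            (add_le_add_right (MeasureTheory.measure_union_le _ _) _)
    _ ≤ ∑ _y : V, e + ∑ _x : V, (e + (e + e)) := by
        gcongr with y _ x _
        · exact hPF y
        · exact hP1 x
        · exact hP2 x
        · exact hP3 x
    _ = ENNReal.ofReal (4 * Fintype.card V * Real.exp (-(c₀ * a))) := by
        rw [ENNReal.ofReal_mul (by positivity), ENNReal.ofReal_mul (by norm_num)]
        simp only [Finset.sum_const, Finset.card_univ, nsmul_eq_mul, ENNReal.ofReal_natCast,
          ENNReal.ofReal_ofNat]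
        ring

end Coverage

/-! ### Dissemination -/

section Informed

variable {V : Type} [Fintype V] [MetricSpace V] {M : Model} {S : ℕ} {s : V}

lemma informed_subset_cons (h : History V) (x : Finset V × Outcome V) :
    informed s h ⊆ informed s (x :: h) := by
  obtain ⟨T, o⟩ := x
  exact fun v hv => Or.inl hv

lemma mem_informed_of_massDelivers {h : History V} {x : Finset V × Outcome V} {u v : V}
    (hu : u ∈ informed s h) (hx : MassDelivers M x.2 u)
    (huv : dist u v ≤ (1 - M.ε / 2) * M.R) : v ∈ informed s (x :: h) := by
  obtain ⟨T, o⟩ := x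
  by_cases hvu : v = u
  · exact Or.inl (hvu ▸ hu)
  · exact Or.inr ⟨u, hx v hvu huv, hu⟩

/-- In round 0 the source transmits with probability 1 and everyone else with probability 0, so
there is no interference at all. -/
lemma massDelivers_start {x : Finset V × Outcome V} (hx : RoundOK M (broadcast S) s [] x) :
    MassDelivers M x.2 s := by
  classical
  have hsrc : s ∈ x.1 := hx.mem_of_prob s (by
    rw [transmitProb_start, if_pos ((node_src _ _).2 rfl)])
  have hall : ∀ w ∈ x.1, w = s := fun w hw => by
    by_contra hne
    refine hx.prob_ne_zero w hw ?_
    rw [transmitProb_start, if_neg fun h => hne ((node_src _ _).1 h)]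
  refine hx.legal.succClear s hsrc (fun w hw hne => absurd (hall w hw) hne) ?_
  unfold interference
  rw [Finset.sum_eq_zero]
  · exact M.Ic_pos.le
  · intro w hw
    exact absurd (hall w (Finset.mem_of_mem_erase hw)) (Finset.ne_of_mem_erase hw)

lemma mem_informed_of_near_source {h : History V} (hv : Valid M (broadcast S) s h)
    (h0 : h.length ≠ 0) {v : V} (hsv : dist s v ≤ (1 - M.ε / 2) * M.R) : v ∈ informed s h := by
  induction h with
  | nil => exact absurd rfl h0
  | cons x h ih =>
    by_cases hh : h.length = 0
    · obtain rfl := List.length_eq_zero_iff.1 hh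
      exact mem_informed_of_massDelivers (u := s) rfl (massDelivers_start hv.2) hsv
    · exact informed_subset_cons h x (ih hv.1 hh)

/-- All nodes near `x` are informed. -/
def NearInformed (M : Model) (s : V) (h : History V) (x : V) : Prop :=
  ∀ u, dist u x < M.ε / 4 * M.R → u ∈ informed s h

open Classical in
/-- The progress of the broadcast along a path. -/
def frontier (M : Model) (s : V) (x : ℕ → V) (d : ℕ) (h : History V) : ℕ :=
  Nat.findGreatest (fun i => NearInformed M s h (x i)) d

variable {x : ℕ → V} {d : ℕ}

lemma frontier_le (h : History V) : frontier M s x d h ≤ d := by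
  classical
  exact Nat.findGreatest_le d

lemma nearInformed_frontier {h : History V} (hv : Valid M (broadcast S) s h)
    (h0 : h.length ≠ 0) (hx0 : x 0 = s) : NearInformed M s h (x (frontier M s x d h)) := by
  classical
  -- `Nat.findGreatest` defaults to 0, so index 0 has to satisfy the predicate: round 0 has informed
  -- everything near the source.
  refine Nat.findGreatest_spec (P := fun i => NearInformed M s h (x i)) (Nat.zero_le d) ?_
  intro u hu
  refine mem_informed_of_near_source hv h0 ?_
  rw [dist_comm, ← hx0]
  exact hu.le.trans (near_le_reach M)

lemma frontier_le_cons {h : History V} (hv : Valid M (broadcast S) s h)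
    (h0 : h.length ≠ 0) (hx0 : x 0 = s) (y : Finset V × Outcome V) :
    frontier M s x d h ≤ frontier M s x d (y :: h) := by
  classical
  exact Nat.le_findGreatest (frontier_le h)
    fun u hu => informed_subset_cons h y (nearInformed_frontier hv h0 hx0 u hu)

lemma frontier_lt {h : History V} (hv : Valid M (broadcast S) s h)
    (h0 : h.length ≠ 0) (hx0 : x 0 = s) (hd : x d ∉ informed s h) :
    frontier M s x d h < d := by
  refine lt_of_le_of_ne (frontier_le h) fun heq => hd ?_
  have := nearInformed_frontier (d := d) hv h0 hx0
  rw [heq] at this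
  exact this _ (by rw [dist_self]; exact near_pos M)

/-- All nodes near the frontier are informed, so it does not matter which of them succeeds. The
reach is just enough for everything near the next path node: εR/4 + (1 - ε)R + εR/4 = (1 - ε/2)R. -/
lemma frontier_lt_cons {h : History V} (hv : Valid M (broadcast S) s h)
    (h0 : h.length ≠ 0) (hx0 : x 0 = s)
    (hx : ∀ i < d, dist (x i) (x (i + 1)) ≤ (1 - M.ε) * M.R) (hd : x d ∉ informed s h)
    {y : Finset V × Outcome V} {u : V} (hu : dist u (x (frontier M s x d h)) < M.ε / 4 * M.R)
    (hy : MassDelivers M y.2 u) : frontier M s x d h < frontier M s x d (y :: h) := by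
  classical
  have hlt := frontier_lt hv h0 hx0 hd
  refine Nat.succ_le_iff.1 (Nat.le_findGreatest hlt fun w hw => ?_)
  refine mem_informed_of_massDelivers (nearInformed_frontier hv h0 hx0 u hu) hy ?_
  have h1 := dist_triangle4 u (x (frontier M s x d h)) (x (frontier M s x d h + 1)) w
  have h2 := hx _ hlt
  rw [dist_comm] at hw
  have : (1 - M.ε / 2) * M.R = M.ε / 4 * M.R + (1 - M.ε) * M.R + M.ε / 4 * M.R := by ring
  rw [this]
  exact h1.trans (add_le_add (add_le_add hu.le h2) hw.le)

lemma total_progress_le {Q : History V → Prop} (hx0 : x 0 = s)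
    (hx : ∀ i < d, dist (x i) (x (i + 1)) ≤ (1 - M.ε) * M.R)
    (hQ : ∀ h, Q h → h.length ≠ 0 ∧ x d ∉ informed s h) {h : History V}
    (hv : Valid M (broadcast S) s h) :
    total (fun h y => ind (Q h ∧ ∃ u, dist u (x (frontier M s x d h)) < M.ε / 4 * M.R ∧
      MassDelivers M y.2 u)) h ≤ d := by
  -- The frontier is monotone only once round 0 has passed, so it is replaced by 0 for the empty
  -- history.
  have key : total (fun h y => ind (Q h ∧ ∃ u, dist u (x (frontier M s x d h)) < M.ε / 4 * M.R ∧
      MassDelivers M y.2 u)) h ≤ if h.length = 0 then 0 else (frontier M s x d h : ℝ) := by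
    induction h with
    | nil => simp
    | cons y h ih =>
      obtain ⟨hv, -⟩ := hv
      have ih := ih hv
      rw [total_cons, List.length_cons, if_neg (Nat.succ_ne_zero _)]
      by_cases hQh : Q h ∧ ∃ u, dist u (x (frontier M s x d h)) < M.ε / 4 * M.R ∧
          MassDelivers M y.2 u
      · rw [ind_pos hQh]
        obtain ⟨hq, u, hu, hy⟩ := hQh
        obtain ⟨h0, hd⟩ := hQ h hq
        rw [if_neg h0] at ih
        have : ((frontier M s x d h + 1 : ℕ) : ℝ) ≤ frontier M s x d (y :: h) := by
          exact_mod_cast frontier_lt_cons hv h0 hx0 hx hd hu hy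
        push_cast at this
        linarith
      · rw [ind_neg hQh, add_zero]
        refine ih.trans ?_
        split_ifs with h0
        · exact Nat.cast_nonneg _
        · exact_mod_cast frontier_le_cons hv h0 hx0 y
  refine key.trans ?_
  split_ifs
  · exact Nat.cast_nonneg _
  · exact_mod_cast frontier_le h

lemma exists_path (hconn : (commGraph M V).Connected) (s v : V) :
    ∃ (d : ℕ) (x : ℕ → V), d ≤ (commGraph M V).diam ∧ x 0 = s ∧ x d = v ∧
      ∀ i < d, dist (x i) (x (i + 1)) ≤ (1 - M.ε) * M.R := by
  obtain ⟨p, hp⟩ := hconn.exists_walk_length_eq_dist s v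
  have : Nonempty V := ⟨s⟩
  refine ⟨p.length, p.getVert, ?_, p.getVert_zero, p.getVert_length, fun i hi =>
    (p.adj_getVert_succ hi).2⟩
  rw [hp]
  -- `diam` would be the default 0 if distances were unbounded; connectedness excludes this.
  exact SimpleGraph.dist_le_diam (SimpleGraph.connected_iff_ediam_ne_top.1 hconn)

/-- The cap 1/2 is never active along an execution, as a node cannot win more elections than have
taken place. -/
lemma coe_transmitProb_dissemination {h : History V} (hh : h.length % 3 = 0) (h0 : h.length ≠ 0)
    (v : V) : (transmitProb M (broadcast S) s h v : ℝ) =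
      (node M S s h v).wins / (2 * elections h) := by
  have hb : (h.length + 1) / 3 = h.length / 3 := by omega
  have hb0 : (0 : ℝ) < (h.length / 3 : ℕ) := by
    have : 0 < h.length / 3 := by omega
    exact_mod_cast this
  have hw : ((node M S s h v).wins : ℝ) ≤ (h.length / 3 : ℕ) := by
    have := (wins_le (M := M) (S := S) (s := s) h v).1
    exact_mod_cast (by omega : (node M S s h v).wins ≤ h.length / 3)
  rw [transmitProb_dissemination hh h0, elections_eq, hb, NNReal.coe_min]
  push_cast
  refine min_eq_right ?_
  rw [div_le_div_iff₀ (by positivity) (by norm_num)]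
  linarith

lemma elections_pos {h : History V} (hh : h.length % 3 = 0) (h0 : h.length ≠ 0) :
    0 < elections h := by
  rw [elections_eq]
  have : 0 < (h.length + 1) / 3 := by omega
  exact_mod_cast this

variable (c : Scale M) {adv : Adversary V}

/-- The probabilities are half the time average of indicators of separated winner sets, so no
concentration argument is needed here. -/
lemma moderate_dissemination (hV : Bounded M V) {h : History V}
    (hv : Valid M (broadcast S) s h) (hh : h.length % 3 = 0) (h0 : h.length ≠ 0) (x : V) :
    Moderate c (transmitProb M (broadcast S) s h) x := by
  have hE := elections_pos hh h0
  refine moderate_of_le c hV (fun g G _ hG => ?_) x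
  have h1 := sum_wins_mul_le hv hG
  have hG0 : 0 ≤ G := by simpa using hG ∅ (by simp [Separated])
  have h2 : ∑ v, (transmitProb M (broadcast S) s h v : ℝ) * g v =
      (∑ w, ((node M S s h w).wins : ℝ) * g w) / (2 * elections h) := by
    rw [Finset.sum_div]
    refine Finset.sum_congr rfl fun v _ => ?_
    rw [coe_transmitProb_dissemination hh h0]
    ring
  rw [h2, div_le_iff₀ (by positivity)]
  nlinarith

open Classical in
-- The hits are paid for by wins within εR/4; dividing their number by twice the number of elections
-- turns 1/(4S) into 1/(8S).
lemma le_sum_transmitProb (hS1 : 1 ≤ S) {h : History V} (hv : Valid M (broadcast S) s h)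
    (hh : h.length % 3 = 0) (h0 : h.length ≠ 0) {x : V}
    (hx : elections h / (4 * S) ≤ hits M S s x h) :
    1 / (8 * S) ≤ ∑ u with dist u x < M.ε / 4 * M.R,
      (transmitProb M (broadcast S) s h u : ℝ) := by
  have hE := elections_pos hh h0
  have hS : (0 : ℝ) < S := by exact_mod_cast hS1
  have h1 := hits_le_sum_wins hv x
  have h2 : 0 ≤ ∑ u with dist u x < M.ε / 4 * M.R,
      (if u ∈ freshSet M S s h then (1 : ℝ) else 0) :=
    Finset.sum_nonneg fun u _ => by split_ifs <;> norm_num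
  simp only [coe_transmitProb_dissemination hh h0]
  rw [← Finset.sum_div, le_div_iff₀ (by positivity)]
  refine le_trans (le_of_eq ?_) (hx.trans (by linarith :
    hits M S s x h ≤ ∑ u with dist u x < M.ε / 4 * M.R, ((node M S s h u).wins : ℝ)))
  field_simp
  norm_num

lemma le_roundLaw_spread (hV : Bounded M V) (hS1 : 1 ≤ S)
    (hadm : Admissible M (broadcast S) s adv) {t : ℕ} {h : History V}
    (hmem : h ∈ (law M (broadcast S) s adv t).support) (hh : h.length % 3 = 0)
    (h0 : h.length ≠ 0) {x : V} (hx : elections h / (4 * S) ≤ hits M S s x h) :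
    ENNReal.ofReal (c.rate / (8 * S)) ≤ (roundLaw M (broadcast S) s adv h).toOuterMeasure
      {y | ∃ u, dist u x < M.ε / 4 * M.R ∧ MassDelivers M y.2 u} := by
  classical
  have hv := valid_of_mem_support hadm hmem
  have h1 := le_roundLaw_clear c hadm hmem (transmitProb_le_half h0)
    (moderate_dissemination c hV hv hh h0 x)
    (U := Finset.univ.filter fun u => dist u x < M.ε / 4 * M.R) fun u hu => by
      have := (Finset.mem_filter.1 hu).2
      linarith [c.near_le, near_pos M]
  refine le_trans (ENNReal.ofReal_le_ofReal ?_) (h1.trans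
    (toOuterMeasure_mono_of_support fun y _ hy => ?_))
  · have := mul_le_mul_of_nonneg_left (le_sum_transmitProb hS1 hv hh h0 hx) c.rate_pos.le
    rwa [mul_one_div] at this
  · obtain ⟨u, hu, hy, -⟩ := hy
    exact ⟨u, (Finset.mem_filter.1 hu).2, hy⟩

/-- A dissemination round from round `t₁` on in which some node has not been notified often
enough. -/
def Uncovered (M : Model) (S : ℕ) (s : V) (t₁ : ℕ) (h : History V) : Prop :=
  (h.length % 3 = 0 ∧ t₁ ≤ h.length) ∧ ∃ x, hits M S s x h < elections h / (4 * S)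

lemma le_total_slots (t₁ : ℕ) (h : History V) :
    (((h.length + 2) / 3 : ℕ) : ℝ) - ((t₁ + 2) / 3 : ℕ) ≤
      total (fun h _ => ind (h.length % 3 = 0 ∧ t₁ ≤ h.length)) h := by
  induction h with
  | nil =>
    simp
  | cons x h ih =>
    rw [total_cons, List.length_cons]
    by_cases hh : h.length % 3 = 0
    · rw [show (h.length + 1 + 2) / 3 = (h.length + 2) / 3 + 1 by omega]
      by_cases ht : t₁ ≤ h.length
      · rw [ind_pos ⟨hh, ht⟩]
        push_cast
        linarith
      · rw [ind_neg (by tauto), add_zero]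
        have h1 : (((h.length + 2) / 3 + 1 : ℕ) : ℝ) ≤ ((t₁ + 2) / 3 : ℕ) := by
          exact_mod_cast (by omega : (h.length + 2) / 3 + 1 ≤ (t₁ + 2) / 3)
        have := total_nonneg (f := fun (h : History V) _ =>
          ind (h.length % 3 = 0 ∧ t₁ ≤ h.length)) (fun _ _ => ind_nonneg _) h
        linarith
    · rw [ind_neg (by tauto), add_zero, show (h.length + 1 + 2) / 3 = (h.length + 2) / 3 by omega]
      exact ih

/-- As long as `v` lacks the message, every late dissemination round either qualifies for progress
or is uncovered. -/
lemma total_slots_le {t₁ : ℕ} {v : V} {h : History V} (hv : v ∉ informed s h) :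
    total (fun h _ => ind (h.length % 3 = 0 ∧ t₁ ≤ h.length)) h ≤
      total (fun h _ => ind ((h.length % 3 = 0 ∧ t₁ ≤ h.length) ∧ ¬ Uncovered M S s t₁ h ∧
        v ∉ informed s h)) h + total (fun h _ => ind (Uncovered M S s t₁ h)) h := by
  induction h with
  | nil => simp
  | cons x h ih =>
    have hv' : v ∉ informed s h := fun hcon => hv (informed_subset_cons h x hcon)
    have ih := ih hv'
    rw [total_cons, total_cons, total_cons]
    have : ind (h.length % 3 = 0 ∧ t₁ ≤ h.length) ≤
        ind ((h.length % 3 = 0 ∧ t₁ ≤ h.length) ∧ ¬ Uncovered M S s t₁ h ∧ v ∉ informed s h) +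
          ind (Uncovered M S s t₁ h) := by
      by_cases hu : Uncovered M S s t₁ h
      · rw [ind_pos hu]
        linarith [ind_le_one (h.length % 3 = 0 ∧ t₁ ≤ h.length),
          ind_nonneg ((h.length % 3 = 0 ∧ t₁ ≤ h.length) ∧ ¬ Uncovered M S s t₁ h ∧
            v ∉ informed s h)]
      · refine (ind_mono (q := (h.length % 3 = 0 ∧ t₁ ≤ h.length) ∧ ¬ Uncovered M S s t₁ h ∧
          v ∉ informed s h) fun hp => ⟨hp, hu, hv'⟩).trans ?_
        linarith [ind_nonneg (Uncovered M S s t₁ h)]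
    linarith

/-- Either some late dissemination round is uncovered, which a union bound over time makes unlikely,
or some `v` stays uninformed through about `j` rounds that each advance the frontier with
probability at least κ. At most `diam` advances are possible, so Chernoff applies. -/
lemma law_not_informed_le (hV : Bounded M V) (hconn : (commGraph M V).Connected) (hS1 : 1 ≤ S)
    (hS : 2000 * c.N ≤ c.winRate * c.notifyRate * S) {γ : ℝ} (hγ : 1 ≤ γ) (hγ' : γ ≤ 4 / 3)
    (hγS : γ ^ S ≤ 2) (hadm : Admissible M (broadcast S) s adv) {T j m : ℕ} (hj : 6 * j ≤ T)
    (hj1 : 1000 ≤ c.winRate * j) (hj2 : 2000 * c.N ≤ c.winRate * c.notifyRate * j)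
    (hm : (m : ℝ) ≤ j / 50) (hcard : (Fintype.card V : ℝ) ≤ γ ^ m) {κ c₀ : ℝ}
    (hκ : κ = c.rate / (8 * S)) (hc₀ : c₀ = c.winRate ^ 2 * c.notifyRate ^ 2 / 10000) :
    (law M (broadcast S) s adv T).toOuterMeasure {h | ¬ ∀ v, v ∈ informed s h} ≤
      ENNReal.ofReal (T * (4 * Fintype.card V * Real.exp (-(c₀ * j))) + Fintype.card V *
        Real.exp (-(κ / 2 * (κ / 2 * (j - 1) - (commGraph M V).diam)))) := by
  have hw := c.winRate_pos
  have hn := c.notifyRate_pos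
  have hSpos : (1 : ℝ) ≤ S := by exact_mod_cast hS1
  have hκ0 : 0 < κ := by
    rw [hκ]
    exact div_pos c.rate_pos (by linarith)
  have hκ1 : κ ≤ 1 := by
    rw [hκ, div_le_one (by linarith)]
    linarith [c.rate_le_one]
  have hj0 : j ≠ 0 := by
    rintro rfl
    norm_num at hj1
  -- The first `3 * j` rounds make the win frequencies reliable; `T ≥ 6 * j` leaves at least `j`
  -- dissemination rounds.
  set t₁ := 3 * j with ht₁
  have hsparse : (law M (broadcast S) s adv T).toOuterMeasure
      {h | 1 ≤ total (fun h _ => ind (Uncovered M S s t₁ h)) h} ≤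
      ENNReal.ofReal (T * (4 * Fintype.card V * Real.exp (-(c₀ * j)))) := by
    refine (law_one_le_total_le _ T).trans ?_
    rw [ENNReal.ofReal_mul (Nat.cast_nonneg _), ENNReal.ofReal_natCast]
    refine (Finset.sum_le_card_nsmul _ _ _ fun t _ => ?_).trans
      (by rw [Finset.card_range, nsmul_eq_mul])
    by_cases ht : t₁ ≤ t
    · have hja : (j : ℝ) ≤ ((t + 1) / 3 : ℕ) := by
        exact_mod_cast (by omega : j ≤ (t + 1) / 3)
      refine (toOuterMeasure_mono_of_support fun h hh hu => ?_).trans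
        ((law_hits_lt_le c hV hS1 hS hγ hγ' hγS hadm (t := t) rfl (m := m) ?_ ?_ ?_ hcard).trans
          (ENNReal.ofReal_le_ofReal ?_))
      · obtain ⟨-, x, hx⟩ := hu
        refine ⟨x, ?_⟩
        rwa [elections_eq, length_of_mem_support hh] at hx
      · exact hj1.trans (by gcongr)
      · exact hj2.trans (by gcongr)
      · exact hm.trans (by gcongr)
      · rw [hc₀]
        gcongr
    · refine (toOuterMeasure_mono_of_support (t := ∅) fun h hh hu => ?_).trans (by simp)
      have := hu.1.2
      rw [length_of_mem_support hh] at this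
      exact absurd this ht
  have hslow : ∀ v, (law M (broadcast S) s adv T).toOuterMeasure
      {h | v ∉ informed s h ∧ ¬ 1 ≤ total (fun h _ => ind (Uncovered M S s t₁ h)) h} ≤
      ENNReal.ofReal (Real.exp (-(κ / 2 * (κ / 2 * (j - 1) - (commGraph M V).diam)))) := by
    intro v
    obtain ⟨d, x, hd, hx0, hxd, hx⟩ := exists_path hconn s v
    have hch := law_chernoff (M := M) (A := broadcast S) (s := s) (adv := adv)
      (P := fun h => (h.length % 3 = 0 ∧ t₁ ≤ h.length) ∧ ¬ Uncovered M S s t₁ h ∧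
        v ∉ informed s h)
      (B := fun h y => ∃ u, dist u (x (frontier M s x d h)) < M.ε / 4 * M.R ∧
        MassDelivers M y.2 u) (p := κ) (p' := κ / 2) (by linarith) (by linarith) hκ1
      (fun t h hh hP => by
        obtain ⟨hsl, hunc, -⟩ := hP
        rw [hκ]
        refine le_roundLaw_spread c hV hS1 hadm hh hsl.1 (by omega) ?_
        by_contra hcon
        exact hunc ⟨hsl, x (frontier M s x d h), not_le.1 hcon⟩) T (κ / 2 * (j - 1) - (commGraph M V).diam)
    rw [show κ - κ / 2 = κ / 2 by ring] at hch
    refine (toOuterMeasure_mono_of_support fun h hh hun => ?_).trans hch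
    obtain ⟨hvi, hfew⟩ := hun
    have h1 := le_total_slots t₁ h
    have h2 := total_slots_le (M := M) (S := S) (t₁ := t₁) hvi
    have h3 := total_progress_le (Q := fun h => (h.length % 3 = 0 ∧ t₁ ≤ h.length) ∧
      ¬ Uncovered M S s t₁ h ∧ v ∉ informed s h) hx0 hx
      (fun h hQ => ⟨by have := hQ.1.2; omega, hxd ▸ hQ.2.2⟩) (valid_of_mem_support hadm hh)
    rw [length_of_mem_support hh, show (t₁ + 2) / 3 = j by omega] at h1
    have h4 : (2 * j : ℝ) ≤ ((T + 2) / 3 : ℕ) := by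
      exact_mod_cast (by omega : 2 * j ≤ (T + 2) / 3)
    have h5 : (d : ℝ) ≤ (commGraph M V).diam := by exact_mod_cast hd
    rw [Set.mem_ofPred_eq]
    -- The uncovered rounds total less than 1, which costs one slot in this estimate.
    have h6 : (j : ℝ) - 1 ≤ total (fun h _ => ind ((h.length % 3 = 0 ∧ t₁ ≤ h.length) ∧
        ¬ Uncovered M S s t₁ h ∧ v ∉ informed s h)) h := by linarith
    have h7 := mul_le_mul_of_nonneg_left h6 (by linarith : 0 ≤ κ / 2)
    linarith
  have hsub : (law M (broadcast S) s adv T).toOuterMeasure {h | ¬ ∀ v, v ∈ informed s h} ≤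
      (law M (broadcast S) s adv T).toOuterMeasure
        ({h | 1 ≤ total (fun h _ => ind (Uncovered M S s t₁ h)) h} ∪ ⋃ v, {h | v ∉ informed s h ∧
          ¬ 1 ≤ total (fun h _ => ind (Uncovered M S s t₁ h)) h}) := by
    refine toOuterMeasure_mono_of_support fun h _ hun => ?_
    rw [Set.mem_ofPred_eq, not_forall] at hun
    obtain ⟨v, hv⟩ := hun
    by_cases hu : 1 ≤ total (fun h _ => ind (Uncovered M S s t₁ h)) h
    · exact Or.inl hu
    · exact Or.inr (Set.mem_iUnion.2 ⟨v, hv, hu⟩)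
  refine hsub.trans ((MeasureTheory.measure_union_le _ _).trans ?_)
  rw [ENNReal.ofReal_add (by positivity) (by positivity)]
  refine add_le_add hsparse ((MeasureTheory.measure_iUnion_fintype_le _ _).trans ?_)
  rw [ENNReal.ofReal_mul (Nat.cast_nonneg _), ENNReal.ofReal_natCast]
  refine (Finset.sum_le_card_nsmul _ _ _ fun v _ => hslow v).trans ?_
  rw [Finset.card_univ, nsmul_eq_mul]

end Informed

/-! ### Choice of the constants and conclusion -/

/-- `C` is a sum of terms, one for each requirement. Both error terms are brought below n^(-(k+1)),
and n ≥ 2 makes each at most half of n^(-k). -/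
lemma exists_time_constant {κ c₀ g : ℝ} (B : ℝ) (hκ : 0 < κ) (hκ1 : κ ≤ 1) (hc₀ : 0 < c₀)
    (hg : 0 < g) (k : ℕ) : ∃ C : ℝ, 0 < C ∧ ∀ n D T : ℕ, 2 ≤ n →
      C * (D + Real.log n) ≤ T → B ≤ (T / 6 : ℕ) ∧ Real.log n ≤ (T / 300 : ℕ) * g ∧
        T * (4 * n * Real.exp (-(c₀ * (T / 6 : ℕ)))) +
          n * Real.exp (-(κ / 2 * (κ / 2 * ((T / 6 : ℕ) - 1) - D))) ≤ (n : ℝ) ^ (-(k : ℝ)) := by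
  have hκ2 : 0 < κ ^ 2 := by positivity
  refine ⟨1200 + 24 * |B| + 600 / g + 96 * (k + 2) / κ ^ 2 + 24 * (k + 2 + 192 / c₀) / c₀,
    by positivity, fun n D T hn hT => ?_⟩
  set C := 1200 + 24 * |B| + 600 / g + 96 * (k + 2) / κ ^ 2 + 24 * (k + 2 + 192 / c₀) / c₀ with hC
  set L := Real.log n with hL
  have hn' : (2 : ℝ) ≤ n := by exact_mod_cast hn
  have hL2 : 1 / 2 ≤ L := by
    have h1 := Real.log_two_gt_d9
    have h2 : Real.log 2 ≤ L := Real.log_le_log (by norm_num) hn'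
    linarith
  have hD : (0 : ℝ) ≤ D := Nat.cast_nonneg D
  have hX0 : 0 ≤ D + L := by linarith
  have p1 : 0 ≤ 24 * |B| := by positivity
  have p2 : 0 ≤ 600 / g := by positivity
  have p3 : 0 ≤ 96 * (k + 2) / κ ^ 2 := by positivity
  have p4 : 0 ≤ 24 * (k + 2 + 192 / c₀) / c₀ := by positivity
  have hX : ∀ a, a ≤ C → a * (D + L) ≤ T := fun a ha =>
    (mul_le_mul_of_nonneg_right ha hX0).trans hT
  have hT600 : 600 ≤ T := by
    have := hX 1200 (by linarith)
    have : (600 : ℝ) ≤ T := by linarith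
    exact_mod_cast this
  have hj : (T : ℝ) ≤ 12 * (T / 6 : ℕ) := by exact_mod_cast (by omega : T ≤ 12 * (T / 6))
  have hj' : (T : ℝ) + 24 ≤ 24 * (T / 6 : ℕ) := by
    exact_mod_cast (by omega : T + 24 ≤ 24 * (T / 6))
  have hm : (T : ℝ) ≤ 600 * (T / 300 : ℕ) := by exact_mod_cast (by omega : T ≤ 600 * (T / 300))
  refine ⟨?_, ?_, ?_⟩
  · have h1 := hX (24 * |B|) (by linarith)
    have h2 := le_abs_self B
    have h3 := mul_le_mul_of_nonneg_left (show 1 / 2 ≤ D + L by linarith) p1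
    linarith
  · have h1 := hX (600 / g) (by linarith)
    rw [div_mul_eq_mul_div, div_le_iff₀ hg] at h1
    have h2 := mul_le_mul_of_nonneg_right hm hg.le
    linarith
  have hexpL : Real.exp L = n := Real.exp_log (by linarith)
  have hhalf : Real.exp (-L) ≤ 1 / 2 := by
    rw [Real.exp_neg, hexpL, one_div]
    exact inv_anti₀ (by norm_num) hn'
  have hgoal : Real.exp (-((k + 1) * L)) ≤ 1 / 2 * (n : ℝ) ^ (-(k : ℝ)) := by
    rw [Real.rpow_def_of_pos (by linarith), show -((k + 1) * L) = -L + L * -k by ring,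
      Real.exp_add]
    gcongr
  have hfirst : T * (4 * n * Real.exp (-(c₀ * (T / 6 : ℕ)))) ≤ Real.exp (-((k + 1) * L)) := by
    have h1 := hX (24 * (k + 2 + 192 / c₀) / c₀) (by linarith)
    rw [div_mul_eq_mul_div, div_le_iff₀ hc₀] at h1
    have h2 : (k + 2 + 192 / c₀) * L ≤ c₀ * T / 24 := by
      have h3 : (k + 2 + 192 / c₀) * L ≤ (k + 2 + 192 / c₀) * (D + L) := by
        gcongr
        linarith
      linarith
    have h3 : Real.exp (-(c₀ * (T / 6 : ℕ))) ≤
        Real.exp (-(c₀ * T / 24)) * Real.exp (-(c₀ * T / 24)) := by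
      rw [← Real.exp_add]
      refine Real.exp_le_exp.2 ?_
      have := mul_le_mul_of_nonneg_left hj hc₀.le
      linarith
    have h4 : c₀ * T / 24 * Real.exp (-(c₀ * T / 24)) ≤ 1 := by
      rw [Real.exp_neg, ← div_eq_mul_inv, div_le_one (Real.exp_pos _)]
      linarith [Real.add_one_le_exp (c₀ * T / 24)]
    -- The factor `T` of the union bound is absorbed by one of the two exponentials via x e^(-x) ≤
    -- 1. The constant 96/c₀ left over becomes a power of n because L ≥ 1/2, whence 192/c₀ in `C`.
    have h5 : 96 / c₀ ≤ Real.exp (192 / c₀ * L) := by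
      have h6 : 96 / c₀ ≤ 192 / c₀ * L := by
        rw [div_mul_eq_mul_div]
        gcongr
        linarith
      linarith [Real.add_one_le_exp (192 / c₀ * L)]
    calc T * (4 * n * Real.exp (-(c₀ * (T / 6 : ℕ))))
        ≤ T * (4 * n * (Real.exp (-(c₀ * T / 24)) * Real.exp (-(c₀ * T / 24)))) := by gcongr
      _ = n * (96 / c₀) * (c₀ * T / 24 * Real.exp (-(c₀ * T / 24))) *
          Real.exp (-(c₀ * T / 24)) := by field_simp; ring
      _ ≤ Real.exp L * Real.exp (192 / c₀ * L) * 1 *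
          Real.exp (-((k + 2 + 192 / c₀) * L)) := by
        rw [hexpL]
        gcongr
      _ = Real.exp (-((k + 1) * L)) := by
        rw [mul_one, ← Real.exp_add, ← Real.exp_add]
        ring_nf
  have hsecond : n * Real.exp (-(κ / 2 * (κ / 2 * ((T / 6 : ℕ) - 1) - D))) ≤
      Real.exp (-((k + 1) * L)) := by
    have h1 := hX (96 * (k + 2) / κ ^ 2) (by linarith)
    rw [div_mul_eq_mul_div, div_le_iff₀ hκ2] at h1
    have h2 := mul_le_mul_of_nonneg_left hj' hκ2.le
    have h3 : κ * D ≤ 1 * D := mul_le_mul_of_nonneg_right hκ1 hD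
    have h4 : 0 ≤ (k : ℝ) * D := by positivity
    calc n * Real.exp (-(κ / 2 * (κ / 2 * ((T / 6 : ℕ) - 1) - D)))
        ≤ Real.exp L * Real.exp (-((k + 2) * L)) := by
          rw [hexpL]
          refine mul_le_mul_of_nonneg_left (Real.exp_le_exp.2 (neg_le_neg ?_)) (Nat.cast_nonneg n)
          linarith
      _ = Real.exp (-((k + 1) * L)) := by
        rw [← Real.exp_add]
        ring_nf
  linarith

/-- `S` depends only on the model: it is large compared with the packing number `N` divided by the
success rates. Only `C` depends on `k`, so a single program serves all `k`. -/
theorem broadcast_spec (M : Model) : ∃ S : ℕ, ∀ k : ℕ, ∃ C : ℝ, 0 < C ∧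
    ∀ (V : Type) [Fintype V] [MetricSpace V], Bounded M V → (commGraph M V).Connected →
      ∀ (s : V) (adv : Adversary V), Admissible M (broadcast S) s adv → ∀ T : ℕ,
        C * (((commGraph M V).diam : ℝ) + Real.log (Fintype.card V)) ≤ T →
        (law M (broadcast S) s adv T).toOuterMeasure {h | ¬ ∀ v : V, v ∈ informed s h} ≤
          ENNReal.ofReal ((Fintype.card V : ℝ) ^ (-(k : ℝ))) := by
  obtain ⟨c⟩ := exists_scale M
  have hw := c.winRate_pos
  have hn := c.notifyRate_pos
  have hwn := mul_pos hw hn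
  obtain ⟨S', hS'⟩ := exists_nat_ge (2000 * c.N / (c.winRate * c.notifyRate))
  set S := S' + 1 with hSdef
  have hS1 : 1 ≤ S := by omega
  have hS : 2000 * c.N ≤ c.winRate * c.notifyRate * S := by
    rw [div_le_iff₀ hwn] at hS'
    rw [hSdef]
    push_cast
    nlinarith
  obtain ⟨γ, hγ, hγ', hγS⟩ := exists_growth S
  have hSpos : (1 : ℝ) ≤ S := by exact_mod_cast hS1
  have hκ0 : 0 < c.rate / (8 * S) := div_pos c.rate_pos (by linarith)
  have hκ1 : c.rate / (8 * S) ≤ 1 := by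
    rw [div_le_one (by linarith)]
    linarith [c.rate_le_one]
  refine ⟨S, fun k => ?_⟩
  obtain ⟨C, hC, hT⟩ := exists_time_constant
    (max (1000 / c.winRate) (2000 * c.N / (c.winRate * c.notifyRate))) hκ0 hκ1
    (by positivity : 0 < c.winRate ^ 2 * c.notifyRate ^ 2 / 10000) (Real.log_pos hγ) k
  refine ⟨C, hC, fun V _ _ hV hconn s adv hadm T hCT => ?_⟩
  have hpos : 0 < Fintype.card V := Fintype.card_pos_iff.2 ⟨s⟩
  rcases Nat.lt_or_ge (Fintype.card V) 2 with h1 | h2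
  -- With a single node the claimed bound on the failure probability is 1.
  · rw [show Fintype.card V = 1 by omega, Nat.cast_one, Real.one_rpow, ENNReal.ofReal_one]
    exact toOuterMeasure_le_one _ _
  · obtain ⟨hB, hlog, hfin⟩ := hT _ _ T h2 hCT
    obtain ⟨hB1, hB2⟩ := max_le_iff.1 hB
    refine (law_not_informed_le c hV hconn hS1 hS hγ.le hγ' hγS hadm (j := T / 6) (m := T / 300)
      (Nat.mul_div_le T 6) ?_ ?_ ?_ ?_ rfl rfl).trans (ENNReal.ofReal_le_ofReal hfin)
    · rwa [div_le_iff₀' hw] at hB1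
    · rwa [div_le_iff₀' hwn] at hB2
    -- The burn-in of T/300 elections is at most a fiftieth of `j`, as `le_hits` demands.
    · rw [show T / 300 = T / 6 / 50 by rw [Nat.div_div_eq_div_mul]]
      exact_mod_cast Nat.cast_div_le (α := ℝ) (m := T / 6) (n := 50)
    · rw [← Real.log_le_log_iff (by exact_mod_cast hpos) (pow_pos (by linarith) _), Real.log_pow]
      exact hlog

end WirelessBroadcast


end

theorem mainTheorem6 (M : WirelessBroadcast.Model) :
    ∃ A : WirelessBroadcast.Algorithm, ∀ k : ℕ, ∃ C : ℝ, 0 < C ∧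
      ∀ (V : Type) [Fintype V] [MetricSpace V],
        WirelessBroadcast.BoundedIndependence V (M.ε * M.R / 8) M.lam M.Cind →
        (WirelessBroadcast.commGraph M V).Connected →
        ∀ (s : V) (adv : WirelessBroadcast.Adversary V),
          WirelessBroadcast.Admissible M A s adv →
          ∀ T : ℕ,
            C * (((WirelessBroadcast.commGraph M V).diam : ℝ) + Real.log (Fintype.card V)) ≤ T →
            (WirelessBroadcast.law M A s adv T).toOuterMeasure
                {h | ¬ ∀ v : V, v ∈ WirelessBroadcast.informed s h} ≤
              ENNReal.ofReal ((Fintype.card V : ℝ) ^ (-(k : ℝ))) := by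
  obtain ⟨S, hS⟩ := WirelessBroadcast.broadcast_spec M
  exact ⟨WirelessBroadcast.broadcast S, hS⟩
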